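/- **Setting.** Let $f=L_1^{s_1}\cdots L_n^{s_n}$ with $n\ge 1$, where each $L_i\in\mathbb{C}[x_1,\dots,x_d]$ is a nonzero linear form (homogeneous of degree $1$; the $L_i$ need not be pairwise non-proportional) and the $s_i$ are positive integers. Put $H_i=\{L_i=0\}\subset\mathbb{C}^d$ and $\mathcal{A}=\{H_1,\dots,H_n\}$, and let $L(\mathcal{A})$ be the set of all intersections of members of $\mathcal{A}$, except for the ambient space $\mathbb{C}^d$. For $W\in L(\mathcal{A})$ put $s(W)=\sum_{j:\,W\subseteq H_j}s_j$. A subset $\mathcal{G}\subseteq L(\mathcal{A})$ is a *building set* if for every $C\in L(\mathcal{A})$ the minimal elements of $\{U\in\mathcal{G}: C\subseteq U\}$ have intersection $C$ and intersect transversally (their codimensions add up to $\operatorname{codim} C$). **Log canonical threshold.** A *log resolution* of $(\mathbb{C}^d,\operatorname{div} f)$ is a proper holomorphic map $\rho:X\to\mathbb{C}^d$ from a connected (Hausdorff) complex manifold of dimension $d$ that is biholomorphic over a nonempty Zariski open subset of $\mathbb{C}^d$ and such that $\rho^*\operatorname{div} f+\operatorname{Exc}(\rho)$ has finitely many prime components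 $E_i$ and simple normal crossing support. Write $\operatorname{div}(f\circ\rho)=\sum_i a_iE_i$, and let $K_\rho=\sum_i b_iE_i$ be the relative canonical divisor, which is locally the divisor of the Jacobian determinant of $\rho$ (so $a_i,b_i\ge 0$, not both zero). The log canonical threshold of $f$ and its multiplicity are $$\lambda_{\mathbb{C}}=\min_{i:\,a_i>0}\frac{b_i+1}{a_i},\qquad m_{\mathbb{C}}=\max_{P\in X}\Big|\Big\{i : a_i>0,\ \frac{b_i+1}{a_i}=\lambda_{\mathbb{C}},\ P\in E_i\Big\}\Big|.$$ **Theorem.** Log resolutions of $(\mathbb{C}^d,\operatorname{div} f)$ exist, the pair $(\lambda_{\mathbb{C}},m_{\mathbb{C}})$ is the same for all of them, and for every building set $\mathcal{G}$ of $\mathcal{A}$ $$\lambda_{\mathbb{C}}=\min_{W\in\mathcal{G}}\frac{\operatorname{codim}(W)}{s(W)},\qquad m_{\mathbb{C}}=\max_{\substack{W_0\subseteq\cdots\subseteq W_{d-1}\\ W_i\in L(\mathcal{A})}}\Big|\Big\{W\in\{W_0,\dots,W_{d-1}\} : \frac{\operatorname{codim}(W)}{s(W)}=\lambda_{\mathbb{C}}\Big\}\Big|.$$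 Here the inclusions need not be strict, and the cardinality counts distinct subspaces $W$, not indices. -/

import Mathlib

open scoped Manifold ContDiff

noncomputable section

namespace Arrangement

/-! ### Linear forms, intersection lattices, building sets -/

/-- The linear functional `x ↦ ∑ j, c_j x_j`, where `c_j` is the coefficient of `X_j` in `p`. -/
def linearFunctional {d : ℕ} (p : MvPolynomial (Fin d) ℂ) : (Fin d → ℂ) →ₗ[ℂ] ℂ :=
  ∑ j, MvPolynomial.coeff (Finsupp.single j 1) p • LinearMap.proj j

/-- The hyperplane through the origin defined by a linear form `p`, see `mem_hyperplane`. -/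
def hyperplane {d : ℕ} (p : MvPolynomial (Fin d) ℂ) : Submodule ℂ (Fin d → ℂ) :=
  LinearMap.ker (linearFunctional p)

/-- `hyperplane p` is the zero locus of `p`, for every linear form `p`. -/
theorem mem_hyperplane {d : ℕ} {p : MvPolynomial (Fin d) ℂ} (hp : p.IsHomogeneous 1)
    (x : Fin d → ℂ) : x ∈ hyperplane p ↔ MvPolynomial.eval x p = 0 := by
  have key : MvPolynomial.eval x p = linearFunctional p x := by
    have hinj : Function.Injective (fun j : Fin d => (Finsupp.single j 1 : Fin d →₀ ℕ)) :=
      Finsupp.single_left_injective one_ne_zero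
    have hsub : p.support ⊆ Finset.univ.map ⟨_, hinj⟩ := by
      intro m hm
      have h1 : m.degree = 1 := by
        rw [Finsupp.degree_eq_weight_one]
        exact hp (MvPolynomial.mem_support_iff.1 hm)
      obtain ⟨j, hj⟩ := (Finsupp.sum_eq_one_iff m).1 h1
      simp [hj]
    rw [MvPolynomial.eval_eq, Finset.sum_subset hsub
      (fun m _ hm => by rw [MvPolynomial.notMem_support_iff.1 hm, zero_mul]), Finset.sum_map]
    simp only [linearFunctional, LinearMap.coe_sum, Finset.sum_apply, LinearMap.smul_apply,
      LinearMap.coe_proj, Function.eval, smul_eq_mul, Function.Embedding.coeFn_mk]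
    refine Finset.sum_congr rfl fun j _ => ?_
    congr 1
    rw [Finset.prod_eq_single j]
    · simp
    · intro i _ hij
      simp [hij.symm]
    · simp
  rw [hyperplane, LinearMap.mem_ker, key]

/-- The codimension of a linear subspace of `ℂ^d`. -/
def codim {d : ℕ} (W : Submodule ℂ (Fin d → ℂ)) : ℕ :=
  Module.finrank ℂ ((Fin d → ℂ) ⧸ W)

/-- `L(𝒜)`: all intersections of members of `𝒜`, except for the ambient space. -/
def intersectionLattice {d : ℕ} (𝒜 : Set (Submodule ℂ (Fin d → ℂ))) :
    Set (Submodule ℂ (Fin d → ℂ)) :=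
  {W | W ≠ ⊤ ∧ ∃ S ⊆ 𝒜, W = sInf S}

/-- `𝒢 ⊆ L(𝒜)` is a building set: for every `C ∈ L(𝒜)`, the minimal elements among the members of
`𝒢` that contain `C` have intersection `C`, and they intersect transversally, that is, their
codimensions add up to that of their intersection. -/
def IsBuildingSet {d : ℕ} (𝒜 𝒢 : Set (Submodule ℂ (Fin d → ℂ))) : Prop :=
  𝒢 ⊆ intersectionLattice 𝒜 ∧
    ∀ C ∈ intersectionLattice 𝒜,
      sInf {U | Minimal (fun U => U ∈ 𝒢 ∧ C ≤ U) U} = C ∧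
      ∑ᶠ U ∈ {U | Minimal (fun U => U ∈ 𝒢 ∧ C ≤ U) U}, codim U = codim C

open Classical in
/-- `s(W)`: the sum of the exponents `s_j` over all `j` with `W ⊆ H_j`. -/
def weight {d n : ℕ} (H : Fin n → Submodule ℂ (Fin d → ℂ)) (s : Fin n → ℕ)
    (W : Submodule ℂ (Fin d → ℂ)) : ℕ :=
  ∑ j with W ≤ H j, s j

/-- `codim(W) / s(W)`. -/
def slope {d n : ℕ} (H : Fin n → Submodule ℂ (Fin d → ℂ)) (s : Fin n → ℕ)
    (W : Submodule ℂ (Fin d → ℂ)) : ℝ :=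
  (codim W : ℝ) / (weight H s W : ℝ)

/-! ### Log resolutions and the log canonical threshold -/

open Classical in
/-- A log resolution of the pair `(ℂ^d, div f)`: a connected complex manifold `X` of dimension `d`
with a proper holomorphic map `ρ : X → ℂ^d` that is biholomorphic over a nonempty Zariski open set
and for which `ρ^* div f + Exc ρ` has simple normal crossings.

The `E i` are the prime divisors of `ρ^* div f + Exc ρ`. They are regular (by `snc`) and connected,
hence irreducible; `div (f ∘ ρ) = ∑ i, a i • E i`, and the relative canonical divisor, locally
defined by the Jacobian determinant of `ρ`, is `∑ i, b i • E i`. The exceptional prime divisors are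
those with `0 < b i`. -/
structure LogResolution {d : ℕ} (f : MvPolynomial (Fin d) ℂ) where
  /-- the source of the resolution -/
  X : Type
  [topX : TopologicalSpace X]
  [t2X : T2Space X]
  [connX : ConnectedSpace X]
  [chartedX : ChartedSpace (Fin d → ℂ) X]
  [manifoldX : IsManifold 𝓘(ℂ, Fin d → ℂ) ω X]
  /-- the resolution map -/
  ρ : X → (Fin d → ℂ)
  holomorphic : ContMDiff 𝓘(ℂ, Fin d → ℂ) 𝓘(ℂ, Fin d → ℂ) ω ρ
  proper : IsProperMap ρ
  birational : ∃ g : MvPolynomial (Fin d) ℂ, g ≠ 0 ∧ ∃ τ : (Fin d → ℂ) → X,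
    ContMDiffOn 𝓘(ℂ, Fin d → ℂ) 𝓘(ℂ, Fin d → ℂ) ω τ {y | MvPolynomial.eval y g ≠ 0} ∧
    (∀ y, MvPolynomial.eval y g ≠ 0 → ρ (τ y) = y) ∧
    (∀ x, MvPolynomial.eval (ρ x) g ≠ 0 → τ (ρ x) = x)
  /-- the index set of the prime divisors -/
  ι : Type
  [fintypeι : Fintype ι]
  /-- the prime divisors of `ρ^* div f + Exc ρ` -/
  E : ι → Set X
  isClosed_E : ∀ i, IsClosed (E i)
  isConnected_E : ∀ i, IsConnected (E i)
  /-- the multiplicities of the pullback of `f` -/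
  a : ι → ℕ
  /-- the multiplicities of the relative canonical divisor -/
  b : ι → ℕ
  supported : ∀ i, 0 < a i ∨ 0 < b i
  /-- At every point `P` there are local coordinates `φ = (u_1, …, u_d)` centred at `P` in which
  the `E i` through `P` are pairwise distinct coordinate hyperplanes `u_{j i} = 0`, while `f ∘ ρ`
  and the Jacobian determinant of `ρ` are units times the monomials `∏ u_{j i} ^ a i` and
  `∏ u_{j i} ^ b i`. -/
  snc : ∀ P : X, ∃ φ ∈ IsManifold.maximalAtlas 𝓘(ℂ, Fin d → ℂ) ω X,
    P ∈ φ.source ∧ φ P = 0 ∧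
    ∃ j : ι → Fin d, Set.InjOn j {i | P ∈ E i} ∧
      (∀ i, P ∈ E i → ∀ x ∈ φ.source, x ∈ E i ↔ φ x (j i) = 0) ∧
      (∀ i, P ∉ E i → ∀ x ∈ φ.source, x ∉ E i) ∧
      ∃ h h' : (Fin d → ℂ) → ℂ,
        AnalyticOnNhd ℂ h φ.target ∧ AnalyticOnNhd ℂ h' φ.target ∧
        ∀ u ∈ φ.target, h u ≠ 0 ∧ h' u ≠ 0 ∧
          MvPolynomial.eval (ρ (φ.symm u)) f = h u * ∏ i with P ∈ E i, u (j i) ^ a i ∧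
          (fderiv ℂ (fun v => ρ (φ.symm v)) u).det = h' u * ∏ i with P ∈ E i, u (j i) ^ b i

attribute [instance] LogResolution.topX LogResolution.t2X LogResolution.connX
  LogResolution.chartedX LogResolution.manifoldX LogResolution.fintypeι

/-- `(b_i + 1) / a_i`, to be used for the prime divisors of `div (f ∘ ρ)`, i.e. if `0 < a i`. -/
def LogResolution.ratio {d : ℕ} {f : MvPolynomial (Fin d) ℂ} (R : LogResolution f) (i : R.ι) : ℝ :=
  ((R.b i : ℝ) + 1) / (R.a i : ℝ)

/-- The log resolution `R` computes the pair `(lam, m)`: `lam` is the minimum of the numbers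
`(b_i + 1) / a_i` over the prime divisors `E i` of `div (f ∘ ρ)`, and `m` is the maximal number of
those `E i` that attain it and pass through one point of `X`. -/
def LogResolution.Computes {d : ℕ} {f : MvPolynomial (Fin d) ℂ} (R : LogResolution f)
    (lam : ℝ) (m : ℕ) : Prop :=
  IsLeast {r : ℝ | ∃ i, 0 < R.a i ∧ r = R.ratio i} lam ∧
    IsGreatest {k : ℕ | ∃ P : R.X,
      k = Set.ncard {i | 0 < R.a i ∧ lam = R.ratio i ∧ P ∈ R.E i}} m

/-- `lct(f) = (lam, m)`: the polynomial `f` has log canonical threshold `lam` with multiplicity `m`.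
The pair is well defined (log resolutions exist) and does not depend on the log resolution. -/
def IsLCT {d : ℕ} (f : MvPolynomial (Fin d) ℂ) (lam : ℝ) (m : ℕ) : Prop :=
  Nonempty (LogResolution f) ∧ ∀ R : LogResolution f, R.Computes lam m

end Arrangement

end

/-!
The proof constructs one explicit log resolution, reads the pair `(lam, m)` off its divisors, and
compares it with all other log resolutions by an integral that depends on `f` only.

*The model.* Adjoin the coordinate functions to the given forms, so that the family `F j` spans.
`Family.Model` is the closure of the graph of all ratios `F j / F k`, as points of the projective
line, on the complement of the hyperplanes. (It is the wonderful model whose building set is the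
whole intersection lattice.) It is proper over `ℂ^d`, since the projective line is compact. Near a
point of the model the forms are totally ordered by their growth. A greedy choice with respect to
this order (`exists_greedy_basis`) gives a basis `F (β 0), …, F (β (d - 1))` among the forms in
which every form is a combination of basis elements that are not larger than itself. In the
coordinates `u` with `F (β i) = u_0 ⋯ u_i` every form is then the monomial `u_0 ⋯ u_l` of its first
basis element times a unit (`dotProduct_pt`), and all ratios are determined by `u`. These
coordinates are charts of a complex manifold (`Family.exists_mem_coordDomain`, `Family.chart`), in
which the resolution map has the Jacobian determinant `∏ u_p ^ (d - 1 - p)` up to a constant.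

*The divisors.* The hyperplane `u_p = 0` is the divisor of the flat `W` cut out by the basis
elements from the `p`-th one on (`Family.chartPt_mem_divisor_iff`), with `a = s(W)` and
`b = codim W - 1`; hence the ratio `(b + 1) / a` is the slope of `W`. The divisors of a set of flats
have a common point if and only if the flats form a chain (`Family.exists_mem_divisors`,
`Family.isChain_divisors`). Each divisor is connected: it is the closure of the set of
limits of `w + t v` for `t → 0`, with `w` generic in `W` and `v` generic modulo `W`
(`Family.isConnected_divisor`).

*Independence.* For a log resolution that computes `(lam, m)`, the integral of `|f| ^ (-2 s)` over a
large ball grows like `(lam - s) ^ (-m)` as `s` increases to `lam`: in normal crossing coordinates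
it is a product of integrals of one variable, which have a simple pole at `lam` if
`lam * a = b + 1`, and none otherwise (`exists_zetaIntegral_bounds`). So `(lam, m)` is determined by
`f` (`LogResolution.Computes.of_other`).

*Building sets.* The smallest slope on a building set is the smallest slope on the whole lattice:
codimensions add up over the minimal elements above `C`, and weights are subadditive, because every
hyperplane is in the building set (`IsBuildingSet.mul_weight_le`). A flat that involves adjoined
coordinate functions has slope at least that of the intersection of the given hyperplanes
containing it, with equality only if it is in the lattice (`exists_lattice_slope_le`), so these
flats affect neither the minimum nor the multiplicity.
-/

noncomputable section

namespace Arrangement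

open Matrix

/-! ### Bases among linear forms -/

variable {d : ℕ} {J : Type}

/-- The matrix whose rows are the forms `F (β 0), …, F (β (d - 1))`. -/
def rows (F : J → Fin d → ℂ) (β : Fin d → J) : Matrix (Fin d) (Fin d) ℂ :=
  Matrix.of fun i => F (β i)

/-- The coordinates of the form `F j` with respect to the forms `F (β i)`. -/
def coef (F : J → Fin d → ℂ) (β : Fin d → J) (j : J) : Fin d → ℂ :=
  F j ᵥ* (rows F β)⁻¹

theorem coef_vecMul {F : J → Fin d → ℂ} {β : Fin d → J} (hβ : (rows F β).det ≠ 0) (j : J) :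
    coef F β j ᵥ* rows F β = F j := by
  rw [coef, vecMul_vecMul, nonsing_inv_mul _ (Ne.isUnit hβ), vecMul_one]

theorem coef_self {F : J → Fin d → ℂ} {β : Fin d → J} (hβ : (rows F β).det ≠ 0) (i : Fin d) :
    coef F β (β i) = Pi.single i 1 := by
  have h : F (β i) = Pi.single i 1 ᵥ* rows F β := by
    rw [single_one_vecMul]; rfl
  rw [coef, h, vecMul_vecMul, mul_nonsing_inv _ (Ne.isUnit hβ), vecMul_one]

theorem dotProduct_eq_sum_coef {F : J → Fin d → ℂ} {β : Fin d → J} (hβ : (rows F β).det ≠ 0)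
    (j : J) (x : Fin d → ℂ) : F j ⬝ᵥ x = ∑ i, coef F β j i * (F (β i) ⬝ᵥ x) := by
  conv_lhs => rw [← coef_vecMul hβ j, ← dotProduct_mulVec]
  rfl

theorem exists_coef_ne_zero {F : J → Fin d → ℂ} {β : Fin d → J} (hβ : (rows F β).det ≠ 0)
    {j : J} (hj : F j ≠ 0) : ∃ i, coef F β j i ≠ 0 := by
  by_contra! h
  apply hj
  rw [← coef_vecMul hβ j, funext h]
  exact zero_vecMul _

/-- The determinant after replacing one of the chosen forms by `F j`. -/
theorem det_rows_update [DecidableEq J] {F : J → Fin d → ℂ} {β : Fin d → J}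
    (hβ : (rows F β).det ≠ 0) (i : Fin d) (j : J) :
    (rows F (Function.update β i j)).det = coef F β j i * (rows F β).det := by
  have h : rows F (Function.update β i j) =
      (rows F β).updateRow i (∑ k, coef F β j k • rows F β k) := by
    ext a b
    by_cases hab : a = i
    · subst hab
      simp only [rows, of_apply, Function.update_self, updateRow_self]
      have := congrFun (coef_vecMul hβ j) b
      rw [← this]
      simp [vecMul, dotProduct, rows]
    · simp [rows, updateRow_ne hab, Function.update_of_ne hab]
  rw [h, det_updateRow_sum, smul_eq_mul]

/-- Greedy choice of a basis. For every weight `v` on a finite spanning family of linear forms there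
is a basis among them, ordered by decreasing weight, such that every form of the family is a
combination of basis elements of at most its own weight. A basis of minimal total weight has this
property, by exchange. -/
theorem exists_greedy_basis [Finite J] {F : J → Fin d → ℂ}
    (hF : ∃ β : Fin d → J, (rows F β).det ≠ 0) (v : J → ℕ) :
    ∃ β : Fin d → J, (rows F β).det ≠ 0 ∧ Antitone (v ∘ β) ∧
      ∀ j i, coef F β j i ≠ 0 → v (β i) ≤ v j := by
  classical
  have hne : {β : Fin d → J | (rows F β).det ≠ 0}.Nonempty := hF
  obtain ⟨β, hβ, hmin⟩ := Set.exists_min_image _ (fun β => ∑ i, v (β i)) (Set.toFinite _) hne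
  have key : ∀ j i, coef F β j i ≠ 0 → v (β i) ≤ v j := by
    intro j i hij
    have := hmin (Function.update β i j) (by
      simp only [Set.mem_ofPred_eq, det_rows_update hβ]
      exact mul_ne_zero hij hβ)
    have hsum : ∑ k ∈ Finset.univ.erase i, v (Function.update β i j k) =
        ∑ k ∈ Finset.univ.erase i, v (β k) :=
      Finset.sum_congr rfl fun k hk => by
        rw [Function.update_of_ne (Finset.ne_of_mem_erase hk)]
    rw [← Finset.add_sum_erase _ _ (Finset.mem_univ i),
      ← Finset.add_sum_erase _ (fun k => v (Function.update β i j k)) (Finset.mem_univ i),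
      Function.update_self, hsum] at this
    exact le_of_add_le_add_right this
  -- reorder by decreasing weight
  let σ : Equiv.Perm (Fin d) := (Fin.revPerm).trans (Tuple.sort (v ∘ β))
  have hrows : rows F (β ∘ σ) = (rows F β).submatrix σ id := rfl
  have hdet : (rows F (β ∘ σ)).det ≠ 0 := by
    rw [hrows, det_permute]
    exact mul_ne_zero (by simp) hβ
  refine ⟨β ∘ σ, hdet, ?_, ?_⟩
  · intro a b hab
    exact Tuple.monotone_sort (v ∘ β) (Fin.rev_le_rev.2 hab)
  · intro j i hij
    have hc : coef F (β ∘ σ) j = coef F β j ∘ σ := by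
      have h1 : (coef F β j ∘ σ) ᵥ* rows F (β ∘ σ) = F j := by
        rw [← coef_vecMul hβ j, hrows]
        ext b
        simp only [vecMul, dotProduct, Function.comp, submatrix_apply, id]
        exact Equiv.sum_comp σ (fun i => coef F β j i * rows F β i b)
      rw [coef, ← h1, vecMul_vecMul, mul_nonsing_inv _ (Ne.isUnit hdet), vecMul_one]
    rw [hc] at hij
    exact key j (σ i) hij

/-! ### Monomial coordinates -/

open Classical in
/-- The first basis element that occurs in `F j`. -/
def lead [NeZero d] (F : J → Fin d → ℂ) (β : Fin d → J) (j : J) : Fin d :=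
  Classical.epsilon fun i => coef F β j i ≠ 0 ∧ ∀ k < i, coef F β j k = 0

theorem lead_spec [NeZero d] {F : J → Fin d → ℂ} {β : Fin d → J} (hβ : (rows F β).det ≠ 0)
    {j : J} (hj : F j ≠ 0) :
    coef F β j (lead F β j) ≠ 0 ∧ ∀ k < lead F β j, coef F β j k = 0 := by
  classical
  apply Classical.epsilon_spec (p := fun i => coef F β j i ≠ 0 ∧ ∀ k < i, coef F β j k = 0)
  have hne : (Finset.univ.filter fun i => coef F β j i ≠ 0).Nonempty := by
    obtain ⟨i, hi⟩ := exists_coef_ne_zero hβ hj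
    exact ⟨i, by simpa using hi⟩
  refine ⟨Finset.min' _ hne, by simpa using Finset.min'_mem _ hne, fun k hk => ?_⟩
  by_contra h
  exact absurd (Finset.min'_le _ k (by simpa using h)) (not_le.2 hk)

theorem lead_self [NeZero d] {F : J → Fin d → ℂ} {β : Fin d → J} (hβ : (rows F β).det ≠ 0)
    (hF : ∀ j, F j ≠ 0) (i : Fin d) : lead F β (β i) = i := by
  by_contra h
  apply (lead_spec hβ (hF (β i))).1
  rw [coef_self hβ, Pi.single_eq_of_ne h]

/-- The product `u_0 ⋯ u_i`. -/
def mono (i : Fin d) (u : Fin d → ℂ) : ℂ := ∏ q ∈ Finset.Iic i, u q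

/-- The product of the `u_q` with `p < q ≤ i`. -/
def seg (p i : Fin d) (u : Fin d → ℂ) : ℂ := ∏ q ∈ Finset.Ioc p i, u q

theorem mono_mul_seg {p i : Fin d} (h : p ≤ i) (u : Fin d → ℂ) :
    mono p u * seg p i u = mono i u := by
  rw [mono, seg, mono, ← Finset.prod_union]
  · congr 1
    ext q
    simp only [Finset.mem_union, Finset.mem_Iic, Finset.mem_Ioc]
    constructor
    · rintro (h' | h')
      · exact h'.trans h
      · exact h'.2
    · intro h'
      rcases le_or_gt q p with h1 | h1
      · exact Or.inl h1
      · exact Or.inr ⟨h1, h'⟩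
  · rw [Finset.disjoint_left]
    intro q hq hq'
    exact absurd (Finset.mem_Ioc.1 hq').1 (not_lt.2 (Finset.mem_Iic.1 hq))

theorem seg_of_le {p i : Fin d} (h : i ≤ p) (u : Fin d → ℂ) : seg p i u = 1 := by
  rw [seg, Finset.Ioc_eq_empty (not_lt.2 h), Finset.prod_empty]

theorem seg_ne_zero {u : Fin d → ℂ} (hu : ∀ i, u i ≠ 0) (p i : Fin d) : seg p i u ≠ 0 :=
  Finset.prod_ne_zero_iff.2 fun q _ => hu q

theorem mono_ne_zero {u : Fin d → ℂ} (hu : ∀ i, u i ≠ 0) (i : Fin d) : mono i u ≠ 0 :=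
  Finset.prod_ne_zero_iff.2 fun q _ => hu q

/-- The monomials in front of two forms have the ratio of the complementary segments. -/
theorem mono_mul_seg_comm (p i : Fin d) (u : Fin d → ℂ) :
    mono p u * seg p i u = mono i u * seg i p u := by
  rcases le_total p i with h | h
  · rw [mono_mul_seg h, seg_of_le h, mul_one]
  · rw [mono_mul_seg h, seg_of_le h, mul_one]

/-- The point with coordinates `F (β i) = u_0 ⋯ u_i`. -/
def pt (F : J → Fin d → ℂ) (β : Fin d → J) (u : Fin d → ℂ) : Fin d → ℂ :=
  (rows F β)⁻¹ *ᵥ fun i => mono i u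

theorem dotProduct_pt_self {F : J → Fin d → ℂ} {β : Fin d → J} (hβ : (rows F β).det ≠ 0)
    (i : Fin d) (u : Fin d → ℂ) : F (β i) ⬝ᵥ pt F β u = mono i u := by
  have : rows F β *ᵥ pt F β u = fun i => mono i u := by
    rw [pt, mulVec_mulVec, mul_nonsing_inv _ (Ne.isUnit hβ), one_mulVec]
  exact congrFun this i

/-- The form `F j` at `pt F β u`, divided by its leading monomial. -/
def unitPart [NeZero d] (F : J → Fin d → ℂ) (β : Fin d → J) (j : J) (u : Fin d → ℂ) : ℂ :=
  ∑ i, coef F β j i * seg (lead F β j) i u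

theorem dotProduct_pt [NeZero d] {F : J → Fin d → ℂ} {β : Fin d → J} (hβ : (rows F β).det ≠ 0)
    {j : J} (hj : F j ≠ 0) (u : Fin d → ℂ) :
    F j ⬝ᵥ pt F β u = mono (lead F β j) u * unitPart F β j u := by
  rw [dotProduct_eq_sum_coef hβ, unitPart, Finset.mul_sum]
  refine Finset.sum_congr rfl fun i _ => ?_
  rw [dotProduct_pt_self hβ]
  rcases le_or_gt (lead F β j) i with h | h
  · rw [← mono_mul_seg h]; ring
  · rw [(lead_spec hβ hj).2 i h]; ring

theorem unitPart_self [NeZero d] {F : J → Fin d → ℂ} {β : Fin d → J} (hβ : (rows F β).det ≠ 0)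
    (hF : ∀ j, F j ≠ 0) (i : Fin d) (u : Fin d → ℂ) : unitPart F β (β i) u = 1 := by
  rw [unitPart, coef_self hβ, lead_self hβ hF, Finset.sum_eq_single i]
  · simp [seg_of_le]
  · intro k _ hk
    simp [Pi.single_eq_of_ne hk]
  · simp

theorem unitPart_zero_ne_zero [NeZero d] {F : J → Fin d → ℂ} {β : Fin d → J}
    (hβ : (rows F β).det ≠ 0) {j : J} (hj : F j ≠ 0) : unitPart F β j 0 ≠ 0 := by
  rw [unitPart, Finset.sum_eq_single (lead F β j)]
  · rw [seg_of_le le_rfl, mul_one]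
    exact (lead_spec hβ hj).1
  · intro k _ hk
    rcases lt_or_gt_of_ne hk with h | h
    · rw [(lead_spec hβ hj).2 k h, zero_mul]
    · rw [seg, Finset.prod_eq_zero (Finset.mem_Ioc.2 ⟨h, le_rfl⟩) rfl, mul_zero]
  · simp

theorem analyticAt_seg (p i : Fin d) (u : Fin d → ℂ) : AnalyticAt ℂ (seg p i) u :=
  Finset.analyticAt_fun_prod _ fun q _ =>
    (ContinuousLinearMap.proj (R := ℂ) (φ := fun _ : Fin d => ℂ) q).analyticAt u

theorem analyticAt_mono (i : Fin d) (u : Fin d → ℂ) : AnalyticAt ℂ (mono i) u :=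
  Finset.analyticAt_fun_prod _ fun q _ =>
    (ContinuousLinearMap.proj (R := ℂ) (φ := fun _ : Fin d => ℂ) q).analyticAt u

theorem analyticAt_unitPart [NeZero d] (F : J → Fin d → ℂ) (β : Fin d → J) (j : J)
    (u : Fin d → ℂ) : AnalyticAt ℂ (unitPart F β j) u :=
  Finset.analyticAt_fun_sum _ fun i _ => analyticAt_const.mul (analyticAt_seg _ i u)

theorem analyticAt_pt (F : J → Fin d → ℂ) (β : Fin d → J) (u : Fin d → ℂ) :
    AnalyticAt ℂ (pt F β) u :=
  ((Matrix.mulVecLin (rows F β)⁻¹).toContinuousLinearMap.analyticAt _).comp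
    (analyticAt_pi_iff.2 fun i => analyticAt_mono i u)

end Arrangement

namespace Arrangement

open Matrix Topology Filter

/-! ### Ratios in the projective line -/

/-- The ratio `a / b` as a point of the projective line `OnePoint ℂ`; it is meaningful for
`(a, b) ≠ (0, 0)`. -/
def ratio (a b : ℂ) : OnePoint ℂ := open Classical in if b = 0 then OnePoint.infty else ↑(a / b)

/-- The finite value of a point of the projective line, with `0` at infinity. -/
def finiteValue (z : OnePoint ℂ) : ℂ := z.elim 0 id

@[simp] theorem finiteValue_coe (z : ℂ) : finiteValue z = z := rfl

theorem ratio_of_ne_zero {a b : ℂ} (hb : b ≠ 0) : ratio a b = ↑(a / b) := if_neg hb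

theorem ratio_zero_right (a : ℂ) : ratio a 0 = OnePoint.infty := if_pos rfl

theorem finiteValue_ratio (a b : ℂ) : finiteValue (ratio a b) = a / b := by
  by_cases hb : b = 0
  · subst hb; rw [ratio_zero_right, div_zero]; rfl
  · rw [ratio_of_ne_zero hb, finiteValue_coe]

theorem ratio_ne_infty_iff {a b : ℂ} : ratio a b ≠ OnePoint.infty ↔ b ≠ 0 := by
  by_cases hb : b = 0
  · simp [hb, ratio_zero_right]
  · simp [hb, ratio_of_ne_zero hb]

theorem ratio_eq_zero_iff {a b : ℂ} : ratio a b = ((0 : ℂ) : OnePoint ℂ) ↔ a = 0 ∧ b ≠ 0 := by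
  by_cases hb : b = 0
  · simp [hb, ratio_zero_right]
  · simp [hb, ratio_of_ne_zero hb]

theorem ratio_congr {a b a' b' : ℂ} (h : a * b' = a' * b) (hb : b = 0 ↔ b' = 0) :
    ratio a b = ratio a' b' := by
  by_cases hb0 : b = 0
  · rw [hb0, hb.1 hb0, ratio_zero_right, ratio_zero_right]
  · rw [ratio_of_ne_zero hb0, ratio_of_ne_zero (fun h => hb0 (hb.2 h)),
      (div_eq_div_iff hb0 fun h => hb0 (hb.2 h)).2 h]

theorem continuousAt_ratio {a b : ℂ} (h : a ≠ 0 ∨ b ≠ 0) :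
    ContinuousAt (fun p : ℂ × ℂ => ratio p.1 p.2) (a, b) := by
  by_cases hb : b = 0
  · subst hb
    have ha : a ≠ 0 := by simpa using h
    rw [ContinuousAt, ratio_zero_right]
    intro s hs
    have hs' : (fun z : ℂ => (z : OnePoint ℂ)) ⁻¹' s ∈ Bornology.cobounded ℂ := by
      have : Tendsto (fun z : ℂ => (z : OnePoint ℂ)) (Bornology.cobounded ℂ)
          (𝓝 OnePoint.infty) := by
        rw [Metric.cobounded_eq_cocompact, ← coclosedCompact_eq_cocompact]
        exact OnePoint.tendsto_coe_infty
      exact this hs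
    have h2 : Tendsto (fun p : ℂ × ℂ => p.1 / p.2) (𝓝[{p | p.2 ≠ 0}] (a, 0))
        (Bornology.cobounded ℂ) := by
      rw [← tendsto_norm_atTop_iff_cobounded]
      have h3 : Tendsto (fun p : ℂ × ℂ => ‖p.2‖⁻¹) (𝓝[{p | p.2 ≠ 0}] (a, 0)) atTop := by
        have : Tendsto (fun p : ℂ × ℂ => p.2) (𝓝[{p | p.2 ≠ 0}] (a, 0)) (𝓝[≠] 0) :=
          tendsto_nhdsWithin_iff.2
            ⟨(continuous_snd.tendsto (a, (0 : ℂ))).mono_left nhdsWithin_le_nhds,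
              eventually_mem_nhdsWithin⟩
        exact (tendsto_norm_inv_nhdsNE_zero_atTop (α := ℂ)).comp this |>.congr
          fun p => norm_inv p.2
      have h4 : Tendsto (fun p : ℂ × ℂ => ‖p.1‖) (𝓝[{p | p.2 ≠ 0}] (a, 0)) (𝓝 ‖a‖) :=
        (continuous_fst.norm.tendsto (a, (0 : ℂ))).mono_left nhdsWithin_le_nhds
      simpa [div_eq_mul_inv] using h4.pos_mul_atTop (norm_pos_iff.2 ha) h3
    have h5 := eventually_nhdsWithin_iff.1 (h2 hs')
    refine mem_map.2 ?_
    filter_upwards [h5] with p hp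
    show ratio p.1 p.2 ∈ s
    by_cases hp2 : p.2 = 0
    · rw [hp2, ratio_zero_right]; exact mem_of_mem_nhds hs
    · rw [ratio_of_ne_zero hp2]; exact hp hp2
  · have h1 : ContinuousAt (fun p : ℂ × ℂ => ((p.1 / p.2 : ℂ) : OnePoint ℂ)) (a, b) :=
      OnePoint.continuous_coe.continuousAt.comp
        (continuousAt_fst.div continuousAt_snd hb)
    refine h1.congr ?_
    filter_upwards [(continuous_snd.tendsto (a, b)).eventually_ne hb] with p hp
    exact (ratio_of_ne_zero hp).symm

theorem continuousAt_ratio_comp {E : Type*} [TopologicalSpace E] {f g : E → ℂ} {x : E}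
    (hf : ContinuousAt f x) (hg : ContinuousAt g x) (h : f x ≠ 0 ∨ g x ≠ 0) :
    ContinuousAt (fun y => ratio (f y) (g y)) x :=
  (continuousAt_ratio h).tendsto.comp (hf.prodMk hg).tendsto

theorem continuousAt_finiteValue {z : OnePoint ℂ} (hz : z ≠ OnePoint.infty) :
    ContinuousAt finiteValue z := by
  obtain ⟨w, rfl⟩ := OnePoint.ne_infty_iff_exists.1 hz
  rw [OnePoint.continuousAt_coe]
  exact continuousAt_id

/-! ### The model and its charts -/

/-- A spanning family of nonzero linear forms on `ℂ^d`, given by their coefficient vectors. -/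
structure Family (d : ℕ) (J : Type) where
  /-- the coefficient vectors -/
  form : J → Fin d → ℂ
  ne_zero : ∀ j, form j ≠ 0
  spanning : ∃ β : Fin d → J, (rows form β).det ≠ 0

variable {d : ℕ} {J : Type}

namespace Family

/-- The complement of the hyperplanes. -/
def generic (F : Family d J) : Set (Fin d → ℂ) := {x | ∀ j, F.form j ⬝ᵥ x ≠ 0}

/-- A point together with all ratios of two forms at this point. -/
def graph (F : Family d J) (x : Fin d → ℂ) : (Fin d → ℂ) × (J → J → OnePoint ℂ) :=
  (x, fun j k => ratio (F.form j ⬝ᵥ x) (F.form k ⬝ᵥ x))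

/-- The closure of the graph of all ratios of two forms on the complement of the hyperplanes. -/
def modelSet (F : Family d J) : Set ((Fin d → ℂ) × (J → J → OnePoint ℂ)) :=
  closure (F.graph '' F.generic)

/-- The model of `ℂ^d` on which all ratios of two forms of the family are defined as points of the
projective line. -/
abbrev Model (F : Family d J) : Type := F.modelSet

theorem graph_mem (F : Family d J) {x : Fin d → ℂ} (hx : x ∈ F.generic) :
    F.graph x ∈ F.modelSet := subset_closure ⟨x, hx, rfl⟩

theorem continuousAt_graph (F : Family d J) {x : Fin d → ℂ} (hx : x ∈ F.generic) :
    ContinuousAt F.graph x := by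
  refine continuousAt_id.prodMk (continuousAt_pi.2 fun j => continuousAt_pi.2 fun k => ?_)
  exact continuousAt_ratio_comp (continuous_const.dotProduct continuous_id).continuousAt
    (continuous_const.dotProduct continuous_id).continuousAt (Or.inr (hx k))

theorem dense_ne_zero : Dense {u : Fin d → ℂ | ∀ i, u i ≠ 0} := by
  have : {u : Fin d → ℂ | ∀ i, u i ≠ 0} = Set.univ.pi fun _ => {0}ᶜ := by
    ext u; simp
  rw [this]
  exact dense_pi _ fun i _ => dense_compl_singleton 0

variable [NeZero d]

/-- The coordinates `(u_0, …, u_{d-1})` for which all forms are monomials times units. -/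
def chartDomain (F : Family d J) (β : Fin d → J) : Set (Fin d → ℂ) :=
  {u | ∀ j, unitPart F.form β j u ≠ 0}

/-- The point of the model with coordinates `u`. -/
def chartPt (F : Family d J) (β : Fin d → J) (u : Fin d → ℂ) :
    (Fin d → ℂ) × (J → J → OnePoint ℂ) :=
  (pt F.form β u, fun j k =>
    ratio (seg (lead F.form β k) (lead F.form β j) u * unitPart F.form β j u)
      (seg (lead F.form β j) (lead F.form β k) u * unitPart F.form β k u))

/-- The coordinates of a point of the model: the first form and the ratios of consecutive forms. -/
def chartCoord (F : Family d J) (β : Fin d → J) (P : (Fin d → ℂ) × (J → J → OnePoint ℂ)) :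
    Fin d → ℂ :=
  fun i => if i = 0 then F.form (β 0) ⬝ᵥ P.1 else finiteValue (P.2 (β i) (β (i - 1)))

theorem Ioc_pred {i : Fin d} (hi : i ≠ 0) : Finset.Ioc (i - 1) i = {i} := by
  ext q
  simp only [Finset.mem_Ioc, Finset.mem_singleton, Fin.lt_def, Fin.le_def, Fin.ext_iff,
    Fin.val_sub_one_of_ne_zero hi]
  have : i.val ≠ 0 := fun h => hi (Fin.ext h)
  omega

theorem pred_lt {i : Fin d} (hi : i ≠ 0) : i - 1 < i := by
  rw [Fin.lt_def, Fin.val_sub_one_of_ne_zero hi]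
  have : i.val ≠ 0 := fun h => hi (Fin.ext h)
  omega

theorem seg_pred {i : Fin d} (hi : i ≠ 0) (u : Fin d → ℂ) : seg (i - 1) i u = u i := by
  rw [seg, Ioc_pred hi, Finset.prod_singleton]

theorem mono_zero (u : Fin d → ℂ) : mono 0 u = u 0 := by
  have : Finset.Iic (0 : Fin d) = {0} := by
    ext q; simp
  rw [mono, this, Finset.prod_singleton]

theorem mono_pred {i : Fin d} (hi : i ≠ 0) (u : Fin d → ℂ) :
    mono i u = mono (i - 1) u * u i := by
  rw [← mono_mul_seg (pred_lt hi).le, seg_pred hi]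

theorem chartCoord_chartPt (F : Family d J) {β : Fin d → J} (hβ : (rows F.form β).det ≠ 0)
    (u : Fin d → ℂ) : F.chartCoord β (F.chartPt β u) = u := by
  ext i
  by_cases hi : i = 0
  · subst hi
    simp only [chartCoord, if_true, chartPt]
    rw [dotProduct_pt_self hβ, mono_zero]
  · simp only [chartCoord, if_neg hi, chartPt, finiteValue_ratio]
    rw [unitPart_self hβ F.ne_zero, unitPart_self hβ F.ne_zero, lead_self hβ F.ne_zero,
      lead_self hβ F.ne_zero, seg_pred hi, seg_of_le (pred_lt hi).le]
    simp

theorem chartPt_eq_graph (F : Family d J) {β : Fin d → J} (hβ : (rows F.form β).det ≠ 0)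
    {u : Fin d → ℂ} (hu : u ∈ F.chartDomain β) (hu0 : ∀ i, u i ≠ 0) :
    F.chartPt β u = F.graph (pt F.form β u) := by
  refine Prod.ext rfl (funext fun j => funext fun k => ratio_congr ?_ ?_)
  · rw [dotProduct_pt hβ (F.ne_zero j), dotProduct_pt hβ (F.ne_zero k)]
    linear_combination (unitPart F.form β j u * unitPart F.form β k u) *
      mono_mul_seg_comm (lead F.form β k) (lead F.form β j) u
  · rw [dotProduct_pt hβ (F.ne_zero k)]
    simp [hu k, mono_ne_zero hu0, seg_ne_zero hu0]

theorem pt_mem_generic (F : Family d J) {β : Fin d → J} (hβ : (rows F.form β).det ≠ 0)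
    {u : Fin d → ℂ} (hu : u ∈ F.chartDomain β) (hu0 : ∀ i, u i ≠ 0) :
    pt F.form β u ∈ F.generic := fun j => by
  rw [dotProduct_pt hβ (F.ne_zero j)]
  exact mul_ne_zero (mono_ne_zero hu0 _) (hu j)

theorem pt_chartCoord_graph (F : Family d J) {β : Fin d → J} (hβ : (rows F.form β).det ≠ 0)
    {x : Fin d → ℂ} (hx : x ∈ F.generic) :
    pt F.form β (F.chartCoord β (F.graph x)) = x := by
  set u := F.chartCoord β (F.graph x) with hu
  have hmono : ∀ (m : ℕ) (hm : m < d), mono ⟨m, hm⟩ u = F.form (β ⟨m, hm⟩) ⬝ᵥ x := by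
    intro m
    induction m with
    | zero =>
      intro hm
      have h0 : (⟨0, hm⟩ : Fin d) = 0 := rfl
      rw [h0, mono_zero, hu]
      simp [chartCoord, graph]
    | succ m ih =>
      intro hm
      have hi : (⟨m + 1, hm⟩ : Fin d) ≠ 0 := fun h => by
        have := congrArg Fin.val h
        simp at this
      have hpred : (⟨m + 1, hm⟩ : Fin d) - 1 = ⟨m, by omega⟩ := by
        ext; rw [Fin.val_sub_one_of_ne_zero hi]; simp
      rw [mono_pred hi, hpred, ih, hu]
      simp only [chartCoord, if_neg hi, graph, finiteValue_ratio, hpred]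
      rw [mul_div_cancel₀ _ (hx _)]
  have h2 : (fun i => mono i u) = rows F.form β *ᵥ x := by
    ext i; exact hmono i.1 i.2
  rw [pt, h2, mulVec_mulVec, nonsing_inv_mul _ (Ne.isUnit hβ), one_mulVec]

theorem chartCoord_graph_ne_zero (F : Family d J) (β : Fin d → J) {x : Fin d → ℂ}
    (hx : x ∈ F.generic) (i : Fin d) : F.chartCoord β (F.graph x) i ≠ 0 := by
  by_cases hi : i = 0
  · simpa [chartCoord, hi, graph] using hx _
  · simpa [chartCoord, hi, graph, finiteValue_ratio] using ⟨hx _, hx _⟩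

theorem chartCoord_graph_mem (F : Family d J) {β : Fin d → J} (hβ : (rows F.form β).det ≠ 0)
    {x : Fin d → ℂ} (hx : x ∈ F.generic) :
    F.chartCoord β (F.graph x) ∈ F.chartDomain β := fun j h => by
  apply hx j
  rw [← F.pt_chartCoord_graph hβ hx, dotProduct_pt hβ (F.ne_zero j), h, mul_zero]

theorem chartPt_chartCoord_graph (F : Family d J) {β : Fin d → J}
    (hβ : (rows F.form β).det ≠ 0) {x : Fin d → ℂ} (hx : x ∈ F.generic) :
    F.chartPt β (F.chartCoord β (F.graph x)) = F.graph x := by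
  rw [F.chartPt_eq_graph hβ (F.chartCoord_graph_mem hβ hx) (F.chartCoord_graph_ne_zero β hx),
    F.pt_chartCoord_graph hβ hx]

theorem isOpen_chartDomain [Finite J] (F : Family d J) (β : Fin d → J) :
    IsOpen (F.chartDomain β) := by
  simp only [chartDomain, Set.ofPred_forall]
  exact isOpen_iInter_of_finite fun j => isOpen_ne.preimage
    (continuous_iff_continuousAt.2 fun u => (analyticAt_unitPart F.form β j u).continuousAt)

/-- One of the two homogeneous coordinates of each ratio is nonzero. -/
theorem chartPt_ne_zero (F : Family d J) {β : Fin d → J} {u : Fin d → ℂ}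
    (hu : u ∈ F.chartDomain β) (j k : J) :
    seg (lead F.form β k) (lead F.form β j) u * unitPart F.form β j u ≠ 0 ∨
      seg (lead F.form β j) (lead F.form β k) u * unitPart F.form β k u ≠ 0 := by
  rcases le_total (lead F.form β j) (lead F.form β k) with h | h
  · left; rw [seg_of_le h, one_mul]; exact hu j
  · right; rw [seg_of_le h, one_mul]; exact hu k

theorem continuousAt_chartPt (F : Family d J) {β : Fin d → J} {u : Fin d → ℂ}
    (hu : u ∈ F.chartDomain β) : ContinuousAt (F.chartPt β) u := by
  refine (analyticAt_pt F.form β u).continuousAt.prodMk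
    (continuousAt_pi.2 fun j => continuousAt_pi.2 fun k => ?_)
  exact continuousAt_ratio_comp
    ((analyticAt_seg _ _ u).mul (analyticAt_unitPart _ _ _ u)).continuousAt
    ((analyticAt_seg _ _ u).mul (analyticAt_unitPart _ _ _ u)).continuousAt
    (F.chartPt_ne_zero hu j k)

theorem chartPt_mem [Finite J] (F : Family d J) {β : Fin d → J} (hβ : (rows F.form β).det ≠ 0)
    {u : Fin d → ℂ} (hu : u ∈ F.chartDomain β) : F.chartPt β u ∈ F.modelSet := by
  have hcl : u ∈ closure (F.chartDomain β ∩ {u : Fin d → ℂ | ∀ i, u i ≠ 0}) :=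
    dense_ne_zero.open_subset_closure_inter (F.isOpen_chartDomain β) hu
  refine (F.continuousAt_chartPt hu).continuousWithinAt.mem_closure hcl ?_
  rintro v ⟨hv, hv0⟩
  exact ⟨_, F.pt_mem_generic hβ hv hv0, (F.chartPt_eq_graph hβ hv hv0).symm⟩

/-- The part of the ambient space on which the coordinates are finite. -/
def coordDomain (F : Family d J) (β : Fin d → J) :
    Set ((Fin d → ℂ) × (J → J → OnePoint ℂ)) :=
  {P | (∀ i ≠ 0, P.2 (β i) (β (i - 1)) ≠ OnePoint.infty) ∧ F.chartCoord β P ∈ F.chartDomain β}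

theorem continuousAt_chartCoord (F : Family d J) {β : Fin d → J}
    {P : (Fin d → ℂ) × (J → J → OnePoint ℂ)}
    (hP : ∀ i ≠ 0, P.2 (β i) (β (i - 1)) ≠ OnePoint.infty) :
    ContinuousAt (F.chartCoord β) P := by
  refine continuousAt_pi.2 fun i => ?_
  by_cases hi : i = 0
  · simp only [chartCoord, hi, if_true]
    exact (continuous_const.dotProduct continuous_fst).continuousAt
  · simp only [chartCoord, if_neg hi]
    have h : Continuous fun Q : (Fin d → ℂ) × (J → J → OnePoint ℂ) => Q.2 (β i) (β (i - 1)) := by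
      fun_prop
    exact (continuousAt_finiteValue (hP i hi)).tendsto.comp (h.tendsto P)

theorem isOpen_coordDomain [Finite J] (F : Family d J) (β : Fin d → J) :
    IsOpen (F.coordDomain β) := by
  have h1 : IsOpen {P : (Fin d → ℂ) × (J → J → OnePoint ℂ) |
      ∀ i ≠ 0, P.2 (β i) (β (i - 1)) ≠ OnePoint.infty} := by
    simp only [Set.ofPred_forall]
    exact isOpen_iInter_of_finite fun i => isOpen_iInter_of_finite fun _ =>
      isOpen_ne.preimage ((continuous_apply _).comp ((continuous_apply _).comp continuous_snd))
  have h2 : ContinuousOn (F.chartCoord β) {P : (Fin d → ℂ) × (J → J → OnePoint ℂ) |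
      ∀ i ≠ 0, P.2 (β i) (β (i - 1)) ≠ OnePoint.infty} :=
    fun P hP => (F.continuousAt_chartCoord hP).continuousWithinAt
  exact h2.isOpen_inter_preimage h1 (F.isOpen_chartDomain β)

theorem chartPt_mem_coordDomain (F : Family d J) {β : Fin d → J} (hβ : (rows F.form β).det ≠ 0)
    {u : Fin d → ℂ} (hu : u ∈ F.chartDomain β) : F.chartPt β u ∈ F.coordDomain β := by
  refine ⟨fun i hi => ratio_ne_infty_iff.2 ?_, by rwa [F.chartCoord_chartPt hβ]⟩
  rw [unitPart_self hβ F.ne_zero, mul_one, lead_self hβ F.ne_zero, lead_self hβ F.ne_zero,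
    seg_of_le (pred_lt hi).le]
  exact one_ne_zero

theorem chartPt_chartCoord (F : Family d J) {β : Fin d → J} (hβ : (rows F.form β).det ≠ 0)
    {P : (Fin d → ℂ) × (J → J → OnePoint ℂ)} (hP : P ∈ F.modelSet) (hPc : P ∈ F.coordDomain β) :
    F.chartPt β (F.chartCoord β P) = P := by
  have : (𝓝[F.graph '' F.generic] P).NeBot := mem_closure_iff_nhdsWithin_neBot.1 hP
  have h1 : Tendsto (fun Q => F.chartPt β (F.chartCoord β Q)) (𝓝[F.graph '' F.generic] P)
      (𝓝 (F.chartPt β (F.chartCoord β P))) :=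
    ((F.continuousAt_chartPt hPc.2).tendsto.comp
      (F.continuousAt_chartCoord hPc.1).tendsto).mono_left nhdsWithin_le_nhds
  have h2 : Tendsto (fun Q => F.chartPt β (F.chartCoord β Q)) (𝓝[F.graph '' F.generic] P)
      (𝓝 P) := by
    refine Tendsto.congr' ?_ (tendsto_id.mono_left nhdsWithin_le_nhds)
    filter_upwards [self_mem_nhdsWithin] with Q hQ
    obtain ⟨x, hx, rfl⟩ := hQ
    exact (F.chartPt_chartCoord_graph hβ hx).symm
  exact tendsto_nhds_unique h1 h2

end Family
end Arrangement

namespace Arrangement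

open Matrix Topology Filter Asymptotics

namespace Family
variable {d : ℕ} {J : Type}

/-! ### The charts cover the model -/

/-- The filter of generic points that converge to `P` in the model. -/
def approach (F : Family d J) (P : (Fin d → ℂ) × (J → J → OnePoint ℂ)) :
    Filter ((Fin d → ℂ) × (J → J → OnePoint ℂ)) := 𝓝[F.graph '' F.generic] P

theorem eventually_approach (F : Family d J) (P : (Fin d → ℂ) × (J → J → OnePoint ℂ)) :
    ∀ᶠ Q in F.approach P, ∃ x ∈ F.generic, F.graph x = Q := by
  filter_upwards [self_mem_nhdsWithin] with Q hQ using hQ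

theorem tendsto_approach (F : Family d J) (P : (Fin d → ℂ) × (J → J → OnePoint ℂ)) (j k : J) :
    Tendsto (fun Q => Q.2 j k) (F.approach P) (𝓝 (P.2 j k)) := by
  have h : Continuous fun Q : (Fin d → ℂ) × (J → J → OnePoint ℂ) => Q.2 j k := by fun_prop
  exact (h.tendsto P).mono_left nhdsWithin_le_nhds

theorem isBigO_of_ne_infty (F : Family d J) {P : (Fin d → ℂ) × (J → J → OnePoint ℂ)} {j k : J}
    (h : P.2 j k ≠ OnePoint.infty) :
    (fun Q => F.form j ⬝ᵥ Q.1) =O[F.approach P] fun Q => F.form k ⬝ᵥ Q.1 := by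
  have h1 := (continuousAt_finiteValue h).tendsto.comp (F.tendsto_approach P j k)
  refine isBigO_of_div_tendsto_nhds ?_ _ (h1.congr' ?_)
  · filter_upwards [F.eventually_approach P] with Q hQ h0
    obtain ⟨x, hx, rfl⟩ := hQ
    exact absurd h0 (hx k)
  · filter_upwards [F.eventually_approach P] with Q hQ
    obtain ⟨x, hx, rfl⟩ := hQ
    exact finiteValue_ratio _ _

theorem isLittleO_of_eq_infty (F : Family d J) {P : (Fin d → ℂ) × (J → J → OnePoint ℂ)} {j k : J}
    (h : P.2 j k = OnePoint.infty) :
    (fun Q => F.form k ⬝ᵥ Q.1) =o[F.approach P] fun Q => F.form j ⬝ᵥ Q.1 := by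
  have h1 := F.tendsto_approach P j k
  rw [h] at h1
  have h2 : Tendsto (fun Q : (Fin d → ℂ) × (J → J → OnePoint ℂ) =>
      (F.form j ⬝ᵥ Q.1) / (F.form k ⬝ᵥ Q.1)) (F.approach P) (Bornology.cobounded ℂ) := by
    rw [Metric.cobounded_eq_cocompact, ← coclosedCompact_eq_cocompact,
      ← OnePoint.comap_coe_nhds_infty, tendsto_comap_iff]
    refine h1.congr' ?_
    filter_upwards [F.eventually_approach P] with Q hQ
    obtain ⟨x, hx, rfl⟩ := hQ
    exact ratio_of_ne_zero (hx k)
  refine (isLittleO_iff_tendsto' ?_).2 ?_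
  · filter_upwards [F.eventually_approach P] with Q hQ h0
    obtain ⟨x, hx, rfl⟩ := hQ
    exact absurd h0 (hx j)
  · refine (tendsto_inv₀_cobounded.comp h2).congr fun Q => ?_
    simp [inv_div]

/-- No form is negligible with respect to itself. -/
theorem not_isLittleO_self (F : Family d J) {P : (Fin d → ℂ) × (J → J → OnePoint ℂ)}
    (hP : P ∈ F.modelSet) (j : J) :
    ¬ (fun Q => F.form j ⬝ᵥ Q.1) =o[F.approach P] fun Q => F.form j ⬝ᵥ Q.1 := by
  have : (F.approach P).NeBot := mem_closure_iff_nhdsWithin_neBot.1 hP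
  apply isLittleO_irrefl
  refine Eventually.frequently ?_
  filter_upwards [F.eventually_approach P] with Q hQ
  obtain ⟨x, hx, rfl⟩ := hQ
  exact hx j

open Classical in
/-- Each point of the model lies in a chart: the forms are ordered by their growth near the point,
and a basis adapted to this order gives the coordinates. -/
theorem exists_mem_coordDomain [NeZero d] [Finite J] (F : Family d J)
    {P : (Fin d → ℂ) × (J → J → OnePoint ℂ)} (hP : P ∈ F.modelSet) :
    ∃ β : Fin d → J, (rows F.form β).det ≠ 0 ∧ P ∈ F.coordDomain β := by
  have := Fintype.ofFinite J
  have hne : (F.approach P).NeBot := mem_closure_iff_nhdsWithin_neBot.1 hP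
  let le : J → J → Prop := fun j k =>
    (fun Q => F.form j ⬝ᵥ Q.1) =O[F.approach P] fun Q => F.form k ⬝ᵥ Q.1
  have htotal : ∀ j k, ¬ le j k → le k j := fun j k h => by
    by_cases hi : P.2 j k = OnePoint.infty
    · exact (F.isLittleO_of_eq_infty hi).isBigO
    · exact absurd (F.isBigO_of_ne_infty hi) h
  let v : J → ℕ := fun j => (Finset.univ.filter fun i => le i j).card
  have hv : ∀ j k, v j ≤ v k → le j k := fun j k h => by
    by_contra hjk
    refine absurd h (not_le.2 (Finset.card_lt_card ?_))
    refine Finset.ssubset_iff_of_subset (fun i hi => ?_) |>.2 ⟨j, ?_, ?_⟩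
    · simp only [Finset.mem_filter, Finset.mem_univ, true_and] at hi ⊢
      exact IsBigO.trans hi (htotal j k hjk)
    · simp only [Finset.mem_filter, Finset.mem_univ, true_and]
      exact isBigO_refl _ _
    · simpa using hjk
  obtain ⟨β, hβ, hanti, hcoef⟩ := exists_greedy_basis F.spanning v
  have hfin : ∀ i ≠ 0, P.2 (β i) (β (i - 1)) ≠ OnePoint.infty := fun i hi h =>
    F.not_isLittleO_self hP (β i)
      ((hv _ _ (hanti (pred_lt hi).le)).trans_isLittleO (F.isLittleO_of_eq_infty h))
  refine ⟨β, hβ, hfin, fun j h0 => ?_⟩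
  have h1 : Tendsto (fun Q => unitPart F.form β j (F.chartCoord β Q)) (F.approach P) (𝓝 0) := by
    rw [← h0]
    exact ((analyticAt_unitPart F.form β j _).continuousAt.tendsto.comp
      (F.continuousAt_chartCoord hfin).tendsto).mono_left nhdsWithin_le_nhds
  have h2 : (fun Q => F.form j ⬝ᵥ Q.1) =o[F.approach P]
      fun Q => F.form (β (lead F.form β j)) ⬝ᵥ Q.1 := by
    refine (isLittleO_iff_tendsto' ?_).2 (h1.congr' ?_)
    · filter_upwards [F.eventually_approach P] with Q hQ h0
      obtain ⟨x, hx, rfl⟩ := hQ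
      exact absurd h0 (hx _)
    · filter_upwards [F.eventually_approach P] with Q hQ
      obtain ⟨x, hx, rfl⟩ := hQ
      have hpt := F.pt_chartCoord_graph hβ hx
      have ha := dotProduct_pt hβ (F.ne_zero j) (F.chartCoord β (F.graph x))
      have hb := dotProduct_pt_self hβ (lead F.form β j) (F.chartCoord β (F.graph x))
      rw [hpt] at ha hb
      show _ = (F.form j ⬝ᵥ x) / (F.form (β (lead F.form β j)) ⬝ᵥ x)
      rw [ha, hb, mul_div_cancel_left₀]
      exact mono_ne_zero (F.chartCoord_graph_ne_zero β hx) _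
  exact F.not_isLittleO_self hP j
    (h2.trans_isBigO (hv _ _ (hcoef j _ (lead_spec hβ (F.ne_zero j)).1)))

/-! ### The complex manifold -/

variable [NeZero d] [Finite J]

open Classical in
/-- The coordinates `u - c` of a chart, on the part where the `u_q` with `c_q ≠ 0` have no zeros.
If `c` is the coordinate vector of a point, then this chart is centred at the point. -/
def chart (F : Family d J) {β : Fin d → J} (hβ : (rows F.form β).det ≠ 0) (c : Fin d → ℂ) :
    OpenPartialHomeomorph F.Model (Fin d → ℂ) where
  toFun P := F.chartCoord β P.1 - c
  invFun v := if h : c + v ∈ F.chartDomain β then ⟨F.chartPt β (c + v), F.chartPt_mem hβ h⟩ else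
    ⟨F.chartPt β 0, F.chartPt_mem hβ fun j => unitPart_zero_ne_zero hβ (F.ne_zero j)⟩
  source := {P | P.1 ∈ F.coordDomain β ∧ ∀ q, c q ≠ 0 → F.chartCoord β P.1 q ≠ 0}
  target := {v | c + v ∈ F.chartDomain β ∧ ∀ q, c q ≠ 0 → (c + v) q ≠ 0}
  map_source' := by
    rintro P ⟨hP, hq⟩
    simpa using ⟨hP.2, hq⟩
  map_target' := by
    rintro v ⟨hv, hq⟩
    rw [dif_pos hv]
    exact ⟨F.chartPt_mem_coordDomain hβ hv, by rwa [F.chartCoord_chartPt hβ]⟩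
  left_inv' := by
    rintro P ⟨hP, -⟩
    rw [dif_pos (by simpa using hP.2)]
    apply Subtype.ext
    simpa using F.chartPt_chartCoord hβ P.2 hP
  right_inv' := by
    rintro v ⟨hv, -⟩
    rw [dif_pos hv]
    simp [F.chartCoord_chartPt hβ]
  open_source := by
    have h : ContinuousOn (F.chartCoord β) (F.coordDomain β) := fun P hP =>
      (F.continuousAt_chartCoord hP.1).continuousWithinAt
    have h2 : IsOpen {u : Fin d → ℂ | ∀ q, c q ≠ 0 → u q ≠ 0} := by
      simp only [Set.ofPred_forall]
      exact isOpen_iInter_of_finite fun q => isOpen_iInter_of_finite fun _ =>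
        isOpen_ne.preimage (continuous_apply q)
    exact (h.isOpen_inter_preimage (F.isOpen_coordDomain β) h2).preimage continuous_subtype_val
  open_target := by
    have h2 : IsOpen {v : Fin d → ℂ | ∀ q, c q ≠ 0 → (c + v) q ≠ 0} := by
      simp only [Set.ofPred_forall]
      exact isOpen_iInter_of_finite fun q => isOpen_iInter_of_finite fun _ =>
        isOpen_ne.preimage ((continuous_apply q).comp (continuous_const_add c))
    exact ((F.isOpen_chartDomain β).preimage (continuous_const_add c)).inter h2
  continuousOn_toFun := by
    rintro P ⟨hP, -⟩
    refine ContinuousAt.continuousWithinAt ?_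
    exact (((F.continuousAt_chartCoord hP.1).tendsto.comp
      (continuous_subtype_val.tendsto P)).sub_const c)
  continuousOn_invFun := by
    rintro v ⟨hv, hq⟩
    refine ContinuousAt.continuousWithinAt ?_
    rw [IsInducing.subtypeVal.continuousAt_iff]
    have h : ContinuousAt (fun v => F.chartPt β (c + v)) v :=
      (F.continuousAt_chartPt hv).comp (f := fun v => c + v) (continuous_const_add c).continuousAt
    refine h.congr ?_
    filter_upwards [((F.isOpen_chartDomain β).preimage (continuous_const_add c)).mem_nhds hv]
      with w hw
    have hw' : c + w ∈ F.chartDomain β := hw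
    simp only [Function.comp, hw', dite_true]

open Classical in
theorem chart_symm_val (F : Family d J) {β : Fin d → J} (hβ : (rows F.form β).det ≠ 0)
    {c v : Fin d → ℂ} (h : c + v ∈ F.chartDomain β) :
    ((F.chart hβ c).symm v).1 = F.chartPt β (c + v) := by
  show (dite _ _ _ : F.Model).1 = _
  rw [dif_pos h]

theorem mem_chart_target (F : Family d J) {β : Fin d → J} (hβ : (rows F.form β).det ≠ 0)
    {c v : Fin d → ℂ} : v ∈ (F.chart hβ c).target ↔
      c + v ∈ F.chartDomain β ∧ ∀ q, c q ≠ 0 → (c + v) q ≠ 0 := Iff.rfl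

theorem mem_chart_source' (F : Family d J) {β : Fin d → J} (hβ : (rows F.form β).det ≠ 0)
    {c : Fin d → ℂ} {P : F.Model} : P ∈ (F.chart hβ c).source ↔
      P.1 ∈ F.coordDomain β ∧ ∀ q, c q ≠ 0 → F.chartCoord β P.1 q ≠ 0 := Iff.rfl

theorem chart_apply (F : Family d J) {β : Fin d → J} (hβ : (rows F.form β).det ≠ 0)
    (c : Fin d → ℂ) (P : F.Model) : F.chart hβ c P = F.chartCoord β P.1 - c := rfl

/-- The basis of the preferred chart at a point. -/
def basisAt (F : Family d J) (P : F.Model) : Fin d → J :=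
  (F.exists_mem_coordDomain P.2).choose

theorem basisAt_det (F : Family d J) (P : F.Model) : (rows F.form (F.basisAt P)).det ≠ 0 :=
  (F.exists_mem_coordDomain P.2).choose_spec.1

theorem mem_coordDomain_basisAt (F : Family d J) (P : F.Model) :
    P.1 ∈ F.coordDomain (F.basisAt P) :=
  (F.exists_mem_coordDomain P.2).choose_spec.2

instance chartedSpace (F : Family d J) : ChartedSpace (Fin d → ℂ) F.Model where
  atlas := {e | ∃ (β : Fin d → J) (hβ : (rows F.form β).det ≠ 0) (c : Fin d → ℂ),
    e = F.chart hβ c}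
  chartAt P := F.chart (F.basisAt_det P) (F.chartCoord (F.basisAt P) P.1)
  mem_chart_source P := ⟨F.mem_coordDomain_basisAt P, fun _ h => h⟩
  chart_mem_atlas _ := ⟨_, _, _, rfl⟩

omit [Finite J] in
theorem analyticAt_chartCoord_chartPt (F : Family d J) {β γ : Fin d → J} {u : Fin d → ℂ}
    (hu' : F.chartPt β u ∈ F.coordDomain γ) :
    AnalyticAt ℂ (fun u => F.chartCoord γ (F.chartPt β u)) u := by
  refine analyticAt_pi_iff.2 fun i => ?_
  by_cases hi : i = 0
  · simp only [chartCoord, hi, if_true, chartPt, dotProduct]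
    exact Finset.analyticAt_fun_sum _ fun k _ =>
      analyticAt_const.mul (analyticAt_pi_iff.1 (analyticAt_pt F.form β u) k)
  · simp only [chartCoord, if_neg hi, chartPt, finiteValue_ratio]
    exact ((analyticAt_seg _ _ u).mul (analyticAt_unitPart _ _ _ u)).div
      ((analyticAt_seg _ _ u).mul (analyticAt_unitPart _ _ _ u))
      (ratio_ne_infty_iff.1 (hu'.1 i hi))

theorem contDiffAt_chart_transition (F : Family d J) {β γ : Fin d → J}
    (hβ : (rows F.form β).det ≠ 0) (hγ : (rows F.form γ).det ≠ 0) (c c' v : Fin d → ℂ)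
    (hv : v ∈ (F.chart hβ c).target)
    (hv' : (F.chart hβ c).symm v ∈ (F.chart hγ c').source) :
    ContDiffAt ℂ ω (fun w => F.chart hγ c' ((F.chart hβ c).symm w)) v := by
  have hv1 := ((F.mem_chart_target hβ).1 hv).1
  have hv2 := ((F.mem_chart_source' hγ).1 hv').1
  rw [F.chart_symm_val hβ hv1] at hv2
  have h1 : AnalyticAt ℂ (fun v => F.chartCoord γ (F.chartPt β (c + v)) - c') v :=
    ((F.analyticAt_chartCoord_chartPt hv2).comp_of_eq
      (f := fun v => c + v) (analyticAt_const.add analyticAt_id) rfl).sub analyticAt_const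
  refine h1.contDiffAt.congr_of_eventuallyEq ?_
  filter_upwards [((F.isOpen_chartDomain β).preimage (continuous_const_add c)).mem_nhds hv1]
    with w hw
  have hw' : c + w ∈ F.chartDomain β := hw
  rw [F.chart_apply, F.chart_symm_val hβ hw']

instance isManifold (F : Family d J) : IsManifold 𝓘(ℂ, Fin d → ℂ) ω F.Model := by
  refine isManifold_of_contDiffOn _ _ _ fun e e' he he' => ?_
  obtain ⟨β, hβ, c, rfl⟩ := he
  obtain ⟨γ, hγ, c', rfl⟩ := he'
  generalize F.chart hβ c = e, F.chart hγ c' = e',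
    F.contDiffAt_chart_transition hβ hγ c c' = h at *
  intro v hv
  simp only [mfld_simps] at hv
  exact (h v hv.1 hv.2).contDiffWithinAt

/-! ### The resolution map -/

omit [NeZero d] [Finite J] in
theorem isProperMap_fst (F : Family d J) : IsProperMap fun P : F.Model => P.1.1 :=
  isProperMap_fst_of_compactSpace.comp
    (isClosed_closure (s := F.graph '' F.generic)).isClosedEmbedding_subtypeVal.isProperMap

theorem contMDiff_fst (F : Family d J) :
    ContMDiff 𝓘(ℂ, Fin d → ℂ) 𝓘(ℂ, Fin d → ℂ) ω fun P : F.Model => P.1.1 := by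
  intro P
  let e := chartAt (Fin d → ℂ) P
  let c := F.chartCoord (F.basisAt P) P.1
  have h1 : ContMDiffAt 𝓘(ℂ, Fin d → ℂ) 𝓘(ℂ, Fin d → ℂ) ω e P :=
    (contMDiffOn_chart P (mem_chart_source _ P)).contMDiffAt
      (e.open_source.mem_nhds (mem_chart_source _ P))
  have h2 : ContMDiffAt 𝓘(ℂ, Fin d → ℂ) 𝓘(ℂ, Fin d → ℂ) ω
      (fun v => pt F.form (F.basisAt P) (c + v)) (e P) :=
    ContDiffAt.contMDiffAt (((analyticAt_pt F.form (F.basisAt P) _).comp_of_eq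
      (f := fun v => c + v) (analyticAt_const.add analyticAt_id) rfl).contDiffAt)
  refine (h2.comp P h1).congr_of_eventuallyEq ?_
  filter_upwards [e.open_source.mem_nhds (mem_chart_source _ P)] with Q hQ
  have h3 := F.chartPt_chartCoord (F.basisAt_det P) Q.2 hQ.1
  have h4 : c + e Q = F.chartCoord (F.basisAt P) Q.1 := add_sub_cancel _ _
  show Q.1.1 = pt F.form (F.basisAt P) (c + e Q)
  rw [h4]
  conv_lhs => rw [← h3]
  rfl

omit [Finite J] in
theorem analyticAt_chartCoord_graph (F : Family d J) (β : Fin d → J) {x : Fin d → ℂ}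
    (hx : x ∈ F.generic) : AnalyticAt ℂ (fun y => F.chartCoord β (F.graph y)) x := by
  have hform : ∀ j, AnalyticAt ℂ (fun y => F.form j ⬝ᵥ y) x := fun j =>
    Finset.analyticAt_fun_sum _ fun k _ => analyticAt_const.mul
      ((ContinuousLinearMap.proj (R := ℂ) (φ := fun _ : Fin d => ℂ) k).analyticAt x)
  refine analyticAt_pi_iff.2 fun i => ?_
  by_cases hi : i = 0
  · simp only [chartCoord, hi, if_true, graph]
    exact hform _
  · simp only [chartCoord, if_neg hi, graph, finiteValue_ratio]
    exact (hform _).div (hform _) (hx _)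

omit [NeZero d] in
theorem isOpen_generic (F : Family d J) : IsOpen F.generic := by
  simp only [generic, Set.ofPred_forall]
  exact isOpen_iInter_of_finite fun j => isOpen_ne.preimage
    (continuous_const.dotProduct continuous_id)

open Classical in
/-- The inverse of the resolution map over the complement of the hyperplanes. -/
def lift (F : Family d J) (y : Fin d → ℂ) : F.Model :=
  if h : y ∈ F.generic then ⟨F.graph y, F.graph_mem h⟩ else
    ⟨F.chartPt _ 0, F.chartPt_mem F.spanning.choose_spec fun j =>
      unitPart_zero_ne_zero F.spanning.choose_spec (F.ne_zero j)⟩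

theorem lift_val (F : Family d J) {y : Fin d → ℂ} (hy : y ∈ F.generic) :
    (F.lift y).1 = F.graph y := by
  rw [lift, dif_pos hy]

theorem lift_fst (F : Family d J) {P : F.Model} (hP : P.1.1 ∈ F.generic) :
    F.lift P.1.1 = P := by
  apply Subtype.ext
  rw [F.lift_val hP]
  have : (𝓝[F.graph '' F.generic] P.1).NeBot := mem_closure_iff_nhdsWithin_neBot.1 P.2
  have h1 : Tendsto (fun Q => F.graph Q.1) (𝓝[F.graph '' F.generic] P.1) (𝓝 (F.graph P.1.1)) :=
    ((F.continuousAt_graph hP).tendsto.comp (continuous_fst.tendsto P.1)).mono_left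
      nhdsWithin_le_nhds
  have h2 : Tendsto (fun Q => F.graph Q.1) (𝓝[F.graph '' F.generic] P.1) (𝓝 P.1) := by
    refine Tendsto.congr' ?_ (tendsto_id.mono_left nhdsWithin_le_nhds)
    filter_upwards [self_mem_nhdsWithin] with Q hQ
    obtain ⟨x, hx, rfl⟩ := hQ
    rfl
  exact tendsto_nhds_unique h1 h2

theorem contMDiffOn_lift (F : Family d J) :
    ContMDiffOn 𝓘(ℂ, Fin d → ℂ) 𝓘(ℂ, Fin d → ℂ) ω F.lift F.generic := by
  intro y hy
  refine ContMDiffAt.contMDiffWithinAt ?_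
  let P := F.lift y
  let e := chartAt (Fin d → ℂ) P
  let β := F.basisAt P
  let c := F.chartCoord β P.1
  have hP : P.1 = F.graph y := F.lift_val hy
  have h1 : ContMDiffAt 𝓘(ℂ, Fin d → ℂ) 𝓘(ℂ, Fin d → ℂ) ω
      (fun z => F.chartCoord β (F.graph z) - c) y :=
    ContDiffAt.contMDiffAt
      ((F.analyticAt_chartCoord_graph β hy).sub analyticAt_const).contDiffAt
  have h2 : ContMDiffAt 𝓘(ℂ, Fin d → ℂ) 𝓘(ℂ, Fin d → ℂ) ω e.symm
      (F.chartCoord β (F.graph y) - c) := by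
    have ht : F.chartCoord β (F.graph y) - c ∈ e.target := by
      rw [← hP]; exact e.map_source (mem_chart_source _ P)
    exact (contMDiffOn_chart_symm _ ht).contMDiffAt (e.open_target.mem_nhds ht)
  refine (h2.comp y h1).congr_of_eventuallyEq ?_
  filter_upwards [F.isOpen_generic.mem_nhds hy] with z hz
  apply Subtype.ext
  have hc : c + (F.chartCoord β (F.graph z) - c) = F.chartCoord β (F.graph z) :=
    add_sub_cancel _ _
  have hz2 : c + (F.chartCoord β (F.graph z) - c) ∈ F.chartDomain β := by
    rw [hc]; exact F.chartCoord_graph_mem (F.basisAt_det P) hz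
  refine (F.lift_val hz).trans ?_
  refine Eq.trans ?_ (F.chart_symm_val (F.basisAt_det P) hz2).symm
  rw [hc, F.chartPt_chartCoord_graph (F.basisAt_det P) hz]

end Family
end Arrangement

namespace Arrangement

open Matrix Topology Filter

namespace Family
variable {d : ℕ} {J : Type}

/-! ### Flats and adapted bases -/

/-- The hyperplane on which the form `F j` vanishes. -/
def hyper (F : Family d J) (j : J) : Submodule ℂ (Fin d → ℂ) where
  carrier := {x | F.form j ⬝ᵥ x = 0}
  add_mem' := fun {x y} (hx : _ = 0) (hy : _ = 0) => by
    show F.form j ⬝ᵥ (x + y) = 0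
    rw [dotProduct_add, hx, hy, add_zero]
  zero_mem' := dotProduct_zero _
  smul_mem' := fun c x (hx : _ = 0) => by
    show F.form j ⬝ᵥ (c • x) = 0
    rw [dotProduct_smul, hx, smul_zero]

theorem mem_hyper {F : Family d J} {j : J} {x : Fin d → ℂ} :
    x ∈ F.hyper j ↔ F.form j ⬝ᵥ x = 0 := Iff.rfl

/-- The intersections of the hyperplanes, except for the ambient space. -/
def flats (F : Family d J) : Set (Submodule ℂ (Fin d → ℂ)) :=
  intersectionLattice (Set.range F.hyper)

theorem hyper_ne_top (F : Family d J) (j : J) : F.hyper j ≠ ⊤ := fun h => by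
  apply F.ne_zero j
  ext i
  have : (Pi.single i 1 : Fin d → ℂ) ∈ F.hyper j := h ▸ Submodule.mem_top
  simpa [mem_hyper] using this

theorem mem_of_mem_flats {F : Family d J} {W : Submodule ℂ (Fin d → ℂ)} (hW : W ∈ F.flats)
    {x : Fin d → ℂ} (hx : ∀ j, W ≤ F.hyper j → x ∈ F.hyper j) : x ∈ W := by
  obtain ⟨-, S, hS, rfl⟩ := hW
  rw [Submodule.mem_sInf]
  intro U hU
  obtain ⟨j, rfl⟩ := hS hU
  exact hx j (sInf_le hU)

/-- A flat is determined by the hyperplanes that contain it. -/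
theorem flats_ext {F : Family d J} {W W' : Submodule ℂ (Fin d → ℂ)} (hW : W ∈ F.flats)
    (hW' : W' ∈ F.flats) (h : ∀ j, W ≤ F.hyper j ↔ W' ≤ F.hyper j) : W = W' :=
  le_antisymm (fun _ hx => mem_of_mem_flats hW' fun j hj => (h j).2 hj hx)
    (fun _ hx => mem_of_mem_flats hW fun j hj => (h j).1 hj hx)

theorem exists_le_hyper {F : Family d J} {W : Submodule ℂ (Fin d → ℂ)} (hW : W ∈ F.flats) :
    ∃ j, W ≤ F.hyper j := by
  by_contra! h
  exact hW.1 (eq_top_iff.2 fun x _ => mem_of_mem_flats hW fun j hj => absurd hj (h j))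

theorem finite_intersectionLattice {𝒜 : Set (Submodule ℂ (Fin d → ℂ))} (h𝒜 : 𝒜.Finite) :
    (intersectionLattice 𝒜).Finite := by
  refine (h𝒜.finite_subsets.image sInf).subset ?_
  rintro W ⟨-, S, hS, rfl⟩
  exact ⟨S, hS, rfl⟩

/-- The common zero space of the basis elements from the `p`-th one on. -/
def flag (F : Family d J) (β : Fin d → J) (p : Fin d) : Submodule ℂ (Fin d → ℂ) :=
  sInf (F.hyper '' (β '' Set.Ici p))

theorem mem_flag {F : Family d J} {β : Fin d → J} {p : Fin d} {x : Fin d → ℂ} :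
    x ∈ F.flag β p ↔ ∀ i, p ≤ i → F.form (β i) ⬝ᵥ x = 0 := by
  simp [flag, Submodule.mem_sInf, mem_hyper]

theorem flag_mem_flats (F : Family d J) (β : Fin d → J) (p : Fin d) : F.flag β p ∈ F.flats := by
  refine ⟨fun h => F.hyper_ne_top (β p) (top_le_iff.1 ?_), _, ?_, rfl⟩
  · rw [← h]
    exact fun x hx => mem_flag.1 hx p le_rfl
  · rintro _ ⟨j, -, rfl⟩
    exact ⟨j, rfl⟩

theorem flag_mono (F : Family d J) (β : Fin d → J) : Monotone (F.flag β) := fun _ _ h _ hx =>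
  mem_flag.2 fun i hi => mem_flag.1 hx i (h.trans hi)

theorem dotProduct_inv_mulVec {F : Family d J} {β : Fin d → J} (hβ : (rows F.form β).det ≠ 0)
    (y : Fin d → ℂ) (i : Fin d) : F.form (β i) ⬝ᵥ ((rows F.form β)⁻¹ *ᵥ y) = y i := by
  have : rows F.form β *ᵥ ((rows F.form β)⁻¹ *ᵥ y) = y := by
    rw [mulVec_mulVec, mul_nonsing_inv _ (Ne.isUnit hβ), one_mulVec]
  exact congrFun this i

theorem codim_flag (F : Family d J) {β : Fin d → J} (hβ : (rows F.form β).det ≠ 0) (p : Fin d) :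
    codim (F.flag β p) = d - p := by
  let T : (Fin d → ℂ) →ₗ[ℂ] (Set.Ici p → ℂ) :=
    LinearMap.funLeft ℂ ℂ (Subtype.val : Set.Ici p → Fin d) ∘ₗ (rows F.form β).mulVecLin
  have hT : ∀ x i, T x i = F.form (β i) ⬝ᵥ x := fun x i => rfl
  have hker : LinearMap.ker T = F.flag β p := by
    ext x
    rw [LinearMap.mem_ker, mem_flag]
    constructor
    · intro h i hi
      rw [← hT x ⟨i, hi⟩, h]; rfl
    · intro h
      ext i
      rw [hT]; exact h i i.2
  have hsurj : Function.Surjective T := by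
    classical
    intro y
    refine ⟨(rows F.form β)⁻¹ *ᵥ fun i => if h : p ≤ i then y ⟨i, h⟩ else 0, ?_⟩
    ext i
    rw [hT, dotProduct_inv_mulVec hβ]
    have : p ≤ i.1 := i.2
    simp [this]
  rw [codim, ← hker, (T.quotKerEquivOfSurjective hsurj).finrank_eq,
    Module.finrank_fintype_fun_eq_card]
  rw [← Nat.card_eq_fintype_card, Nat.card_coe_set_eq, ← Finset.coe_Ici, Set.ncard_coe_finset,
    Fin.card_Ici]

theorem finrank_add_codim (W : Submodule ℂ (Fin d → ℂ)) :
    Module.finrank ℂ W + codim W = d := by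
  have := Submodule.finrank_quotient_add_finrank W
  rw [Module.finrank_fin_fun] at this
  rw [codim]; omega

theorem finrank_flag (F : Family d J) {β : Fin d → J} (hβ : (rows F.form β).det ≠ 0)
    (p : Fin d) : Module.finrank ℂ (F.flag β p) = p := by
  have h1 := finrank_add_codim (F.flag β p)
  rw [F.codim_flag hβ] at h1
  omega

theorem flag_le_hyper_iff [NeZero d] (F : Family d J) {β : Fin d → J}
    (hβ : (rows F.form β).det ≠ 0) {p : Fin d} {j : J} :
    F.flag β p ≤ F.hyper j ↔ p ≤ lead F.form β j := by
  constructor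
  · intro h
    by_contra! hlt
    have hx : (rows F.form β)⁻¹ *ᵥ Pi.single (lead F.form β j) 1 ∈ F.flag β p := by
      rw [mem_flag]
      intro i hi
      rw [dotProduct_inv_mulVec hβ, Pi.single_eq_of_ne (hlt.trans_le hi).ne']
    have h0 := mem_hyper.1 (h hx)
    rw [dotProduct_eq_sum_coef hβ, Finset.sum_eq_single (lead F.form β j)] at h0
    · rw [dotProduct_inv_mulVec hβ, Pi.single_eq_same, mul_one] at h0
      exact (lead_spec hβ (F.ne_zero j)).1 h0
    · intro i _ hi
      rw [dotProduct_inv_mulVec hβ, Pi.single_eq_of_ne hi, mul_zero]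
    · simp
  · intro h x hx
    rw [mem_hyper, dotProduct_eq_sum_coef hβ]
    refine Finset.sum_eq_zero fun i _ => ?_
    rcases lt_or_ge i (lead F.form β j) with hi | hi
    · rw [(lead_spec hβ (F.ne_zero j)).2 i hi, zero_mul]
    · rw [mem_flag.1 hx i (h.trans hi), mul_zero]

open Classical in
/-- Every chain of flats is part of the flag of some basis among the forms. -/
theorem exists_flag_eq [NeZero d] [Finite J] (F : Family d J)
    (𝒞 : Finset (Submodule ℂ (Fin d → ℂ)))
    (h𝒞 : ∀ W ∈ 𝒞, W ∈ F.flats) (hchain : IsChain (· ≤ ·) (𝒞 : Set (Submodule ℂ (Fin d → ℂ)))) :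
    ∃ β : Fin d → J, (rows F.form β).det ≠ 0 ∧ ∀ W ∈ 𝒞, ∃ p, W = F.flag β p := by
  -- the weight of a form: the number of members of the chain on which it does not vanish
  let S : J → Finset (Submodule ℂ (Fin d → ℂ)) := fun j => 𝒞.filter fun W => ¬ W ≤ F.hyper j
  obtain ⟨β, hβ, hanti, hcoef⟩ := exists_greedy_basis F.spanning fun j => (S j).card
  have hS : ∀ j k, (S k).card ≤ (S j).card → ∀ W ∈ 𝒞, W ≤ F.hyper j → W ≤ F.hyper k := by
    intro j k hjk W hW hWj
    by_contra hWk
    have hsub : S j ⊆ S k := by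
      intro U hU
      simp only [S, Finset.mem_filter] at hU ⊢
      refine ⟨hU.1, fun hUk => ?_⟩
      rcases hchain.total hW hU.1 with h | h
      · exact hWk (h.trans hUk)
      · exact hU.2 (h.trans hWj)
    have heq := Finset.eq_of_subset_of_card_le hsub hjk
    have hWS : W ∈ S k := Finset.mem_filter.2 ⟨hW, hWk⟩
    rw [← heq] at hWS
    exact (Finset.mem_filter.1 hWS).2 hWj
  refine ⟨β, hβ, fun W hW => ?_⟩
  have hlead : ∀ j, W ≤ F.hyper j → W ≤ F.hyper (β (lead F.form β j)) := fun j hj =>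
    hS j _ (hcoef j _ (lead_spec hβ (F.ne_zero j)).1) W hW hj
  have hup : ∀ i i', i ≤ i' → W ≤ F.hyper (β i) → W ≤ F.hyper (β i') := fun i i' hi h =>
    hS _ _ (hanti hi) W hW h
  have hne : (Finset.univ.filter fun i => W ≤ F.hyper (β i)).Nonempty := by
    obtain ⟨j, hj⟩ := exists_le_hyper (h𝒞 W hW)
    exact ⟨lead F.form β j, by simpa using hlead j hj⟩
  have hpmem : W ≤ F.hyper (β (Finset.min' _ hne)) := by simpa using Finset.min'_mem _ hne
  refine ⟨Finset.min' _ hne, flats_ext (h𝒞 W hW) (F.flag_mem_flats β _) fun j => ?_⟩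
  rw [F.flag_le_hyper_iff hβ]
  constructor
  · intro hj
    exact Finset.min'_le _ _ (by simpa using hlead j hj)
  · intro hp x hx
    rw [mem_hyper, dotProduct_eq_sum_coef hβ]
    refine Finset.sum_eq_zero fun i _ => ?_
    rcases lt_or_ge i (lead F.form β j) with hi | hi
    · rw [(lead_spec hβ (F.ne_zero j)).2 i hi, zero_mul]
    · rw [mem_hyper.1 (hup _ i (hp.trans hi) hpmem hx), mul_zero]

/-! ### The divisors of the model -/

/-- The divisor of a flat `W`: the forms that vanish on `W` are zero, and infinitely smaller than
the others. -/
def divisor (F : Family d J) (W : Submodule ℂ (Fin d → ℂ)) :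
    Set ((Fin d → ℂ) × (J → J → OnePoint ℂ)) :=
  {P | (∀ j, W ≤ F.hyper j → F.form j ⬝ᵥ P.1 = 0) ∧
    ∀ j k, W ≤ F.hyper j → ¬ W ≤ F.hyper k → P.2 j k = ((0 : ℂ) : OnePoint ℂ)}

theorem isClosed_divisor (F : Family d J) (W : Submodule ℂ (Fin d → ℂ)) :
    IsClosed (F.divisor W) := by
  have h1 : IsClosed {P : (Fin d → ℂ) × (J → J → OnePoint ℂ) |
      ∀ j, W ≤ F.hyper j → F.form j ⬝ᵥ P.1 = 0} := by
    simp only [Set.ofPred_forall]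
    exact isClosed_iInter fun j => isClosed_iInter fun _ =>
      isClosed_eq (continuous_const.dotProduct continuous_fst) continuous_const
  have h2 : IsClosed {P : (Fin d → ℂ) × (J → J → OnePoint ℂ) |
      ∀ j k, W ≤ F.hyper j → ¬ W ≤ F.hyper k → P.2 j k = ((0 : ℂ) : OnePoint ℂ)} := by
    simp only [Set.ofPred_forall]
    exact isClosed_iInter fun j => isClosed_iInter fun k => isClosed_iInter fun _ =>
      isClosed_iInter fun _ => isClosed_eq (by fun_prop) continuous_const
  exact h1.inter h2

theorem mono_eq_zero {u : Fin d → ℂ} {p i : Fin d} (h : p ≤ i) (hp : u p = 0) : mono i u = 0 :=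
  Finset.prod_eq_zero (Finset.mem_Iic.2 h) hp

theorem seg_eq_zero {u : Fin d → ℂ} {p i k : Fin d} (hk : k < p) (h : p ≤ i) (hp : u p = 0) :
    seg k i u = 0 :=
  Finset.prod_eq_zero (Finset.mem_Ioc.2 ⟨hk, h⟩) hp

variable [NeZero d]

/-- In a chart, the divisors of the flats are the coordinate hyperplanes. -/
theorem chartPt_mem_divisor_iff (F : Family d J) {β : Fin d → J}
    (hβ : (rows F.form β).det ≠ 0) {u : Fin d → ℂ} (hu : u ∈ F.chartDomain β)
    {W : Submodule ℂ (Fin d → ℂ)} (hW : W ∈ F.flats) :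
    F.chartPt β u ∈ F.divisor W ↔ ∃ p, W = F.flag β p ∧ u p = 0 := by
  constructor
  · rintro ⟨h1, h2⟩
    obtain ⟨j, hj, hmin⟩ : ∃ j, W ≤ F.hyper j ∧
        ∀ k, W ≤ F.hyper k → lead F.form β j ≤ lead F.form β k := by
      obtain ⟨j₁, hj₁⟩ := exists_le_hyper hW
      obtain ⟨i, ⟨j, hj, rfl⟩, hi⟩ := Set.exists_min_image
        (lead F.form β '' {j | W ≤ F.hyper j}) id (Set.toFinite _) ⟨_, j₁, hj₁, rfl⟩
      exact ⟨j, hj, fun k hk => hi _ ⟨k, hk, rfl⟩⟩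
    have hout : ∀ k, ¬ W ≤ F.hyper k → lead F.form β k < lead F.form β j := by
      intro k hk
      have h3 := (ratio_eq_zero_iff.1 (h2 j k hj hk)).1
      by_contra! hle
      rw [seg_of_le hle, one_mul] at h3
      exact hu j h3
    have hiff : ∀ k, W ≤ F.hyper k ↔ lead F.form β j ≤ lead F.form β k := fun k =>
      ⟨hmin k, fun h => by_contra fun hk => absurd h (not_le.2 (hout k hk))⟩
    have hWp : W = F.flag β (lead F.form β j) :=
      flats_ext hW (F.flag_mem_flats β _) fun k => by rw [hiff, F.flag_le_hyper_iff hβ]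
    refine ⟨_, hWp, ?_⟩
    generalize lead F.form β j = p at *
    have hp : W ≤ F.hyper (β p) := by rw [hiff, lead_self hβ F.ne_zero]
    by_cases hp0 : p = 0
    · have h3 := h1 _ hp
      rw [hp0] at h3 ⊢
      rwa [chartPt, dotProduct_pt_self hβ, mono_zero] at h3
    · have hp' : ¬ W ≤ F.hyper (β (p - 1)) := by
        rw [hiff, lead_self hβ F.ne_zero]
        exact not_le.2 (pred_lt hp0)
      have h3 := (ratio_eq_zero_iff.1 (h2 _ _ hp hp')).1
      rwa [lead_self hβ F.ne_zero, lead_self hβ F.ne_zero, unitPart_self hβ F.ne_zero, mul_one,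
        seg_pred hp0] at h3
  · rintro ⟨p, rfl, hp⟩
    refine ⟨fun j hj => ?_, fun j k hj hk => ?_⟩
    · rw [F.flag_le_hyper_iff hβ] at hj
      rw [chartPt, dotProduct_pt hβ (F.ne_zero j), mono_eq_zero hj hp, zero_mul]
    · rw [F.flag_le_hyper_iff hβ] at hj hk
      rw [not_le] at hk
      refine ratio_eq_zero_iff.2 ⟨?_, ?_⟩
      · rw [seg_eq_zero hk hj hp, zero_mul]
      · rw [seg_of_le (hk.le.trans hj), one_mul]
        exact hu k

theorem zero_mem_chartDomain (F : Family d J) {β : Fin d → J} (hβ : (rows F.form β).det ≠ 0) :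
    0 ∈ F.chartDomain β := fun j => unitPart_zero_ne_zero hβ (F.ne_zero j)

/-- The divisors of the flats of a chain have a common point. -/
theorem exists_mem_divisors [Finite J] (F : Family d J) (𝒞 : Finset (Submodule ℂ (Fin d → ℂ)))
    (h𝒞 : ∀ W ∈ 𝒞, W ∈ F.flats) (hchain : IsChain (· ≤ ·) (𝒞 : Set (Submodule ℂ (Fin d → ℂ)))) :
    ∃ P : F.Model, ∀ W ∈ 𝒞, P.1 ∈ F.divisor W := by
  obtain ⟨β, hβ, h⟩ := F.exists_flag_eq 𝒞 h𝒞 hchain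
  have h0 := F.zero_mem_chartDomain hβ
  refine ⟨⟨F.chartPt β 0, F.chartPt_mem hβ h0⟩, fun W hW => ?_⟩
  obtain ⟨p, hp⟩ := h W hW
  exact (F.chartPt_mem_divisor_iff hβ h0 (h𝒞 W hW)).2 ⟨p, hp, rfl⟩

/-- The flats whose divisors pass through one point form a chain. -/
theorem isChain_divisors [Finite J] (F : Family d J) (P : F.Model) :
    IsChain (· ≤ ·) {W | W ∈ F.flats ∧ P.1 ∈ F.divisor W} := by
  intro W hW W' hW' _
  have hP := F.mem_coordDomain_basisAt P
  have hβ := F.basisAt_det P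
  have hpt := F.chartPt_chartCoord hβ P.2 hP
  have key : ∀ U, U ∈ F.flats ∧ P.1 ∈ F.divisor U → ∃ p, U = F.flag (F.basisAt P) p := by
    rintro U ⟨hU, hPU⟩
    rw [← hpt] at hPU
    obtain ⟨p, hp, -⟩ := (F.chartPt_mem_divisor_iff hβ hP.2 hU).1 hPU
    exact ⟨p, hp⟩
  obtain ⟨p, rfl⟩ := key W hW
  obtain ⟨p', rfl⟩ := key W' hW'
  rcases le_total p p' with h | h
  · exact Or.inl (F.flag_mono _ h)
  · exact Or.inr (F.flag_mono _ h)

end Family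
end Arrangement

namespace Arrangement

open Matrix Topology Filter

/-! ### Connectedness -/

/-- Complements of finitely many complex hyperplanes are connected: two points are joined inside
the complex line through them, from which only finitely many points are missing. -/
theorem isPreconnected_forall_ne_zero {E κ : Type*} [AddCommGroup E] [Module ℂ E]
    [TopologicalSpace E] [ContinuousAdd E] [ContinuousSMul ℂ E] [Finite κ] (l : κ → E →ₗ[ℂ] ℂ) :
    IsPreconnected {x : E | ∀ k, l k x ≠ 0} := by
  refine isPreconnected_of_forall_pair fun x hx y hy => ?_
  let T : Set ℂ := {t | ∀ k, l k (x + t • (y - x)) ≠ 0}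
  have hT : Tᶜ.Countable := by
    refine ((Set.finite_range fun k => l k x / (l k x - l k y)).subset fun t ht => ?_).countable
    simp only [T, Set.mem_compl_iff, Set.mem_ofPred_eq, not_forall, not_not] at ht
    obtain ⟨k, hk⟩ := ht
    refine ⟨k, ?_⟩
    simp only [map_add, map_smul, map_sub, smul_eq_mul] at hk
    have hne : l k x - l k y ≠ 0 := fun h0 => hx k (by linear_combination hk + t * h0)
    show l k x / (l k x - l k y) = t
    rw [div_eq_iff hne]
    linear_combination hk
  have hconn : IsPreconnected T := by
    rw [← compl_compl T]
    exact (hT.isConnected_compl_of_one_lt_rank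
      (by rw [Complex.rank_real_complex]; exact Nat.one_lt_ofNat)).isPreconnected
  have hcont : Continuous fun t : ℂ => x + t • (y - x) := by fun_prop
  refine ⟨(fun t : ℂ => x + t • (y - x)) '' T, ?_, ⟨0, fun k => ?_, by simp⟩,
    ⟨1, fun k => ?_, by simp⟩, hconn.image _ hcont.continuousOn⟩
  · rintro _ ⟨t, ht, rfl⟩
    exact ht
  · simpa using hx k
  · simpa using hy k

namespace Family
variable {d : ℕ} {J : Type}

/-- The form `F j` as a linear map. -/
def lin (F : Family d J) (j : J) : (Fin d → ℂ) →ₗ[ℂ] ℂ where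
  toFun x := F.form j ⬝ᵥ x
  map_add' := dotProduct_add _
  map_smul' c x := by simp [dotProduct_smul]

theorem isPreconnected_generic [Finite J] (F : Family d J) : IsPreconnected F.generic :=
  isPreconnected_forall_ne_zero F.lin

open Classical in
/-- The homogeneous coordinates of the ratios at the point `w + t v`, for `w` in the flat `W`,
divided by `t` for two forms that vanish on `W`. -/
def limitCoord (F : Family d J) (W : Submodule ℂ (Fin d → ℂ)) (w v : Fin d → ℂ) (t : ℂ)
    (j k : J) : ℂ :=
  if W ≤ F.hyper j then (if W ≤ F.hyper k then F.form j ⬝ᵥ v else t * (F.form j ⬝ᵥ v))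
  else F.form j ⬝ᵥ w + t * (F.form j ⬝ᵥ v)

/-- The point of the model over `w + t v`, see `limitPt_eq_graph`, with the ratios written such that
they are also defined for `t = 0`, where this is the limit of the points with `t ≠ 0`. -/
def limitPt (F : Family d J) (W : Submodule ℂ (Fin d → ℂ)) (w v : Fin d → ℂ) (t : ℂ) :
    (Fin d → ℂ) × (J → J → OnePoint ℂ) :=
  (w + t • v, fun j k => ratio (F.limitCoord W w v t j k) (F.limitCoord W w v t k j))

open Classical in
/-- The pairs `(w, v)` with `w` generic in `W` and `v` generic modulo `W`. -/
def limitDomain (F : Family d J) (W : Submodule ℂ (Fin d → ℂ)) : Set (W × (Fin d → ℂ)) :=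
  {q | ∀ j, (if W ≤ F.hyper j then F.lin j ∘ₗ LinearMap.snd ℂ W (Fin d → ℂ)
    else F.lin j ∘ₗ W.subtype ∘ₗ LinearMap.fst ℂ W (Fin d → ℂ)) q ≠ 0}

theorem mem_limitDomain {F : Family d J} {W : Submodule ℂ (Fin d → ℂ)} {q : W × (Fin d → ℂ)} :
    q ∈ F.limitDomain W ↔ (∀ j, W ≤ F.hyper j → F.form j ⬝ᵥ q.2 ≠ 0) ∧
      ∀ j, ¬ W ≤ F.hyper j → F.form j ⬝ᵥ (q.1 : Fin d → ℂ) ≠ 0 := by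
  constructor
  · intro h
    refine ⟨fun j hj => ?_, fun j hj => ?_⟩
    · have := h j
      rw [if_pos hj] at this
      exact this
    · have := h j
      rw [if_neg hj] at this
      exact this
  · rintro ⟨h1, h2⟩ j
    by_cases hj : W ≤ F.hyper j
    · rw [if_pos hj]; exact h1 j hj
    · rw [if_neg hj]; exact h2 j hj

theorem isPreconnected_limitDomain [Finite J] (F : Family d J) (W : Submodule ℂ (Fin d → ℂ)) :
    IsPreconnected (F.limitDomain W) :=
  isPreconnected_forall_ne_zero _

theorem limitCoord_ne_zero (F : Family d J) {W : Submodule ℂ (Fin d → ℂ)} {q : W × (Fin d → ℂ)}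
    (hq : q ∈ F.limitDomain W) (j k : J) :
    F.limitCoord W q.1 q.2 0 j k ≠ 0 ∨ F.limitCoord W q.1 q.2 0 k j ≠ 0 := by
  obtain ⟨h1, h2⟩ := mem_limitDomain.1 hq
  by_cases hj : W ≤ F.hyper j
  · by_cases hk : W ≤ F.hyper k
    · left; simpa [limitCoord, hj, hk] using h1 j hj
    · right; simpa [limitCoord, hj, hk] using h2 k hk
  · left; simpa [limitCoord, hj] using h2 j hj

theorem continuousOn_limitPt (F : Family d J) (W : Submodule ℂ (Fin d → ℂ)) :
    ContinuousOn (fun q : W × (Fin d → ℂ) => F.limitPt W q.1 q.2 0) (F.limitDomain W) := by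
  intro q hq
  refine ContinuousAt.continuousWithinAt ?_
  refine ContinuousAt.prodMk (by fun_prop)
    (continuousAt_pi.2 fun j => continuousAt_pi.2 fun k => ?_)
  have hc : ∀ j k, Continuous fun q : W × (Fin d → ℂ) => F.limitCoord W q.1 q.2 0 j k := by
    intro j k
    have h1 : Continuous fun q : W × (Fin d → ℂ) => F.form j ⬝ᵥ q.2 :=
      continuous_const.dotProduct continuous_snd
    have h2 : Continuous fun q : W × (Fin d → ℂ) => F.form j ⬝ᵥ (q.1 : Fin d → ℂ) :=
      continuous_const.dotProduct (continuous_subtype_val.comp continuous_fst)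
    unfold limitCoord
    split_ifs <;> fun_prop
  exact continuousAt_ratio_comp (hc j k).continuousAt (hc k j).continuousAt
    (F.limitCoord_ne_zero hq j k)

theorem limitPt_eq_graph (F : Family d J) {W : Submodule ℂ (Fin d → ℂ)} {w v : Fin d → ℂ}
    (hw : w ∈ W) {t : ℂ} (ht : t ≠ 0) : F.limitPt W w v t = F.graph (w + t • v) := by
  refine Prod.ext rfl (funext fun j => funext fun k => ?_)
  have hform : ∀ j, F.form j ⬝ᵥ (w + t • v) = F.form j ⬝ᵥ w + t * (F.form j ⬝ᵥ v) := fun j => by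
    rw [dotProduct_add, dotProduct_smul, smul_eq_mul]
  have hzero : ∀ j, W ≤ F.hyper j → F.form j ⬝ᵥ w = 0 := fun j hj => hj hw
  by_cases hj : W ≤ F.hyper j <;> by_cases hk : W ≤ F.hyper k <;>
    refine ratio_congr ?_ ?_ <;> simp [limitCoord, hj, hk, hform, hzero, ht]
  ring

theorem limitPt_mem [Finite J] (F : Family d J) {W : Submodule ℂ (Fin d → ℂ)}
    {q : W × (Fin d → ℂ)} (hq : q ∈ F.limitDomain W) :
    F.limitPt W q.1 q.2 0 ∈ F.modelSet := by
  obtain ⟨h1, h2⟩ := mem_limitDomain.1 hq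
  have hcont : ContinuousAt (F.limitPt W q.1 q.2) 0 := by
    refine ContinuousAt.prodMk (by fun_prop)
      (continuousAt_pi.2 fun j => continuousAt_pi.2 fun k => ?_)
    have hc : ∀ j k, Continuous fun t => F.limitCoord W q.1 q.2 t j k := by
      intro j k
      unfold limitCoord
      split_ifs <;> fun_prop
    exact continuousAt_ratio_comp (hc j k).continuousAt (hc k j).continuousAt
      (F.limitCoord_ne_zero hq j k)
  refine mem_closure_of_tendsto (b := 𝓝[≠] (0 : ℂ)) (hcont.tendsto.mono_left nhdsWithin_le_nhds) ?_
  have hgen : ∀ᶠ t in 𝓝[≠] (0 : ℂ), (q.1 : Fin d → ℂ) + t • q.2 ∈ F.generic := by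
    refine eventually_all.2 fun j => ?_
    by_cases hj : W ≤ F.hyper j
    · filter_upwards [self_mem_nhdsWithin] with t ht
      have h3 : F.form j ⬝ᵥ (q.1 : Fin d → ℂ) = 0 := hj q.1.2
      rw [dotProduct_add, dotProduct_smul, h3, zero_add, smul_eq_mul]
      exact mul_ne_zero ht (h1 j hj)
    · have hc : Continuous fun t : ℂ => F.form j ⬝ᵥ ((q.1 : Fin d → ℂ) + t • q.2) :=
        continuous_const.dotProduct (by fun_prop)
      have := (hc.tendsto 0).eventually_ne (b₂ := 0) (by simpa using h2 j hj)
      exact this.filter_mono nhdsWithin_le_nhds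
  filter_upwards [hgen, self_mem_nhdsWithin] with t ht ht0
  exact ⟨_, ht, (F.limitPt_eq_graph q.1.2 ht0).symm⟩

theorem limitPt_mem_divisor (F : Family d J) {W : Submodule ℂ (Fin d → ℂ)}
    {q : W × (Fin d → ℂ)} (hq : q ∈ F.limitDomain W) :
    F.limitPt W q.1 q.2 0 ∈ F.divisor W := by
  obtain ⟨h1, h2⟩ := mem_limitDomain.1 hq
  refine ⟨fun j hj => ?_, fun j k hj hk => ratio_eq_zero_iff.2 ⟨?_, ?_⟩⟩
  · simpa [limitPt] using mem_hyper.1 (hj q.1.2)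
  · simp [limitCoord, hj, hk]
  · simpa [limitCoord, hj, hk] using h2 k hk

theorem seg_mul_seg {p i k : Fin d} (h1 : p ≤ i) (h2 : i ≤ k) (u : Fin d → ℂ) :
    seg p i u * seg i k u = seg p k u := by
  rw [seg, seg, seg, ← Finset.prod_union]
  · congr 1
    ext q
    simp only [Finset.mem_union, Finset.mem_Ioc, Fin.lt_def, Fin.le_def] at *
    omega
  · rw [Finset.disjoint_left]
    intro q hq hq'
    simp only [Finset.mem_Ioc, Fin.lt_def, Fin.le_def] at *
    omega

variable [NeZero d]

/-- The points of a chart that lie on the `p`-th coordinate hyperplane and on no other one are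
limits along `w + t v`, with `w` generic in the `p`-th flag space. -/
theorem exists_limitPt_eq_chartPt (F : Family d J) {β : Fin d → J}
    (hβ : (rows F.form β).det ≠ 0) {u : Fin d → ℂ} (hu : u ∈ F.chartDomain β) {p : Fin d}
    (hp : u p = 0) (hne : ∀ q, q ≠ p → u q ≠ 0) :
    ∃ q ∈ F.limitDomain (F.flag β p), F.limitPt (F.flag β p) q.1 q.2 0 = F.chartPt β u := by
  classical
  have hw : pt F.form β u ∈ F.flag β p := mem_flag.2 fun i hi => by
    rw [dotProduct_pt_self hβ, mono_eq_zero hi hp]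
  let v : Fin d → ℂ := (rows F.form β)⁻¹ *ᵥ fun i => if p ≤ i then seg p i u else 0
  have hv : ∀ j, p ≤ lead F.form β j → F.form j ⬝ᵥ v =
      seg p (lead F.form β j) u * unitPart F.form β j u := by
    intro j hj
    rw [dotProduct_eq_sum_coef hβ, unitPart, Finset.mul_sum]
    refine Finset.sum_congr rfl fun i _ => ?_
    rw [dotProduct_inv_mulVec hβ]
    rcases lt_or_ge i (lead F.form β j) with hi | hi
    · rw [(lead_spec hβ (F.ne_zero j)).2 i hi]; ring
    · rw [if_pos (hj.trans hi), ← seg_mul_seg hj hi]; ring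
  have hseg : ∀ i k, p ≤ i → seg i k u ≠ 0 := fun i k hi =>
    Finset.prod_ne_zero_iff.2 fun q hq =>
      hne q (hi.trans_lt (Finset.mem_Ioc.1 hq).1).ne'
  have hseg' : ∀ i k, k < p → seg i k u ≠ 0 := fun i k hk =>
    Finset.prod_ne_zero_iff.2 fun q hq => hne q ((Finset.mem_Ioc.1 hq).2.trans_lt hk).ne
  have hmono : ∀ i, i < p → mono i u ≠ 0 := fun i hi =>
    Finset.prod_ne_zero_iff.2 fun q hq => hne q ((Finset.mem_Iic.1 hq).trans_lt hi).ne
  refine ⟨(⟨_, hw⟩, v), mem_limitDomain.2 ⟨fun j hj => ?_, fun j hj => ?_⟩, ?_⟩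
  · rw [F.flag_le_hyper_iff hβ] at hj
    simp only [hv j hj]
    exact mul_ne_zero (hseg _ _ le_rfl) (hu j)
  · rw [F.flag_le_hyper_iff hβ, not_le] at hj
    simp only [dotProduct_pt hβ (F.ne_zero j)]
    exact mul_ne_zero (hmono _ hj) (hu j)
  · refine Prod.ext (by simp [limitPt, chartPt]) (funext fun j => funext fun k => ?_)
    simp only [limitPt, chartPt, limitCoord, F.flag_le_hyper_iff hβ, zero_mul, add_zero]
    by_cases hj : p ≤ lead F.form β j <;> by_cases hk : p ≤ lead F.form β k
    · simp only [hj, hk, if_true]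
      refine ratio_congr ?_ ?_
      · rw [hv j hj, hv k hk]
        rcases le_total (lead F.form β j) (lead F.form β k) with h | h
        · rw [seg_of_le h, ← seg_mul_seg hj h]; ring
        · rw [seg_of_le h, ← seg_mul_seg hk h]; ring
      · simp [hv k hk, hu k, hseg _ _ le_rfl, hseg _ _ hj]
    · simp only [hj, hk, if_true, if_false]
      rw [not_le] at hk
      rw [seg_eq_zero hk hj hp, zero_mul, dotProduct_pt hβ (F.ne_zero k)]
      refine ratio_congr (by ring) ?_
      simp [hu k, hmono _ hk, hseg' _ _ hk]
    · simp only [hj, hk, if_true, if_false]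
      rw [not_le] at hj
      rw [seg_eq_zero hj hk hp, zero_mul, ratio_zero_right, ratio_zero_right]
    · simp only [hj, hk, if_false]
      rw [not_le] at hj hk
      refine ratio_congr ?_ ?_
      · rw [dotProduct_pt hβ (F.ne_zero j), dotProduct_pt hβ (F.ne_zero k)]
        linear_combination (unitPart F.form β j u * unitPart F.form β k u) *
          mono_mul_seg_comm (lead F.form β j) (lead F.form β k) u
      · simp [dotProduct_pt hβ (F.ne_zero k), hu k, hmono _ hk, hseg' _ _ hk]

theorem divisor_subset_closure [Finite J] (F : Family d J) {W : Submodule ℂ (Fin d → ℂ)}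
    (hW : W ∈ F.flats) : F.divisor W ∩ F.modelSet ⊆
      closure ((fun q : W × (Fin d → ℂ) => F.limitPt W q.1 q.2 0) '' F.limitDomain W) := by
  classical
  rintro P ⟨hPW, hP⟩
  obtain ⟨β, hβ, hPβ⟩ := F.exists_mem_coordDomain hP
  have hpt := F.chartPt_chartCoord hβ hP hPβ
  set c := F.chartCoord β P
  rw [← hpt] at hPW
  obtain ⟨p, rfl, hp⟩ := (F.chartPt_mem_divisor_iff hβ hPβ.2 hW).1 hPW
  let r : (Fin d → ℂ) → (Fin d → ℂ) := fun u => Function.update u p 0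
  have hr : Continuous r := continuous_id.update p continuous_const
  have hrc : r c = c := by
    show Function.update c p 0 = c
    rw [← hp, Function.update_eq_self]
  have hcl : c ∈ closure (r ⁻¹' F.chartDomain β ∩ {u : Fin d → ℂ | ∀ i, u i ≠ 0}) :=
    dense_ne_zero.open_subset_closure_inter ((F.isOpen_chartDomain β).preimage hr)
      (by rw [Set.mem_preimage, hrc]; exact hPβ.2)
  have hcont : ContinuousAt (fun u => F.chartPt β (r u)) c := by
    refine ContinuousAt.comp (g := F.chartPt β) ?_ hr.continuousAt
    rw [hrc]; exact F.continuousAt_chartPt hPβ.2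
  have := hcont.continuousWithinAt.mem_closure hcl (t := (fun q : F.flag β p × (Fin d → ℂ) =>
    F.limitPt (F.flag β p) q.1 q.2 0) '' F.limitDomain (F.flag β p)) (by
      rintro u ⟨hu, hu0⟩
      have hu' : r u ∈ F.chartDomain β := hu
      obtain ⟨q, hq, h⟩ := F.exists_limitPt_eq_chartPt hβ hu' (p := p) (Function.update_self ..)
        fun q hq => by
          show Function.update u p 0 q ≠ 0
          rw [Function.update_of_ne hq]; exact hu0 q
      exact ⟨q, hq, h⟩)
  rwa [hrc, hpt] at this

theorem isConnected_divisor [Finite J] (F : Family d J) {W : Submodule ℂ (Fin d → ℂ)}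
    (hW : W ∈ F.flats) : IsConnected {P : F.Model | P.1 ∈ F.divisor W} := by
  constructor
  · obtain ⟨P, hP⟩ := F.exists_mem_divisors {W} (by simpa using hW) (by simp)
    exact ⟨P, hP W (by simp)⟩
  · have himage : (Subtype.val '' {P : F.Model | P.1 ∈ F.divisor W}) =
        F.divisor W ∩ F.modelSet := by
      ext P
      constructor
      · rintro ⟨Q, hQ, rfl⟩
        exact ⟨hQ, Q.2⟩
      · rintro ⟨hP, hP'⟩
        exact ⟨⟨P, hP'⟩, hP, rfl⟩
    rw [← IsInducing.subtypeVal.isPreconnected_image, himage]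
    refine ((F.isPreconnected_limitDomain W).image _ (F.continuousOn_limitPt W)).subset_closure
      ?_ (F.divisor_subset_closure hW)
    rintro _ ⟨q, hq, rfl⟩
    exact ⟨F.limitPt_mem_divisor hq, F.limitPt_mem hq⟩

theorem generic_nonempty [Finite J] (F : Family d J) : F.generic.Nonempty := by
  obtain ⟨β, hβ⟩ := F.spanning
  obtain ⟨u, hu, hu0⟩ := dense_ne_zero.inter_open_nonempty _ (F.isOpen_chartDomain β)
    ⟨0, F.zero_mem_chartDomain hβ⟩
  exact ⟨_, F.pt_mem_generic hβ hu hu0⟩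

instance connectedSpace [Finite J] (F : Family d J) : ConnectedSpace F.Model := by
  refine isConnected_iff_connectedSpace.1 (IsConnected.closure ⟨F.generic_nonempty.image _, ?_⟩)
  exact F.isPreconnected_generic.image _ fun x hx =>
    (F.continuousAt_graph hx).continuousWithinAt

end Family
end Arrangement

namespace Arrangement

open Matrix Topology Filter

/-! ### The Jacobian determinant of the monomial coordinates -/

theorem hasFDerivAt_mono {d : ℕ} (i : Fin d) (u : Fin d → ℂ) :
    HasFDerivAt (mono i) (∑ q ∈ Finset.Iic i, (∏ k ∈ (Finset.Iic i).erase q, u k) •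
      ContinuousLinearMap.proj (R := ℂ) (φ := fun _ : Fin d => ℂ) q) u := by
  classical
  exact HasFDerivAt.finsetProd (g := fun q (u : Fin d → ℂ) => u q) fun q _ => hasFDerivAt_apply q u

/-- The derivative of the monomial coordinates is triangular. -/
theorem det_fderiv_pt {d : ℕ} {J : Type} (F : J → Fin d → ℂ) (β : Fin d → J) (u : Fin d → ℂ) :
    (fderiv ℂ (pt F β) u).det = ((rows F β)⁻¹).det * ∏ p, u p ^ (d - 1 - (p : ℕ)) := by
  classical
  let D : (Fin d → ℂ) →L[ℂ] (Fin d → ℂ) := ContinuousLinearMap.pi fun i =>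
    ∑ q ∈ Finset.Iic i, (∏ k ∈ (Finset.Iic i).erase q, u k) •
      ContinuousLinearMap.proj (R := ℂ) (φ := fun _ : Fin d => ℂ) q
  have hD : HasFDerivAt (fun u i => mono i u) D u :=
    hasFDerivAt_pi.2 fun i => hasFDerivAt_mono i u
  have hpt : HasFDerivAt (pt F β)
      ((Matrix.mulVecLin (rows F β)⁻¹).toContinuousLinearMap.comp D) u :=
    ((Matrix.mulVecLin (rows F β)⁻¹).toContinuousLinearMap.hasFDerivAt).comp u hD
  rw [hpt.fderiv, ContinuousLinearMap.det]
  have hentry : ∀ i k, LinearMap.toMatrix' (D : (Fin d → ℂ) →ₗ[ℂ] (Fin d → ℂ)) i k =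
      if k ≤ i then ∏ q ∈ (Finset.Iic i).erase k, u q else 0 := by
    intro i k
    rw [LinearMap.toMatrix'_apply]
    simp [D, Pi.single_apply]
  have htri : (LinearMap.toMatrix' (D : (Fin d → ℂ) →ₗ[ℂ] (Fin d → ℂ))).BlockTriangular
      OrderDual.toDual := by
    intro i k hik
    rw [hentry, if_neg (not_le.2 (OrderDual.toDual_lt_toDual.1 hik))]
  have hdet : LinearMap.det (D : (Fin d → ℂ) →ₗ[ℂ] (Fin d → ℂ)) =
      ∏ p, u p ^ (d - 1 - (p : ℕ)) := by
    rw [← LinearMap.det_toMatrix', Matrix.det_of_isLowerTriangular _ htri]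
    simp only [hentry, le_refl, if_true, Finset.Iic_erase]
    rw [Finset.prod_comm' (t' := Finset.univ) (s' := fun q => Finset.Ioi q) (by simp)]
    simp [Fin.card_Ioi]
  rw [← hdet, ← LinearMap.det_toLin', ← LinearMap.det_comp]
  rfl

theorem analyticAt_prod_add {d : ℕ} (c : Fin d → ℂ) (t : Finset (Fin d)) (g : Fin d → ℕ)
    (v : Fin d → ℂ) : AnalyticAt ℂ (fun v => ∏ p ∈ t, (c + v) p ^ g p) v :=
  Finset.analyticAt_fun_prod _ fun p _ => (analyticAt_const.add
    ((ContinuousLinearMap.proj (R := ℂ) (φ := fun _ : Fin d => ℂ) p).analyticAt v)).pow _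

namespace Family
variable {d : ℕ} {J : Type} [Fintype J]

open Classical in
/-- The order of `∏ j, F j ^ s j` along the flat `W`. -/
def order (F : Family d J) (s : J → ℕ) (W : Submodule ℂ (Fin d → ℂ)) : ℕ :=
  ∑ j with W ≤ F.hyper j, s j

/-- The flats whose divisors occur in the pullback of `∏ j, F j ^ s j` or are exceptional. -/
def Index (F : Family d J) (s : J → ℕ) : Type :=
  {W : Submodule ℂ (Fin d → ℂ) // W ∈ F.flats ∧ (0 < F.order s W ∨ 0 < codim W - 1)}

instance (F : Family d J) (s : J → ℕ) : Finite (F.Index s) :=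
  (((finite_intersectionLattice (Set.finite_range F.hyper)).subset fun _ h => h.1).to_subtype :
    Finite {W | W ∈ F.flats ∧ (0 < F.order s W ∨ 0 < codim W - 1)})

instance (F : Family d J) (s : J → ℕ) : Fintype (F.Index s) := Fintype.ofFinite _

omit [Fintype J] in
theorem finrank_lt {F : Family d J} {W : Submodule ℂ (Fin d → ℂ)} (hW : W ∈ F.flats) :
    Module.finrank ℂ W < d := by
  have := Submodule.finrank_lt hW.1
  rwa [Module.finrank_fin_fun] at this

/-- The coordinate that defines the divisor of a flat: its number is the dimension. -/
def coordIndex (F : Family d J) (s : J → ℕ) (W : F.Index s) : Fin d :=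
  ⟨Module.finrank ℂ W.1, finrank_lt W.2.1⟩

theorem coordIndex_eq (F : Family d J) (s : J → ℕ) {β : Fin d → J}
    (hβ : (rows F.form β).det ≠ 0) {W : F.Index s} {p : Fin d} (h : W.1 = F.flag β p) :
    F.coordIndex s W = p := by
  apply Fin.ext
  show Module.finrank ℂ W.1 = p
  rw [h, F.finrank_flag hβ]

variable [NeZero d]

open Classical in
/-- A monomial in the coordinates of a chart, as a monomial in the coordinates centred at a point
with coordinate vector `c`, times a unit. -/
theorem prod_pow_eq (F : Family d J) (s : J → ℕ) {β : Fin d → J}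
    (hβ : (rows F.form β).det ≠ 0) {c : Fin d → ℂ} (hc : c ∈ F.chartDomain β)
    (G : F.Index s → ℕ) (g : Fin d → ℕ) (h1 : ∀ W p, W.1 = F.flag β p → g p = G W)
    (h2 : ∀ p, (∀ W : F.Index s, W.1 ≠ F.flag β p) → g p = 0) (v : Fin d → ℂ) :
    ∏ p, (c + v) p ^ g p = (∏ p with c p ≠ 0, (c + v) p ^ g p) *
      ∏ W : F.Index s with F.chartPt β c ∈ F.divisor W.1, v (F.coordIndex s W) ^ G W := by
  have hW : ∀ W : F.Index s, F.chartPt β c ∈ F.divisor W.1 →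
      W.1 = F.flag β (F.coordIndex s W) ∧ c (F.coordIndex s W) = 0 := by
    intro W hWc
    obtain ⟨p, hp, hcp⟩ := (F.chartPt_mem_divisor_iff hβ hc W.2.1).1 hWc
    rw [F.coordIndex_eq s hβ hp]
    exact ⟨hp, hcp⟩
  rw [← Finset.prod_filter_mul_prod_filter_not Finset.univ (fun p => c p ≠ 0)]
  congr 1
  have hinj : Set.InjOn (F.coordIndex s)
      ((Finset.univ.filter fun W : F.Index s => F.chartPt β c ∈ F.divisor W.1 :
        Finset (F.Index s)) : Set (F.Index s)) := by
    intro W hWm W' hWm' h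
    have e1 := (hW W (by simpa using hWm)).1
    have e2 := (hW W' (by simpa using hWm')).1
    exact Subtype.ext (by rw [e1, e2, h])
  have himage : ∏ W : F.Index s with F.chartPt β c ∈ F.divisor W.1, v (F.coordIndex s W) ^ G W =
      ∏ p ∈ (Finset.univ.filter fun W : F.Index s => F.chartPt β c ∈ F.divisor W.1).image
        (F.coordIndex s), v p ^ g p := by
    rw [Finset.prod_image hinj]
    refine Finset.prod_congr rfl fun W hWm => ?_
    rw [h1 W _ (hW W (Finset.mem_filter.1 hWm).2).1]
  rw [himage]
  symm
  refine (Finset.prod_subset ?_ ?_).trans (Finset.prod_congr rfl ?_)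
  · intro p hp
    obtain ⟨W, hWm, rfl⟩ := Finset.mem_image.1 hp
    simpa using (hW W (Finset.mem_filter.1 hWm).2).2
  · intro p hp hp'
    rw [h2 p, pow_zero]
    intro W hWp
    apply hp'
    refine Finset.mem_image.2 ⟨W, ?_, F.coordIndex_eq s hβ hWp⟩
    simp only [Finset.mem_filter, Finset.mem_univ, true_and, not_not] at hp ⊢
    exact (F.chartPt_mem_divisor_iff hβ hc W.2.1).2 ⟨p, hWp, hp⟩
  · intro p hp
    have : c p = 0 := by simpa using hp
    simp [this]

open Classical in
theorem prod_dotProduct_pt (F : Family d J) (s : J → ℕ) {β : Fin d → J}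
    (hβ : (rows F.form β).det ≠ 0) (u : Fin d → ℂ) :
    ∏ j, (F.form j ⬝ᵥ pt F.form β u) ^ s j =
      (∏ j, unitPart F.form β j u ^ s j) * ∏ p, u p ^ F.order s (F.flag β p) := by
  have h : ∀ j, mono (lead F.form β j) u ^ s j =
      ∏ p, if p ≤ lead F.form β j then u p ^ s j else 1 := by
    intro j
    rw [mono, ← Finset.prod_pow, ← Finset.prod_filter]
    congr 1
    ext q; simp
  simp only [dotProduct_pt hβ (F.ne_zero _), mul_pow, Finset.prod_mul_distrib, h]
  rw [Finset.prod_comm, mul_comm]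
  congr 1
  refine Finset.prod_congr rfl fun p _ => ?_
  simp only [order, F.flag_le_hyper_iff hβ]
  rw [← Finset.prod_filter, Finset.prod_pow_eq_pow_sum]

open Classical in
/-- In the chart centred at a point, the pullback of `∏ j, F j ^ s j` and the Jacobian determinant
of the resolution map are units times monomials. -/
theorem exists_normal_crossings (F : Family d J) (s : J → ℕ) (P : F.Model) :
    ∃ φ ∈ IsManifold.maximalAtlas 𝓘(ℂ, Fin d → ℂ) ω F.Model,
    P ∈ φ.source ∧ φ P = 0 ∧
    ∃ j : F.Index s → Fin d, Set.InjOn j {W | P.1 ∈ F.divisor W.1} ∧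
      (∀ W : F.Index s, P.1 ∈ F.divisor W.1 →
        ∀ x ∈ φ.source, x.1 ∈ F.divisor W.1 ↔ φ x (j W) = 0) ∧
      (∀ W : F.Index s, P.1 ∉ F.divisor W.1 → ∀ x ∈ φ.source, x.1 ∉ F.divisor W.1) ∧
      ∃ h h' : (Fin d → ℂ) → ℂ,
        AnalyticOnNhd ℂ h φ.target ∧ AnalyticOnNhd ℂ h' φ.target ∧
        ∀ u ∈ φ.target, h u ≠ 0 ∧ h' u ≠ 0 ∧
          ∏ j, (F.form j ⬝ᵥ (φ.symm u).1.1) ^ s j =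
            h u * ∏ W : F.Index s with P.1 ∈ F.divisor W.1, u (j W) ^ F.order s W.1 ∧
          (fderiv ℂ (fun v => (φ.symm v).1.1) u).det =
            h' u * ∏ W : F.Index s with P.1 ∈ F.divisor W.1, u (j W) ^ (codim W.1 - 1) := by
  have hβ := F.basisAt_det P
  have hPβ := F.mem_coordDomain_basisAt P
  have hPc := F.chartPt_chartCoord hβ P.2 hPβ
  generalize F.basisAt P = β at *
  generalize hcdef : F.chartCoord β P.1 = c at *
  have hc : c ∈ F.chartDomain β := hcdef ▸ hPβ.2
  have hsrc : ∀ x ∈ (F.chart hβ c).source,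
      F.chartPt β (F.chartCoord β x.1) = x.1 ∧ F.chartCoord β x.1 ∈ F.chartDomain β ∧
        ∀ q, c q ≠ 0 → F.chartCoord β x.1 q ≠ 0 := fun x hx =>
    ⟨F.chartPt_chartCoord hβ x.2 ((F.mem_chart_source' hβ).1 hx).1,
      ((F.mem_chart_source' hβ).1 hx).1.2, ((F.mem_chart_source' hβ).1 hx).2⟩
  have hPW : ∀ W : F.Index s, P.1 ∈ F.divisor W.1 →
      W.1 = F.flag β (F.coordIndex s W) ∧ c (F.coordIndex s W) = 0 := by
    intro W hW
    rw [← hPc] at hW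
    obtain ⟨p, hp, hcp⟩ := (F.chartPt_mem_divisor_iff hβ hc W.2.1).1 hW
    rw [F.coordIndex_eq s hβ hp]
    exact ⟨hp, hcp⟩
  refine ⟨F.chart hβ c, IsManifold.subset_maximalAtlas ⟨β, hβ, c, rfl⟩,
    (F.mem_chart_source' hβ).2 ⟨hPβ, fun q hq => by rwa [hcdef]⟩,
    by rw [F.chart_apply, hcdef, sub_self], F.coordIndex s, ?_, ?_, ?_,
    fun v => (∏ j, unitPart F.form β j (c + v) ^ s j) *
      ∏ p with c p ≠ 0, (c + v) p ^ F.order s (F.flag β p),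
    fun v => ((rows F.form β)⁻¹).det * ∏ p with c p ≠ 0, (c + v) p ^ (d - 1 - (p : ℕ)),
    ?_, ?_, ?_⟩
  · intro W hW W' hW' h
    exact Subtype.ext (by rw [(hPW W hW).1, (hPW W' hW').1, h])
  · intro W hW x hx
    obtain ⟨hx1, hx2, -⟩ := hsrc x hx
    obtain ⟨hWp, hcp⟩ := hPW W hW
    rw [← hx1, F.chartPt_mem_divisor_iff hβ hx2 W.2.1, F.chart_apply, Pi.sub_apply, hcp, sub_zero]
    constructor
    · rintro ⟨p, hp, h0⟩
      rwa [F.coordIndex_eq s hβ hp]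
    · intro h0
      exact ⟨_, hWp, h0⟩
  · intro W hW x hx hxW
    obtain ⟨hx1, hx2, hx3⟩ := hsrc x hx
    rw [← hx1, F.chartPt_mem_divisor_iff hβ hx2 W.2.1] at hxW
    obtain ⟨p, hp, h0⟩ := hxW
    apply hW
    rw [← hPc, F.chartPt_mem_divisor_iff hβ hc W.2.1]
    exact ⟨p, hp, by_contra fun h => hx3 p h h0⟩
  · intro v _
    refine AnalyticAt.mul (Finset.analyticAt_fun_prod _ fun j _ => AnalyticAt.pow ?_ _)
      (analyticAt_prod_add c _ _ v)
    exact (analyticAt_unitPart F.form β j _).comp_of_eq (f := fun v => c + v)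
      (analyticAt_const.add analyticAt_id) rfl
  · intro v _
    exact analyticAt_const.mul (analyticAt_prod_add c _ _ v)
  · intro v hv
    obtain ⟨hv1, hv2⟩ := (F.mem_chart_target hβ).1 hv
    have hunit : ∀ g : Fin d → ℕ, ∏ p with c p ≠ 0, (c + v) p ^ g p ≠ 0 := fun g =>
      Finset.prod_ne_zero_iff.2 fun p hp => pow_ne_zero _ (hv2 p (Finset.mem_filter.1 hp).2)
    refine ⟨mul_ne_zero (Finset.prod_ne_zero_iff.2 fun j _ => pow_ne_zero _ (hv1 j)) (hunit _),
      mul_ne_zero ?_ (hunit _), ?_, ?_⟩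
    · rw [Matrix.det_nonsing_inv]
      exact (Ne.isUnit hβ).ringInverse.ne_zero
    · rw [F.chart_symm_val hβ hv1]
      show ∏ j, (F.form j ⬝ᵥ pt F.form β (c + v)) ^ s j = _
      rw [F.prod_dotProduct_pt s hβ, F.prod_pow_eq s hβ hc (fun W => F.order s W.1), ← mul_assoc,
        hPc]
      · intro W p h
        rw [h]
      · intro p h
        by_contra h0
        exact h ⟨F.flag β p, F.flag_mem_flats β p, Or.inl (Nat.pos_of_ne_zero h0)⟩ rfl
    · have hev : (fun w => ((F.chart hβ c).symm w).1.1) =ᶠ[𝓝 v] fun w => pt F.form β (c + w) := by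
        filter_upwards [(F.chart hβ c).open_target.mem_nhds hv] with w hw
        have hw1 := ((F.mem_chart_target hβ).1 hw).1
        rw [F.chart_symm_val hβ hw1]
        rfl
      rw [hev.fderiv_eq, fderiv_comp_add_left, det_fderiv_pt,
        F.prod_pow_eq s hβ hc (fun W => codim W.1 - 1), ← mul_assoc, hPc]
      · intro W p h
        rw [h, F.codim_flag hβ]
        omega
      · intro p h
        by_contra h0
        refine h ⟨F.flag β p, F.flag_mem_flats β p, Or.inr ?_⟩ rfl
        rw [F.codim_flag hβ]
        omega

/-- The model is a log resolution of `∏ j, F j ^ s j`. -/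
def logResolution (F : Family d J) (s : J → ℕ) (f : MvPolynomial (Fin d) ℂ)
    (hf : ∀ x, MvPolynomial.eval x f = ∏ j, (F.form j ⬝ᵥ x) ^ s j) : LogResolution f where
  X := F.Model
  ρ P := P.1.1
  holomorphic := F.contMDiff_fst
  proper := F.isProperMap_fst
  birational := by
    let g : MvPolynomial (Fin d) ℂ :=
      ∏ j, ∑ i, MvPolynomial.C (F.form j i) * MvPolynomial.X i
    have hg : ∀ x, MvPolynomial.eval x g ≠ 0 ↔ x ∈ F.generic := by
      intro x
      simp [g, map_prod, Finset.prod_ne_zero_iff, generic, dotProduct]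
    obtain ⟨x, hx⟩ := F.generic_nonempty
    refine ⟨g, fun h => (hg x).2 hx (by rw [h, map_zero]), F.lift, ?_, ?_, ?_⟩
    · simp only [hg]
      exact F.contMDiffOn_lift
    · intro y hy
      rw [F.lift_val ((hg y).1 hy)]
      rfl
    · intro P hP
      exact F.lift_fst ((hg _).1 hP)
  ι := F.Index s
  E W := {P | P.1 ∈ F.divisor W.1}
  isClosed_E W := (F.isClosed_divisor W.1).preimage continuous_subtype_val
  isConnected_E W := F.isConnected_divisor W.2.1
  a W := F.order s W.1
  b W := codim W.1 - 1
  supported W := W.2.2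
  snc P := by
    obtain ⟨φ, h1, h2, h3, j, h4, h5, h6, h, h', h7, h8, h9⟩ := F.exists_normal_crossings s P
    refine ⟨φ, h1, h2, h3, j, h4, h5, h6, h, h', h7, h8, fun u hu => ?_⟩
    obtain ⟨k1, k2, k3, k4⟩ := h9 u hu
    exact ⟨k1, k2, by rw [hf]; exact k3, k4⟩

end Family
end Arrangement

namespace Arrangement

open Topology Filter MeasureTheory

/-! ### Zero sets of analytic functions -/

/-- The zero set of an analytic function of one variable on a connected set is a null set if the
function is not identically zero. -/
theorem volume_zeros_one_variable {D : Set ℂ} (hD : IsPreconnected D) {g : ℂ → ℂ}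
    (hg : AnalyticOnNhd ℂ g D) {z₀ : ℂ} (hz₀ : z₀ ∈ D) (h : g z₀ ≠ 0) :
    volume {z | z ∈ D ∧ g z = 0} = 0 := by
  refine measure_null_of_locally_null _ ?_
  rintro z ⟨hzD, -⟩
  refine ⟨{z}, ?_, by simp⟩
  rcases (hg z hzD).eventually_eq_zero_or_eventually_ne_zero with h0 | h0
  · exact absurd (hg.eqOn_zero_of_preconnected_of_eventuallyEq_zero hD hzD h0 hz₀) h
  · rw [eventually_nhdsWithin_iff] at h0
    refine mem_nhdsWithin_iff_eventually.2 ?_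
    filter_upwards [h0] with w hw hwm
    by_contra hne
    exact hw hne hwm.2

/-- The zero set of an analytic function on a convex open set is a null set if the function is not
identically zero: by Fubini, almost every dilation of it about a point with `g x₀ ≠ 0` is. -/
theorem volume_zeros {d : ℕ} {D : Set (Fin d → ℂ)} (hDo : IsOpen D) (hDc : Convex ℝ D)
    {g : (Fin d → ℂ) → ℂ} (hg : AnalyticOnNhd ℂ g D) {x₀ : Fin d → ℂ} (hx₀ : x₀ ∈ D)
    (h : g x₀ ≠ 0) : volume {x | x ∈ D ∧ g x = 0} = 0 := by
  let m : (Fin d → ℂ) × ℂ → (Fin d → ℂ) := fun q => x₀ + q.2 • q.1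
  have hm : Continuous m := by fun_prop
  let S : Set ((Fin d → ℂ) × ℂ) := {q | m q ∈ D ∧ g (m q) = 0}
  have hcont : ContinuousOn (fun q => g (m q)) (m ⁻¹' D) :=
    hg.continuousOn.comp hm.continuousOn fun q hq => hq
  have hO : IsOpen (m ⁻¹' D) := hDo.preimage hm
  have hS : MeasurableSet S := by
    have : S = m ⁻¹' D \ (m ⁻¹' D ∩ (fun q => g (m q)) ⁻¹' {0}ᶜ) := by
      ext q
      simp only [S, Set.mem_ofPred_eq, Set.mem_sdiff, Set.mem_preimage, Set.mem_inter_iff,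
        Set.mem_compl_iff, Set.mem_singleton_iff]
      tauto
    rw [this]
    exact hO.measurableSet.diff
      (hcont.isOpen_inter_preimage hO isOpen_compl_singleton).measurableSet
  have hsec : ∀ x : Fin d → ℂ, volume (Prod.mk x ⁻¹' S) = 0 := by
    intro x
    have ha : ∀ z : ℂ, AnalyticAt ℂ (fun z : ℂ => x₀ + z • x) z := fun z =>
      analyticAt_const.add (analyticAt_id.smul analyticAt_const)
    have hconv : Convex ℝ {z : ℂ | x₀ + z • x ∈ D} := by
      intro z hz w hw s t hs ht hst
      have := hDc hz hw hs ht hst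
      show x₀ + (s • z + t • w) • x ∈ D
      convert! this using 1
      rw [smul_add, smul_add, add_add_add_comm, ← add_smul, hst, one_smul, add_smul, smul_assoc,
        smul_assoc]
    refine volume_zeros_one_variable (D := {z : ℂ | x₀ + z • x ∈ D}) hconv.isPreconnected
      (g := fun z => g (x₀ + z • x)) (fun z hz => (hg _ hz).comp_of_eq (ha z) rfl)
      (z₀ := 0) ?_ ?_
    · simpa using hx₀
    · simpa using h
  have hprod : (volume.prod volume : Measure ((Fin d → ℂ) × ℂ)) S = 0 :=
    Measure.measure_prod_null_of_ae_null hS (Eventually.of_forall hsec)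
  have hswap : (volume.prod volume : Measure (ℂ × (Fin d → ℂ))) (Prod.swap ⁻¹' S) = 0 := by
    rw [← Measure.map_apply measurable_swap hS, Measure.prod_swap, hprod]
  obtain ⟨z, hz, hz0⟩ := ((Measure.measure_ae_null_of_prod_null hswap).and
    (Measure.ae_ne volume (0 : ℂ))).exists
  have hsub : {x | x ∈ D ∧ g x = 0} ⊆
      (fun x => x₀ + z • x) '' (Prod.mk z ⁻¹' (Prod.swap ⁻¹' S)) := by
    rintro x ⟨hxD, hx⟩
    have hxz : x₀ + z • (z⁻¹ • (x - x₀)) = x := by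
      rw [smul_inv_smul₀ hz0, add_sub_cancel]
    refine ⟨z⁻¹ • (x - x₀), ?_, hxz⟩
    show x₀ + z • (z⁻¹ • (x - x₀)) ∈ D ∧ g (x₀ + z • (z⁻¹ • (x - x₀))) = 0
    rw [hxz]
    exact ⟨hxD, hx⟩
  refine measure_mono_null hsub
    (addHaar_image_eq_zero_of_differentiableOn_of_addHaar_eq_zero volume ?_ hz)
  exact ((differentiable_id.const_smul z).const_add x₀).differentiableOn

theorem volume_mvPolynomial_zeros {d : ℕ} {g : MvPolynomial (Fin d) ℂ} (hg : g ≠ 0) :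
    volume {x | MvPolynomial.eval x g = 0} = 0 := by
  obtain ⟨x₀, hx₀⟩ : ∃ x, MvPolynomial.eval x g ≠ 0 := by
    by_contra! h
    exact hg (MvPolynomial.funext fun x => by rw [h x, map_zero])
  simpa using volume_zeros isOpen_univ convex_univ
    (AnalyticOnNhd.eval_mvPolynomial g) (Set.mem_univ x₀) hx₀

/-! ### Integrals of monomials over polydiscs -/

theorem lintegral_rpow_Ioo {δ q : ℝ} (hδ : 0 < δ) (hq : -1 < q) :
    ∫⁻ r in Set.Ioo 0 δ, ENNReal.ofReal (r ^ q) = ENNReal.ofReal (δ ^ (q + 1) / (q + 1)) := by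
  have hint : IntegrableOn (fun r : ℝ => r ^ q) (Set.Ioo 0 δ) :=
    (intervalIntegral.integrableOn_Ioo_rpow_iff hδ).2 hq
  rw [← ofReal_integral_eq_lintegral_ofReal hint]
  · rw [← integral_Ioc_eq_integral_Ioo, ← intervalIntegral.integral_of_le hδ.le,
      integral_rpow (Or.inl hq), Real.zero_rpow (by linarith), sub_zero]
  · filter_upwards [ae_restrict_mem measurableSet_Ioo] with r hr
    exact Real.rpow_nonneg hr.1.le _

/-- The density of a monomial integral in one variable. -/
def density (a b : ℕ) (s : ℝ) (z : ℂ) : ℝ := (‖z‖ ^ b) ^ 2 * (‖z‖ ^ a) ^ (-2 * s)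

theorem density_nonneg (a b : ℕ) (s : ℝ) (z : ℂ) : 0 ≤ density a b s z := by
  unfold density; positivity

theorem measurable_density (a b : ℕ) (s : ℝ) : Measurable (density a b s) := by
  unfold density; fun_prop

theorem lintegral_density {a b : ℕ} {s δ : ℝ} (hδ : 0 < δ) (hs : s * a < b + 1) :
    ∫⁻ z in Metric.ball (0 : ℂ) δ, ENNReal.ofReal (density a b s z) =
      ENNReal.ofReal (Real.pi * δ ^ (2 * (b + 1 - s * a)) / (b + 1 - s * a)) := by
  have hpos : 0 < b + 1 - s * a := by linarith
  rw [← lintegral_indicator measurableSet_ball, ← Complex.lintegral_comp_polarCoord_symm]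
  have hfun : ∀ p ∈ polarCoord.target, ENNReal.ofReal p.1 •
      (Metric.ball (0 : ℂ) δ).indicator (fun z => ENNReal.ofReal (density a b s z))
        (Complex.polarCoord.symm p) =
      (Set.Ioo 0 δ).indicator (fun r => ENNReal.ofReal (r ^ (2 * (b + 1 - s * a) - 1))) p.1 *
        (1 : ENNReal) := by
    rintro ⟨r, θ⟩ ⟨hr, -⟩
    have hr : 0 < r := hr
    have hnorm : ‖Complex.polarCoord.symm (r, θ)‖ = r := by
      rw [Complex.norm_polarCoord_symm, abs_of_pos hr]
    by_cases hrδ : r < δ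
    · rw [Set.indicator_of_mem (by rw [mem_ball_zero_iff, hnorm]; exact hrδ),
        Set.indicator_of_mem (show r ∈ Set.Ioo 0 δ from ⟨hr, hrδ⟩), smul_eq_mul, mul_one,
        ← ENNReal.ofReal_mul hr.le, density, hnorm]
      congr 1
      rw [← Real.rpow_natCast r b, ← Real.rpow_natCast r a, ← Real.rpow_natCast _ 2,
        ← Real.rpow_mul hr.le, ← Real.rpow_mul hr.le, ← Real.rpow_add hr]
      nth_rewrite 1 [← Real.rpow_one r]
      rw [← Real.rpow_add hr]
      congr 1
      push_cast
      ring
    · rw [Set.indicator_of_notMem (by rw [mem_ball_zero_iff, hnorm]; exact hrδ),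
        Set.indicator_of_notMem (fun h => hrδ h.2), smul_zero, zero_mul]
  rw [setLIntegral_congr_fun (s := polarCoord.target)
    (measurableSet_Ioi.prod measurableSet_Ioo) hfun]
  have htarget : (volume : Measure (ℝ × ℝ)).restrict polarCoord.target =
      (volume.restrict (Set.Ioi 0)).prod (volume.restrict (Set.Ioo (-Real.pi) Real.pi)) := by
    rw [Measure.prod_restrict]; rfl
  rw [htarget, lintegral_prod_mul (f := (Set.Ioo 0 δ).indicator
    (fun r => ENNReal.ofReal (r ^ (2 * (b + 1 - s * a) - 1)))) (g := fun _ => 1)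
    ((Measurable.indicator (by fun_prop) measurableSet_Ioo).aemeasurable) aemeasurable_const,
    lintegral_indicator measurableSet_Ioo, Measure.restrict_restrict measurableSet_Ioo,
    Set.inter_eq_left.2 Set.Ioo_subset_Ioi_self, lintegral_rpow_Ioo hδ (by linarith), lintegral_one,
    Measure.restrict_apply_univ, Real.volume_Ioo,
    ← ENNReal.ofReal_mul (div_nonneg (Real.rpow_nonneg hδ.le _) (by linarith))]
  · congr 1
    rw [show 2 * ((b : ℝ) + 1 - s * a) - 1 + 1 = 2 * (b + 1 - s * a) by ring]
    field_simp
    ring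

/-- Two-sided bounds for the monomial integral in one variable, as `s` approaches a number `lam`
that is at most `(b + 1) / a`: there is a simple pole if equality holds, and no pole otherwise. -/
theorem exists_lintegral_density_bounds {a b : ℕ} {lam δ : ℝ} (hlam : 0 < lam) (hδ : 0 < δ)
    (hδ1 : δ ≤ 1) (hab : lam * a ≤ b + 1) {e : ℕ} (he : e = if lam * a = b + 1 then 1 else 0) :
    ∃ c C : ℝ, 0 < c ∧ 0 < C ∧ ∀ s, 0 < s → s < lam →
      ENNReal.ofReal (c * ((lam - s) ^ e)⁻¹) ≤
        ∫⁻ z in Metric.ball (0 : ℂ) δ, ENNReal.ofReal (density a b s z) ∧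
      ∫⁻ z in Metric.ball (0 : ℂ) δ, ENNReal.ofReal (density a b s z) ≤
        ENNReal.ofReal (C * ((lam - s) ^ e)⁻¹) ∧
      ∫⁻ z in Metric.ball (0 : ℂ) δ, ENNReal.ofReal (density a b s z) ≠ ⊤ := by
  have hlt : ∀ s, 0 < s → s < lam → s * a < b + 1 := by
    intro s hs hsl
    rcases Nat.eq_zero_or_pos a with h | h
    · subst h; simp; positivity
    · exact (mul_lt_mul_of_pos_right hsl (by exact_mod_cast h)).trans_le hab
  have hpow : ∀ s, 0 < s → s < lam → δ ^ (2 * ((b : ℝ) + 1)) ≤ δ ^ (2 * (b + 1 - s * a)) ∧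
      δ ^ (2 * (b + 1 - s * a)) ≤ 1 := by
    intro s hs hsl
    constructor
    · refine Real.rpow_le_rpow_of_exponent_ge hδ hδ1 ?_
      have : 0 ≤ s * a := by positivity
      linarith
    · exact Real.rpow_le_one hδ.le hδ1 (by linarith [hlt s hs hsl])
  have hδp : 0 < δ ^ (2 * ((b : ℝ) + 1)) := by positivity
  have hpi := Real.pi_pos
  by_cases hc : lam * a = b + 1
  · have ha : 0 < (a : ℝ) := by
      by_contra! h
      have : lam * a ≤ 0 := mul_nonpos_of_nonneg_of_nonpos hlam.le h
      have : (0 : ℝ) < b + 1 := by positivity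
      linarith
    rw [if_pos hc] at he
    subst he
    refine ⟨Real.pi * δ ^ (2 * ((b : ℝ) + 1)) / a, Real.pi / a, by positivity, by positivity,
      fun s hs hsl => ?_⟩
    have hsub : 0 < lam - s := sub_pos.2 hsl
    rw [lintegral_density hδ (hlt s hs hsl)]
    have hden : (b : ℝ) + 1 - s * a = (lam - s) * a := by rw [← hc]; ring
    obtain ⟨h1, h2⟩ := hpow s hs hsl
    refine ⟨ENNReal.ofReal_le_ofReal ?_, ENNReal.ofReal_le_ofReal ?_, ENNReal.ofReal_ne_top⟩
    · rw [pow_one, div_mul_eq_mul_div, ← div_eq_mul_inv, div_div]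
      rw [hden] at h1 ⊢
      gcongr
    · rw [pow_one, div_mul_eq_mul_div, ← div_eq_mul_inv, div_div]
      rw [hden] at h2 ⊢
      gcongr
      exact mul_le_of_le_one_right hpi.le h2
  · have hgap : 0 < b + 1 - lam * a := sub_pos.2 (lt_of_le_of_ne hab hc)
    rw [if_neg hc] at he
    subst he
    refine ⟨Real.pi * δ ^ (2 * ((b : ℝ) + 1)) / (b + 1), Real.pi / (b + 1 - lam * a),
      by positivity, by positivity, fun s hs hsl => ?_⟩
    rw [lintegral_density hδ (hlt s hs hsl)]
    have hpos : 0 < b + 1 - s * a := by linarith [hlt s hs hsl]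
    have hsa : 0 ≤ s * a := by positivity
    have hsa' : s * a ≤ lam * a := by gcongr
    obtain ⟨h1, h2⟩ := hpow s hs hsl
    refine ⟨ENNReal.ofReal_le_ofReal ?_, ENNReal.ofReal_le_ofReal ?_, ENNReal.ofReal_ne_top⟩
    · rw [pow_zero, inv_one, mul_one]
      gcongr
      linarith
    · rw [pow_zero, inv_one, mul_one]
      gcongr
      exact mul_le_of_le_one_right hpi.le h2

/-- Fubini for products of functions of one variable over a polydisc. -/
theorem lintegral_ball_prod {d : ℕ} {δ : ℝ} (hδ : 0 < δ) (w : Fin d → ℂ → ℝ)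
    (hw0 : ∀ p z, 0 ≤ w p z) (hw : ∀ p, Measurable (w p))
    (hfin : ∀ p, ∫⁻ z in Metric.ball (0 : ℂ) δ, ENNReal.ofReal (w p z) ≠ ⊤) :
    ∫⁻ u in Metric.ball (0 : Fin d → ℂ) δ, ENNReal.ofReal (∏ p, w p (u p)) =
      ∏ p, ∫⁻ z in Metric.ball (0 : ℂ) δ, ENNReal.ofReal (w p z) := by
  have hint : ∀ p, Integrable (w p) (volume.restrict (Metric.ball (0 : ℂ) δ)) := fun p =>
    (lintegral_ofReal_ne_top_iff_integrable (hw p).aestronglyMeasurable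
      (Eventually.of_forall (hw0 p))).1 (hfin p)
  have hrestr : (volume : Measure (Fin d → ℂ)).restrict (Metric.ball 0 δ) =
      Measure.pi fun _ : Fin d => (volume : Measure ℂ).restrict (Metric.ball 0 δ) := by
    rw [ball_pi _ hδ]
    exact Measure.restrict_pi_pi _ _
  rw [hrestr, ← ofReal_integral_eq_lintegral_ofReal (Integrable.fintype_prod_dep hint)
    (Eventually.of_forall fun u => Finset.prod_nonneg fun p _ => hw0 p _),
    integral_fintype_prod_eq_prod,
    ENNReal.ofReal_prod_of_nonneg fun p _ => integral_nonneg (hw0 p)]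
  exact Finset.prod_congr rfl fun p _ =>
    ofReal_integral_eq_lintegral_ofReal (hint p) (Eventually.of_forall (hw0 p))

end Arrangement

namespace Arrangement

open Topology Filter MeasureTheory

/-! ### The growth of the zeta integral at its first pole -/

/-- The integral of `|f| ^ (-2 s)` over a set. The zeros of `f`, where the integrand has a junk
value, form a null set if `f ≠ 0`. -/
def zetaIntegral {d : ℕ} (f : MvPolynomial (Fin d) ℂ) (s : ℝ) (S : Set (Fin d → ℂ)) : ENNReal :=
  ∫⁻ y in S, ENNReal.ofReal (‖MvPolynomial.eval y f‖ ^ (-2 * s))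

theorem det_restrictScalars_eq {d : ℕ} (T : (Fin d → ℂ) →L[ℂ] (Fin d → ℂ)) :
    |(T.restrictScalars ℝ).det| = ‖T.det‖ ^ 2 := by
  have h : (T.restrictScalars ℝ).det = Algebra.norm ℝ T.det :=
    LinearMap.det_restrictScalars (R := ℝ) (f := (T : (Fin d → ℂ) →ₗ[ℂ] (Fin d → ℂ)))
  rw [h, Algebra.norm_complex_apply, Complex.normSq_eq_norm_sq, abs_of_nonneg (by positivity)]

theorem exists_norm_bounds {E : Type*} [TopologicalSpace E] {h : E → ℂ} {x : E}
    (hc : ContinuousAt h x) (hx : h x ≠ 0) :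
    ∃ K : ℝ, 1 ≤ K ∧ ∀ᶠ u in 𝓝 x, K⁻¹ ≤ ‖h u‖ ∧ ‖h u‖ ≤ K := by
  have hpos : 0 < ‖h x‖ := norm_pos_iff.2 hx
  refine ⟨max 1 (max (2 * ‖h x‖) (2 * ‖h x‖⁻¹)), le_max_left _ _, ?_⟩
  have h1 : ∀ᶠ u in 𝓝 x, ‖h x‖ / 2 < ‖h u‖ :=
    hc.norm.tendsto.eventually_const_lt (by linarith)
  have h2 : ∀ᶠ u in 𝓝 x, ‖h u‖ < 2 * ‖h x‖ :=
    hc.norm.tendsto.eventually_lt_const (by linarith)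
  filter_upwards [h1, h2] with u hu1 hu2
  refine ⟨le_trans ?_ hu1.le, hu2.le.trans ((le_max_left _ _).trans (le_max_right _ _))⟩
  have h3 : 2 * ‖h x‖⁻¹ ≤ max 1 (max (2 * ‖h x‖) (2 * ‖h x‖⁻¹)) :=
    (le_max_right _ _).trans (le_max_right _ _)
  have h4 := inv_anti₀ (by positivity) h3
  rwa [mul_inv, inv_inv, inv_mul_eq_div] at h4

theorem rpow_bounds {K x lam s : ℝ} (hK : 1 ≤ K) (hx1 : K⁻¹ ≤ x) (hx2 : x ≤ K) (hs : 0 < s)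
    (hsl : s < lam) : K ^ (-2 * lam) ≤ x ^ (-2 * s) ∧ x ^ (-2 * s) ≤ K ^ (2 * lam) := by
  have hK0 : 0 < K := by linarith
  have hx0 : 0 < x := (inv_pos.2 hK0).trans_le hx1
  constructor
  · calc K ^ (-2 * lam) ≤ K ^ (-2 * s) := Real.rpow_le_rpow_of_exponent_le hK (by linarith)
      _ ≤ x ^ (-2 * s) := Real.rpow_le_rpow_of_nonpos hx0 hx2 (by linarith)
  · calc x ^ (-2 * s) ≤ K⁻¹ ^ (-2 * s) :=
          Real.rpow_le_rpow_of_nonpos (inv_pos.2 hK0) hx1 (by linarith)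
      _ = K ^ (2 * s) := by
          rw [Real.inv_rpow hK0.le, ← Real.rpow_neg hK0.le]; congr 1; ring
      _ ≤ K ^ (2 * lam) := Real.rpow_le_rpow_of_exponent_le hK (by linarith)

/-- The contribution of a polydisc to the zeta integral: if `f` and the Jacobian determinant of an
almost everywhere injective map are units times monomials with exponents `A` and `B`, then
the integral over the image has a pole of the order of the number of `p` with `lam * A p = B p + 1`
at `lam`. -/
theorem exists_zetaIntegral_bounds {d : ℕ} (f g : MvPolynomial (Fin d) ℂ) (hg : g ≠ 0)
    {D : Set (Fin d → ℂ)} (hD : IsOpen D) (h0D : 0 ∈ D) {F : (Fin d → ℂ) → (Fin d → ℂ)}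
    (hF : AnalyticOnNhd ℂ F D)
    (hinj : Set.InjOn F {u | u ∈ D ∧ MvPolynomial.eval (F u) g ≠ 0})
    {h h' : (Fin d → ℂ) → ℂ} (hh : ContinuousAt h 0) (hh' : ContinuousAt h' 0)
    (hne : ∀ u ∈ D, h u ≠ 0) (hne' : ∀ u ∈ D, h' u ≠ 0) (A B e : Fin d → ℕ)
    (hf : ∀ u ∈ D, MvPolynomial.eval (F u) f = h u * ∏ p, u p ^ A p)
    (hJ : ∀ u ∈ D, (fderiv ℂ F u).det = h' u * ∏ p, u p ^ B p)
    {lam : ℝ} (hlam : 0 < lam) (hAB : ∀ p, lam * A p ≤ B p + 1)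
    (he : ∀ p, e p = if lam * A p = B p + 1 then 1 else 0) :
    ∃ δ : ℝ, 0 < δ ∧ Metric.ball 0 δ ⊆ D ∧ F '' Metric.ball 0 δ ⊆ Metric.ball (F 0) 1 ∧
      ∃ c C : ℝ, 0 < c ∧ 0 < C ∧ ∀ s, 0 < s → s < lam →
        ENNReal.ofReal (c * ((lam - s) ^ ∑ p, e p)⁻¹) ≤ zetaIntegral f s
          (F '' {u | u ∈ Metric.ball 0 δ ∧ MvPolynomial.eval (F u) g ≠ 0}) ∧
        zetaIntegral f s
          (F '' {u | u ∈ Metric.ball 0 δ ∧ MvPolynomial.eval (F u) g ≠ 0}) ≤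
            ENNReal.ofReal (C * ((lam - s) ^ ∑ p, e p)⁻¹) := by
  obtain ⟨K, hK1, hK⟩ := exists_norm_bounds hh (hne 0 h0D)
  obtain ⟨K', hK1', hK'⟩ := exists_norm_bounds hh' (hne' 0 h0D)
  have hK0 : 0 < K := by linarith
  have hK0' : 0 < K' := by linarith
  have hball : ∀ᶠ u in 𝓝 (0 : Fin d → ℂ), F u ∈ Metric.ball (F 0) 1 :=
    (hF 0 h0D).continuousAt.tendsto (Metric.ball_mem_nhds _ one_pos)
  obtain ⟨ε, hε, hεsub⟩ := Metric.eventually_nhds_iff_ball.1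
    (hball.and ((hD.eventually_mem h0D).and (hK.and hK')))
  have hδ : 0 < min ε 1 := lt_min hε one_pos
  have hδ1 : min ε 1 ≤ 1 := min_le_right _ _
  have hsub : ∀ u ∈ Metric.ball (0 : Fin d → ℂ) (min ε 1), F u ∈ Metric.ball (F 0) 1 ∧ u ∈ D ∧
      (K⁻¹ ≤ ‖h u‖ ∧ ‖h u‖ ≤ K) ∧ (K'⁻¹ ≤ ‖h' u‖ ∧ ‖h' u‖ ≤ K') :=
    fun u hu => hεsub u (Metric.ball_subset_ball (min_le_left _ _) hu)
  generalize min ε 1 = δ at *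
  have hBD : Metric.ball (0 : Fin d → ℂ) δ ⊆ D := fun u hu => (hsub u hu).2.1
  refine ⟨δ, hδ, hBD, ?_, ?_⟩
  · rintro _ ⟨u, hu, rfl⟩
    exact (hsub u hu).1
  -- the polynomial `g` does not vanish identically on the image of the polydisc
  have hcomp : AnalyticOnNhd ℂ (fun u => MvPolynomial.eval (F u) g) (Metric.ball 0 δ) :=
    fun u hu => (AnalyticOnNhd.eval_mvPolynomial g (F u) (Set.mem_univ _)).comp (hF u (hBD hu))
  obtain ⟨u₀, hu₀, hgu₀⟩ : ∃ u ∈ Metric.ball (0 : Fin d → ℂ) δ,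
      MvPolynomial.eval (F u) g ≠ 0 := by
    by_contra! hall
    obtain ⟨u, hu, hu0⟩ := (Family.dense_ne_zero (d := d)).inter_open_nonempty _
      (Metric.isOpen_ball (x := 0) (ε := δ)) ⟨0, Metric.mem_ball_self hδ⟩
    have hdet : (fderiv ℂ F u).det ≠ 0 := by
      rw [hJ u (hBD hu)]
      exact mul_ne_zero (hne' u (hBD hu))
        (Finset.prod_ne_zero_iff.2 fun p _ => pow_ne_zero _ (hu0 p))
    have hsurj : ((fderiv ℂ F u : (Fin d → ℂ) →L[ℂ] (Fin d → ℂ)) :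
        (Fin d → ℂ) →ₗ[ℂ] (Fin d → ℂ)).range = ⊤ :=
      LinearMap.range_eq_top.2 (LinearMap.equivOfDetNeZero _ hdet).surjective
    have hmap := (hF u (hBD hu)).hasStrictFDerivAt.map_nhds_eq_of_surj hsurj
    have hzero : {y | MvPolynomial.eval y g = 0} ∈ 𝓝 (F u) := by
      rw [← hmap, mem_map]
      filter_upwards [Metric.isOpen_ball.mem_nhds hu] with w hw using hall w hw
    exact (Measure.measure_pos_of_mem_nhds volume hzero).ne' (volume_mvPolynomial_zeros hg)
  have hnull := volume_zeros Metric.isOpen_ball (convex_ball 0 δ) hcomp hu₀ hgu₀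
  set Bg : Set (Fin d → ℂ) := {u | u ∈ Metric.ball 0 δ ∧ MvPolynomial.eval (F u) g ≠ 0} with hBg
  have hBgo : IsOpen Bg :=
    hcomp.continuousOn.isOpen_inter_preimage Metric.isOpen_ball isOpen_compl_singleton
  have hae : Bg =ᵐ[volume] Metric.ball (0 : Fin d → ℂ) δ := by
    refine (LE.le.eventuallyLE (show Bg ≤ _ from fun u hu => hu.1)).antisymm ?_
    refine ae_le_set.2 (measure_mono_null (fun u hu => ?_) hnull)
    refine ⟨hu.1, ?_⟩
    by_contra h0
    exact hu.2 ⟨hu.1, h0⟩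
  have hinjB : Set.InjOn F Bg := fun u hu w hw huw =>
    hinj ⟨hBD hu.1, hu.2⟩ ⟨hBD hw.1, hw.2⟩ huw
  have hzeta : ∀ s, zetaIntegral f s (F '' Bg) = ∫⁻ u in Metric.ball 0 δ, ENNReal.ofReal
      ((‖h u‖ ^ (-2 * s) * ‖h' u‖ ^ 2) * ∏ p, density (A p) (B p) s (u p)) := by
    intro s
    rw [zetaIntegral, lintegral_image_eq_lintegral_abs_det_fderiv_mul volume hBgo.measurableSet
      (f' := fun u => (fderiv ℂ F u).restrictScalars ℝ)
      (fun u hu => ((hF u (hBD hu.1)).differentiableAt.hasFDerivAt.restrictScalars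
        ℝ).hasFDerivWithinAt) hinjB, setLIntegral_congr hae]
    refine setLIntegral_congr_fun measurableSet_ball fun u hu => ?_
    rw [det_restrictScalars_eq, hf u (hBD hu), hJ u (hBD hu), ← ENNReal.ofReal_mul (by positivity)]
    congr 1
    simp only [norm_mul, norm_prod, norm_pow, density, Finset.prod_mul_distrib]
    rw [Real.mul_rpow (norm_nonneg _) (Finset.prod_nonneg fun p _ => by positivity),
      Real.finsetProd_rpow _ _ (fun p _ => by positivity), mul_pow, Finset.prod_pow]
    ring
  choose c C hc hC hcC using fun p =>
    exists_lintegral_density_bounds hlam hδ hδ1 (hAB p) (he p)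
  have hprod : ∀ (k : ℝ) s, 0 ≤ k → 0 < s → s < lam →
      ∫⁻ u in Metric.ball (0 : Fin d → ℂ) δ,
      ENNReal.ofReal (k * ∏ p, density (A p) (B p) s (u p)) =
        ENNReal.ofReal k * ∏ p, ∫⁻ z in Metric.ball (0 : ℂ) δ,
          ENNReal.ofReal (density (A p) (B p) s z) := by
    intro k s hk hs hsl
    have hmeas : Measurable fun u : Fin d → ℂ =>
        ENNReal.ofReal (∏ p, density (A p) (B p) s (u p)) :=
      Measurable.ennreal_ofReal (Finset.measurable_fun_prod _ fun p _ =>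
        (measurable_density _ _ _).comp (measurable_pi_apply p))
    simp only [ENNReal.ofReal_mul hk]
    rw [lintegral_const_mul _ hmeas,
      lintegral_ball_prod hδ (fun p => density (A p) (B p) s) (fun p => density_nonneg _ _ _)
        (fun p => measurable_density _ _ _) (fun p => (hcC p s hs hsl).2.2)]
  have hof : ∀ (k s : ℝ) (w : Fin d → ℝ), 0 ≤ k → s < lam → (∀ p, 0 < w p) →
      ENNReal.ofReal (k * (∏ p, w p) * ((lam - s) ^ ∑ p, e p)⁻¹) =
        ENNReal.ofReal k * ∏ p, ENNReal.ofReal (w p * ((lam - s) ^ e p)⁻¹) := by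
    intro k s w hk hsl hw
    have : 0 < lam - s := sub_pos.2 hsl
    rw [← ENNReal.ofReal_prod_of_nonneg fun p _ => by have := hw p; positivity,
      ← ENNReal.ofReal_mul hk, Finset.prod_mul_distrib, Finset.prod_inv_distrib,
      Finset.prod_pow_eq_pow_sum, mul_assoc]
  have hk1 : 0 < K ^ (-2 * lam) * K'⁻¹ ^ 2 := by positivity
  have hk2 : 0 < K ^ (2 * lam) * K' ^ 2 := by positivity
  refine ⟨K ^ (-2 * lam) * K'⁻¹ ^ 2 * ∏ p, c p, K ^ (2 * lam) * K' ^ 2 * ∏ p, C p,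
    mul_pos hk1 (Finset.prod_pos fun p _ => hc p), mul_pos hk2 (Finset.prod_pos fun p _ => hC p),
    fun s hs hsl => ?_⟩
  rw [hzeta, hof _ _ _ hk1.le hsl hc, hof _ _ _ hk2.le hsl hC]
  constructor
  · calc _ ≤ ENNReal.ofReal (K ^ (-2 * lam) * K'⁻¹ ^ 2) * ∏ p, ∫⁻ z in Metric.ball (0 : ℂ) δ,
            ENNReal.ofReal (density (A p) (B p) s z) := by
          gcongr with p
          exact (hcC p s hs hsl).1
      _ ≤ _ := by
          rw [← hprod _ s hk1.le hs hsl]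
          refine setLIntegral_mono' measurableSet_ball fun u hu => ENNReal.ofReal_le_ofReal ?_
          obtain ⟨-, -, ⟨h1, h2⟩, ⟨h3, h4⟩⟩ := hsub u hu
          refine mul_le_mul_of_nonneg_right ?_
            (Finset.prod_nonneg fun p _ => density_nonneg _ _ _ _)
          have := (rpow_bounds hK1 h1 h2 hs hsl).1
          gcongr
  · calc _ ≤ ENNReal.ofReal (K ^ (2 * lam) * K' ^ 2) * ∏ p, ∫⁻ z in Metric.ball (0 : ℂ) δ,
            ENNReal.ofReal (density (A p) (B p) s z) := by
          rw [← hprod _ s hk2.le hs hsl]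
          refine setLIntegral_mono' measurableSet_ball fun u hu => ENNReal.ofReal_le_ofReal ?_
          obtain ⟨-, -, ⟨h1, h2⟩, ⟨h3, h4⟩⟩ := hsub u hu
          refine mul_le_mul_of_nonneg_right ?_
            (Finset.prod_nonneg fun p _ => density_nonneg _ _ _ _)
          have := (rpow_bounds hK1 h1 h2 hs hsl).2
          gcongr
      _ ≤ _ := by
          gcongr with p
          exact (hcC p s hs hsl).2.1

end Arrangement

namespace Arrangement

open Topology Filter MeasureTheory

/-! ### Independence of the log resolution -/

theorem zetaIntegral_biUnion_le {d : ℕ} {κ : Type*} (f : MvPolynomial (Fin d) ℂ) (s : ℝ)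
    (t : Finset κ) (S : κ → Set (Fin d → ℂ)) :
    zetaIntegral f s (⋃ k ∈ t, S k) ≤ ∑ k ∈ t, zetaIntegral f s (S k) := by
  classical
  induction t using Finset.induction_on with
  | empty => simp [zetaIntegral]
  | insert k t hk ih =>
    rw [Finset.set_biUnion_insert, Finset.sum_insert hk]
    exact (lintegral_union_le _ _ _).trans (add_le_add_right ih _)

namespace LogResolution
variable {d : ℕ} {f : MvPolynomial (Fin d) ℂ}

/-- The number of divisors through `P` that belong to the divisor of `f` and have the ratio
`lam`. -/
def multAt (R : LogResolution f) (lam : ℝ) (P : R.X) : ℕ :=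
  Set.ncard {i | 0 < R.a i ∧ lam = R.ratio i ∧ P ∈ R.E i}

theorem lam_mul_le {R : LogResolution f} {lam : ℝ} (hmin : ∀ i, 0 < R.a i → lam ≤ R.ratio i)
    (i : R.ι) : lam * R.a i ≤ R.b i + 1 := by
  rcases Nat.eq_zero_or_pos (R.a i) with h | h
  · rw [h]; simp; positivity
  · have := hmin i h
    rwa [ratio, le_div_iff₀ (by exact_mod_cast h)] at this

theorem lam_mul_eq_iff {R : LogResolution f} {lam : ℝ} (i : R.ι) :
    lam * R.a i = R.b i + 1 ↔ 0 < R.a i ∧ lam = R.ratio i := by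
  rcases Nat.eq_zero_or_pos (R.a i) with h | h
  · simp only [h, Nat.cast_zero, mul_zero, lt_irrefl, false_and, iff_false]
    positivity
  · have h' : (R.a i : ℝ) ≠ 0 := by exact_mod_cast h.ne'
    rw [ratio, eq_div_iff h']
    simp [h]

open Classical in
/-- Each point of a log resolution has a neighbourhood whose contribution to the zeta integral has
a pole at `lam` of the order `multAt`. -/
theorem exists_local_bounds (R : LogResolution f) {lam : ℝ} (hlam : 0 < lam)
    (hmin : ∀ i, 0 < R.a i → lam ≤ R.ratio i) {g : MvPolynomial (Fin d) ℂ} (hg : g ≠ 0)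
    {τ : (Fin d → ℂ) → R.X} (hτ : ∀ x, MvPolynomial.eval (R.ρ x) g ≠ 0 → τ (R.ρ x) = x)
    (P : R.X) :
    ∃ N : Set R.X, IsOpen N ∧ P ∈ N ∧ R.ρ '' N ⊆ Metric.ball (R.ρ P) 1 ∧
      ∃ c C : ℝ, 0 < c ∧ 0 < C ∧ ∀ s, 0 < s → s < lam →
        ENNReal.ofReal (c * ((lam - s) ^ R.multAt lam P)⁻¹) ≤
          zetaIntegral f s (R.ρ '' {x | x ∈ N ∧ MvPolynomial.eval (R.ρ x) g ≠ 0}) ∧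
        zetaIntegral f s (R.ρ '' {x | x ∈ N ∧ MvPolynomial.eval (R.ρ x) g ≠ 0}) ≤
          ENNReal.ofReal (C * ((lam - s) ^ R.multAt lam P)⁻¹) := by
  obtain ⟨φ, hφ, hPφ, hφP, j, hj, -, -, h, h', hh, hh', hu⟩ := R.snc P
  let F : (Fin d → ℂ) → (Fin d → ℂ) := fun u => R.ρ (φ.symm u)
  have h0 : (0 : Fin d → ℂ) ∈ φ.target := hφP ▸ φ.map_source hPφ
  have hφ0 : φ.symm 0 = P := by rw [← hφP, φ.left_inv hPφ]
  have hF : AnalyticOnNhd ℂ F φ.target := by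
    have h1 : ContMDiffOn 𝓘(ℂ, Fin d → ℂ) 𝓘(ℂ, Fin d → ℂ) ω F φ.target :=
      R.holomorphic.comp_contMDiffOn (contMDiffOn_symm_of_mem_maximalAtlas hφ)
    rw [contMDiffOn_iff_contDiffOn] at h1
    exact (φ.open_target.analyticOn_iff_analyticOnNhd).1 h1.analyticOn
  have hinj : Set.InjOn F {u | u ∈ φ.target ∧ MvPolynomial.eval (F u) g ≠ 0} := by
    intro u hu w hw huw
    apply φ.symm.injOn hu.1 hw.1
    rw [← hτ _ hu.2, ← hτ _ hw.2]
    exact congrArg τ huw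
  -- the exponents, indexed by the coordinates instead of the divisors
  let A : Fin d → ℕ := fun p => ∑ i ∈ (Finset.univ.filter fun i => P ∈ R.E i) with j i = p, R.a i
  let B : Fin d → ℕ := fun p => ∑ i ∈ (Finset.univ.filter fun i => P ∈ R.E i) with j i = p, R.b i
  let T : Finset R.ι := Finset.univ.filter fun i => 0 < R.a i ∧ lam = R.ratio i ∧ P ∈ R.E i
  let e : Fin d → ℕ := fun p => (T.filter fun i => j i = p).card
  have hpow : ∀ (G : R.ι → ℕ) (u : Fin d → ℂ), ∏ i with P ∈ R.E i, u (j i) ^ G i =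
      ∏ p, u p ^ ∑ i ∈ (Finset.univ.filter fun i => P ∈ R.E i) with j i = p, G i := by
    intro G u
    rw [← Finset.prod_fiberwise _ j]
    refine Finset.prod_congr rfl fun p _ => ?_
    rw [← Finset.prod_pow_eq_pow_sum]
    refine Finset.prod_congr rfl fun i hi => ?_
    rw [(Finset.mem_filter.1 hi).2]
  have hfibre : ∀ p, (A p = 0 ∧ B p = 0 ∧ e p = 0) ∨ ∃ i, A p = R.a i ∧ B p = R.b i ∧
      e p = if 0 < R.a i ∧ lam = R.ratio i then 1 else 0 := by
    intro p
    by_cases hp : ∃ i, P ∈ R.E i ∧ j i = p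
    · obtain ⟨i, hi, rfl⟩ := hp
      have hsingle : (Finset.univ.filter fun i => P ∈ R.E i).filter (fun k => j k = j i) = {i} := by
        ext k
        simp only [Finset.mem_filter, Finset.mem_univ, true_and, Finset.mem_singleton]
        exact ⟨fun hk => hj hk.1 hi hk.2, by rintro rfl; exact ⟨hi, rfl⟩⟩
      refine Or.inr ⟨i, by simp only [A, hsingle, Finset.sum_singleton],
        by simp only [B, hsingle, Finset.sum_singleton], ?_⟩
      split_ifs with hc
      · have : T.filter (fun k => j k = j i) = {i} := by
          ext k
          simp only [T, Finset.mem_filter, Finset.mem_univ, true_and, Finset.mem_singleton]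
          exact ⟨fun hk => hj hk.1.2.2 hi hk.2, by rintro rfl; exact ⟨⟨hc.1, hc.2, hi⟩, rfl⟩⟩
        simp only [e, this, Finset.card_singleton]
      · simp only [e, Finset.card_eq_zero, Finset.filter_eq_empty_iff]
        intro k hk hkp
        simp only [T, Finset.mem_filter, Finset.mem_univ, true_and] at hk
        have hki := hj hk.2.2 hi hkp
        subst hki
        exact hc ⟨hk.1, hk.2.1⟩
    · push Not at hp
      refine Or.inl ⟨Finset.sum_eq_zero fun i hi => ?_, Finset.sum_eq_zero fun i hi => ?_, ?_⟩
      · simp only [Finset.mem_filter, Finset.mem_univ, true_and] at hi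
        exact absurd hi.2 (hp i hi.1)
      · simp only [Finset.mem_filter, Finset.mem_univ, true_and] at hi
        exact absurd hi.2 (hp i hi.1)
      · simp only [e, Finset.card_eq_zero, Finset.filter_eq_empty_iff]
        intro i hi
        simp only [T, Finset.mem_filter, Finset.mem_univ, true_and] at hi
        exact hp i hi.2.2
  have hAB : ∀ p, lam * A p ≤ B p + 1 := by
    intro p
    rcases hfibre p with ⟨h1, h2, -⟩ | ⟨i, h1, h2, -⟩
    · rw [h1, h2]; simp
    · rw [h1, h2]; exact lam_mul_le hmin i
  have he : ∀ p, e p = if lam * A p = B p + 1 then 1 else 0 := by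
    intro p
    rcases hfibre p with ⟨h1, h2, h3⟩ | ⟨i, h1, h2, h3⟩
    · rw [h1, h2, h3]; simp
    · rw [h1, h2, h3]; simp only [lam_mul_eq_iff]
  have hsum : ∑ p, e p = R.multAt lam P := by
    rw [← Finset.card_eq_sum_card_fiberwise fun _ _ => Finset.mem_univ _, multAt,
      ← Set.ncard_coe_finset]
    simp [T]
  obtain ⟨δ, hδ, hδD, hδ1, c, C, hc, hC, hcC⟩ := exists_zetaIntegral_bounds f g hg
    φ.open_target h0 hF hinj (hh 0 h0).continuousAt (hh' 0 h0).continuousAt (fun u hu' => (hu u hu').1)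
    (fun u hu' => (hu u hu').2.1) A B e
    (fun u hu' => by rw [← hpow]; exact (hu u hu').2.2.1)
    (fun u hu' => by rw [← hpow]; exact (hu u hu').2.2.2) hlam hAB he
  have himage : R.ρ '' {x | x ∈ φ.source ∩ φ ⁻¹' Metric.ball 0 δ ∧
      MvPolynomial.eval (R.ρ x) g ≠ 0} =
      F '' {u | u ∈ Metric.ball 0 δ ∧ MvPolynomial.eval (F u) g ≠ 0} := by
    ext y
    constructor
    · rintro ⟨x, ⟨⟨hx1, hx2⟩, hx3⟩, rfl⟩
      have hFx : F (φ x) = R.ρ x := congrArg R.ρ (φ.left_inv hx1)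
      exact ⟨φ x, ⟨hx2, by rwa [hFx]⟩, hFx⟩
    · rintro ⟨u, ⟨hu1, hu2⟩, rfl⟩
      refine ⟨φ.symm u, ⟨⟨φ.map_target (hδD hu1), ?_⟩, hu2⟩, rfl⟩
      rwa [Set.mem_preimage, φ.right_inv (hδD hu1)]
  refine ⟨φ.source ∩ φ ⁻¹' Metric.ball 0 δ, φ.isOpen_inter_preimage Metric.isOpen_ball,
    ⟨hPφ, by rw [Set.mem_preimage, hφP]; exact Metric.mem_ball_self hδ⟩, ?_,
    c, C, hc, hC, fun s hs hsl => ?_⟩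
  · rintro _ ⟨x, ⟨hx1, hx2⟩, rfl⟩
    have hFx : F (φ x) = R.ρ x := congrArg R.ρ (φ.left_inv hx1)
    have hF0 : F 0 = R.ρ P := congrArg R.ρ hφ0
    rw [← hFx, ← hF0]
    exact hδ1 ⟨_, hx2, rfl⟩
  · rw [himage, ← hsum]
    exact hcC s hs hsl

/-- The lower bound is uniform in the radius of the ball, so that it can be compared with the upper
bound of another log resolution. -/
theorem exists_lower_bound (R : LogResolution f) {lam : ℝ} (hlam : 0 < lam)
    (hmin : ∀ i, 0 < R.a i → lam ≤ R.ratio i) (P : R.X) :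
    ∃ c : ℝ, 0 < c ∧ ∀ r, ‖R.ρ P‖ + 1 ≤ r → ∀ s, 0 < s → s < lam →
      ENNReal.ofReal (c * ((lam - s) ^ R.multAt lam P)⁻¹) ≤
        zetaIntegral f s (Metric.ball 0 r) := by
  obtain ⟨g, hg, τ, -, -, hτ⟩ := R.birational
  obtain ⟨N, -, -, hN1, c, _, hc, -, hcC⟩ := R.exists_local_bounds hlam hmin hg hτ P
  refine ⟨c, hc, fun r hr s hs hsl => (hcC s hs hsl).1.trans (lintegral_mono_set ?_)⟩
  rintro _ ⟨x, hx, rfl⟩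
  refine Metric.ball_subset_ball' ?_ (hN1 ⟨x, hx.1, rfl⟩)
  rw [dist_zero_right]
  linarith

/-- The preimage of a ball is covered by finitely many of the neighbourhoods of
`exists_local_bounds`. -/
theorem exists_upper_bound (R : LogResolution f) {lam : ℝ} (hlam : 0 < lam)
    (hmin : ∀ i, 0 < R.a i → lam ≤ R.ratio i) {m : ℕ} (hm : ∀ P, R.multAt lam P ≤ m) (r : ℝ) :
    ∃ C : ℝ, 0 < C ∧ ∀ s, 0 < s → s < lam →
      zetaIntegral f s (Metric.ball 0 r) ≤ ENNReal.ofReal (C * ((lam - s) ^ m)⁻¹) := by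
  obtain ⟨g, hg, τ, -, hτ', hτ⟩ := R.birational
  choose N hNo hPN _ _ C _ hC hcC using R.exists_local_bounds hlam hmin hg hτ
  have hK : IsCompact (R.ρ ⁻¹' Metric.closedBall 0 r) :=
    R.proper.isCompact_preimage (isCompact_closedBall 0 r)
  obtain ⟨t, -, ht⟩ := hK.elim_nhds_subcover N fun P _ => (hNo P).mem_nhds (hPN P)
  have hcover : Metric.ball 0 r ≤ᵐ[volume]
      ⋃ P ∈ t, R.ρ '' {x | x ∈ N P ∧ MvPolynomial.eval (R.ρ x) g ≠ 0} := by
    refine ae_le_set.2 (measure_mono_null (fun y hy => ?_) (volume_mvPolynomial_zeros hg))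
    by_contra hgy
    apply hy.2
    have hρ := hτ' y hgy
    have hyK : τ y ∈ R.ρ ⁻¹' Metric.closedBall 0 r := by
      rw [Set.mem_preimage, hρ]; exact Metric.ball_subset_closedBall hy.1
    obtain ⟨P, hPt, hyP⟩ := Set.mem_iUnion₂.1 (ht hyK)
    refine Set.mem_iUnion₂.2 ⟨P, hPt, τ y, ⟨hyP, ?_⟩, hρ⟩
    rw [hρ]; exact hgy
  have hsumC : 0 ≤ ∑ P ∈ t, C P * (lam ^ (m - R.multAt lam P)) :=
    Finset.sum_nonneg fun P _ => by have := hC P; positivity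
  refine ⟨∑ P ∈ t, C P * (lam ^ (m - R.multAt lam P)) + 1, by linarith, fun s hs hsl => ?_⟩
  have hsub : 0 < lam - s := sub_pos.2 hsl
  calc zetaIntegral f s (Metric.ball 0 r)
      ≤ zetaIntegral f s (⋃ P ∈ t, R.ρ '' {x | x ∈ N P ∧ MvPolynomial.eval (R.ρ x) g ≠ 0}) :=
        lintegral_mono' (Measure.restrict_mono_ae hcover) le_rfl
    _ ≤ ∑ P ∈ t, zetaIntegral f s (R.ρ '' {x | x ∈ N P ∧ MvPolynomial.eval (R.ρ x) g ≠ 0}) :=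
        zetaIntegral_biUnion_le f s t _
    _ ≤ ∑ P ∈ t, ENNReal.ofReal (C P * (lam ^ (m - R.multAt lam P)) * ((lam - s) ^ m)⁻¹) := by
        refine Finset.sum_le_sum fun P _ =>
          (hcC P s hs hsl).2.trans (ENNReal.ofReal_le_ofReal ?_)
        rw [mul_assoc]
        refine mul_le_mul_of_nonneg_left ?_ (hC P).le
        have h1 : (lam - s) ^ m =
            (lam - s) ^ (m - R.multAt lam P) * (lam - s) ^ R.multAt lam P := by
          rw [← pow_add, Nat.sub_add_cancel (hm P)]
        rw [h1, mul_inv, ← mul_assoc]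
        refine le_mul_of_one_le_left (by positivity) ?_
        rw [← div_eq_mul_inv, one_le_div (by positivity)]
        gcongr
        linarith
    _ ≤ _ := by
        rw [← ENNReal.ofReal_sum_of_nonneg fun P _ => by have := hC P; positivity]
        refine ENNReal.ofReal_le_ofReal ?_
        rw [← Finset.sum_mul]
        gcongr
        linarith

theorem ratio_pos (R : LogResolution f) {i : R.ι} (hi : 0 < R.a i) : 0 < R.ratio i := by
  have : (0 : ℝ) < R.a i := by exact_mod_cast hi
  rw [ratio]; positivity

theorem surjective_ρ (R : LogResolution f) : Function.Surjective R.ρ := by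
  obtain ⟨g, hg, τ, -, hτ', -⟩ := R.birational
  have hdense : Dense {y | MvPolynomial.eval y g ≠ 0} := by
    have : {y | MvPolynomial.eval y g ≠ 0} = {y | MvPolynomial.eval y g = 0}ᶜ := rfl
    rw [this, ← interior_eq_empty_iff_dense_compl]
    by_contra hne
    obtain ⟨y, hy⟩ := Set.nonempty_iff_ne_empty.2 hne
    exact (Measure.measure_pos_of_mem_nhds volume (mem_interior_iff_mem_nhds.1 hy)).ne'
      (volume_mvPolynomial_zeros hg)
  have hsub : {y | MvPolynomial.eval y g ≠ 0} ⊆ Set.range R.ρ := fun y hy => ⟨τ y, hτ' y hy⟩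
  have huniv := (hdense.mono hsub).closure_eq
  rw [R.proper.isClosedMap.isClosed_range.closure_eq] at huniv
  exact Set.range_eq_univ.1 huniv

/-- If `f` has a zero, then every log resolution computes some pair. -/
theorem exists_computes (R : LogResolution f) {x : Fin d → ℂ} (hx : MvPolynomial.eval x f = 0) :
    ∃ lam m, R.Computes lam m := by
  classical
  obtain ⟨P, hP⟩ := R.surjective_ρ x
  obtain ⟨i₀, hi₀⟩ : ∃ i, 0 < R.a i := by
    by_contra! hall
    obtain ⟨φ, -, hPφ, hφP, j, -, -, -, h, h', -, -, hu⟩ := R.snc P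
    have h0 : (0 : Fin d → ℂ) ∈ φ.target := hφP ▸ φ.map_source hPφ
    obtain ⟨h1, -, h3, -⟩ := hu 0 h0
    have hφ0 : φ.symm 0 = P := by rw [← hφP, φ.left_inv hPφ]
    rw [hφ0, hP, hx] at h3
    refine mul_ne_zero h1 (Finset.prod_ne_zero_iff.2 fun i _ => ?_) h3.symm
    rw [Nat.le_zero.1 (hall i), pow_zero]
    exact one_ne_zero
  obtain ⟨i, hi, hmin⟩ := Set.exists_min_image {i | 0 < R.a i} R.ratio (Set.toFinite _) ⟨i₀, hi₀⟩
  have hfin : (Set.range (R.multAt (R.ratio i))).Finite :=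
    (Set.finite_Iic (Fintype.card R.ι)).subset (by
      rintro _ ⟨Q, rfl⟩
      rw [← Nat.card_eq_fintype_card]
      exact Set.ncard_le_card _)
  obtain ⟨m, ⟨Q, rfl⟩, hmax⟩ := Set.exists_max_image _ id hfin ⟨_, P, rfl⟩
  refine ⟨R.ratio i, R.multAt (R.ratio i) Q, ⟨⟨i, hi, rfl⟩, ?_⟩, ⟨Q, rfl⟩, ?_⟩
  · rintro _ ⟨k, hk, rfl⟩
    exact hmin k hk
  · rintro _ ⟨S, rfl⟩
    exact hmax _ ⟨S, rfl⟩

theorem exists_mul_pow_lt {c M lam : ℝ} (hc : 0 < c) (hlam : 0 < lam) {n : ℕ}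
    (hn : n ≠ 0) : ∃ s, 0 < s ∧ s < lam ∧ M * (lam - s) ^ n < c := by
  have hcont : Continuous fun s : ℝ => M * (lam - s) ^ n := by fun_prop
  have h1 : ∀ᶠ s in 𝓝[<] lam, M * (lam - s) ^ n < c := by
    refine ((hcont.tendsto lam).eventually_lt_const ?_).filter_mono nhdsWithin_le_nhds
    simpa [hn] using hc
  obtain ⟨s, hs, hs'⟩ := (h1.and (Ioo_mem_nhdsLT hlam)).exists
  exact ⟨s, hs'.1, hs'.2, hs⟩

theorem Computes.lam_pos {R : LogResolution f} {lam : ℝ} {m : ℕ} (h : R.Computes lam m) :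
    0 < lam := by
  obtain ⟨⟨i, hi, rfl⟩, -⟩ := h.1
  exact R.ratio_pos hi

theorem Computes.le_ratio {R : LogResolution f} {lam : ℝ} {m : ℕ} (h : R.Computes lam m) (i : R.ι)
    (hi : 0 < R.a i) : lam ≤ R.ratio i := h.1.2 ⟨i, hi, rfl⟩

theorem Computes.multAt_le {R : LogResolution f} {lam : ℝ} {m : ℕ} (h : R.Computes lam m)
    (P : R.X) : R.multAt lam P ≤ m := h.2.2 ⟨P, rfl⟩

theorem Computes.mult_ne_zero {R : LogResolution f} {lam : ℝ} {m : ℕ} (h : R.Computes lam m) :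
    m ≠ 0 := by
  obtain ⟨i, hi, hlam⟩ := h.1.1
  obtain ⟨P, hP⟩ := (R.isConnected_E i).nonempty
  have h1 : 0 < R.multAt lam P := by
    rw [multAt, Set.ncard_pos]
    exact ⟨i, hi, hlam, hP⟩
  have := h.multAt_le P
  omega

/-- If `lam < lam'`, then the zeta integral is unbounded at `lam` by the lower bound from `R`, and
bounded there by the upper bound from `R'`. -/
theorem Computes.lam_le {R R' : LogResolution f} {lam lam' : ℝ} {m m' : ℕ}
    (h : R.Computes lam m) (h' : R'.Computes lam' m') : lam' ≤ lam := by
  by_contra! hlt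
  obtain ⟨P, hP⟩ := h.2.1
  obtain ⟨c, hc, hlow⟩ := R.exists_lower_bound h.lam_pos h.le_ratio P
  obtain ⟨C, hC, hup⟩ := R'.exists_upper_bound h'.lam_pos h'.le_ratio h'.multAt_le (‖R.ρ P‖ + 1)
  have hgap : 0 < lam' - lam := sub_pos.2 hlt
  obtain ⟨s, hs, hsl, hsc⟩ := exists_mul_pow_lt (M := C * ((lam' - lam) ^ m')⁻¹) hc
    h.lam_pos h.mult_ne_zero
  have hsub : 0 < lam - s := sub_pos.2 hsl
  have h1 := (hlow _ le_rfl s hs hsl).trans (hup s hs (hsl.trans hlt))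
  have hsub' : 0 < lam' - s := by linarith
  rw [ENNReal.ofReal_le_ofReal_iff (by positivity), show R.multAt lam P = m from hP.symm,
    ← div_eq_mul_inv, div_le_iff₀ (by positivity)] at h1
  have h2 : C * ((lam' - s) ^ m')⁻¹ ≤ C * ((lam' - lam) ^ m')⁻¹ := by gcongr
  have h3 : C * ((lam' - s) ^ m')⁻¹ * (lam - s) ^ m ≤
      C * ((lam' - lam) ^ m')⁻¹ * (lam - s) ^ m := by
    gcongr
  linarith

/-- Two-sided comparison of the zeta integral at the same pole: `(lam - s) ^ (-m)` is bounded by a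
multiple of `(lam - s) ^ (-m')`. -/
theorem Computes.mult_le {R R' : LogResolution f} {lam : ℝ} {m m' : ℕ}
    (h : R.Computes lam m) (h' : R'.Computes lam m') : m ≤ m' := by
  by_contra! hlt
  obtain ⟨P, hP⟩ := h.2.1
  obtain ⟨c, hc, hlow⟩ := R.exists_lower_bound h.lam_pos h.le_ratio P
  obtain ⟨C, hC, hup⟩ := R'.exists_upper_bound h'.lam_pos h'.le_ratio h'.multAt_le (‖R.ρ P‖ + 1)
  obtain ⟨s, hs, hsl, hsc⟩ := exists_mul_pow_lt (M := C) hc h.lam_pos (n := m - m') (by omega)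
  have hsub : 0 < lam - s := sub_pos.2 hsl
  have h1 := (hlow _ le_rfl s hs hsl).trans (hup s hs hsl)
  have hpow : (lam - s) ^ m = (lam - s) ^ (m - m') * (lam - s) ^ m' := by
    rw [← pow_add, Nat.sub_add_cancel hlt.le]
  rw [ENNReal.ofReal_le_ofReal_iff (by positivity), show R.multAt lam P = m from hP.symm,
    ← div_eq_mul_inv, ← div_eq_mul_inv, hpow, div_le_div_iff₀ (by positivity) (by positivity),
    ← mul_assoc] at h1
  have := le_of_mul_le_mul_right h1 (by positivity)
  linarith

/-- The pair does not depend on the log resolution. -/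
theorem Computes.of_other {R : LogResolution f} {lam : ℝ} {m : ℕ} (h : R.Computes lam m)
    {x : Fin d → ℂ} (hx : MvPolynomial.eval x f = 0) (R' : LogResolution f) :
    R'.Computes lam m := by
  obtain ⟨lam', m', h'⟩ := R'.exists_computes hx
  obtain rfl : lam = lam' := le_antisymm (h'.lam_le h) (h.lam_le h')
  obtain rfl : m = m' := le_antisymm (h.mult_le h') (h'.mult_le h)
  exact h'

end LogResolution
end Arrangement

namespace Arrangement

open Matrix

/-! ### The pair computed by the model -/

namespace Family
variable {d : ℕ} {J : Type} [Fintype J]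

theorem codim_pos {W : Submodule ℂ (Fin d → ℂ)} (hW : W ≠ ⊤) : 0 < codim W := by
  have h1 := finrank_add_codim W
  have h2 := Submodule.finrank_lt hW
  rw [Module.finrank_fin_fun] at h2
  omega

variable [NeZero d] (F : Family d J) (s : J → ℕ) (f : MvPolynomial (Fin d) ℂ)
  (hf : ∀ x, MvPolynomial.eval x f = ∏ j, (F.form j ⬝ᵥ x) ^ s j)

theorem ratio_logResolution (W : F.Index s) :
    (F.logResolution s f hf).ratio W = (codim W.1 : ℝ) / (F.order s W.1 : ℝ) := by
  have h : codim W.1 - 1 + 1 = codim W.1 := Nat.succ_pred_eq_of_pos (codim_pos W.2.1.1)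
  show (((codim W.1 - 1 : ℕ) : ℝ) + 1) / (F.order s W.1 : ℝ) = _
  rw [← Nat.cast_add_one, h]

theorem multAt_logResolution (lam : ℝ) (P : F.Model) :
    (F.logResolution s f hf).multAt lam P = Set.ncard {W | W ∈ F.flats ∧ 0 < F.order s W ∧
      lam = (codim W : ℝ) / (F.order s W : ℝ) ∧ P.1 ∈ F.divisor W} := by
  have h : {W | W ∈ F.flats ∧ 0 < F.order s W ∧
      lam = (codim W : ℝ) / (F.order s W : ℝ) ∧ P.1 ∈ F.divisor W} =
      Subtype.val '' {W : F.Index s | 0 < F.order s W.1 ∧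
        lam = (F.logResolution s f hf).ratio W ∧ P.1 ∈ F.divisor W.1} := by
    ext W
    constructor
    · rintro ⟨h1, h2, h3, h4⟩
      exact ⟨⟨W, h1, Or.inl h2⟩,
        ⟨h2, h3.trans (F.ratio_logResolution s f hf (⟨W, h1, Or.inl h2⟩ : F.Index s)).symm, h4⟩,
        rfl⟩
    · rintro ⟨W, ⟨h2, h3, h4⟩, rfl⟩
      exact ⟨W.2.1, h2, h3.trans (F.ratio_logResolution s f hf W), h4⟩
  rw [h, Set.ncard_image_of_injective _ Subtype.val_injective]
  rfl

end Family

/-! ### Linear forms -/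

variable {d n : ℕ}

/-- The vector of the coefficients of a linear form. -/
def coeffVec (p : MvPolynomial (Fin d) ℂ) : Fin d → ℂ :=
  fun j => MvPolynomial.coeff (Finsupp.single j 1) p

theorem linearFunctional_apply (p : MvPolynomial (Fin d) ℂ) (x : Fin d → ℂ) :
    linearFunctional p x = coeffVec p ⬝ᵥ x := by
  simp [linearFunctional, coeffVec, dotProduct]

theorem eval_eq_dotProduct {p : MvPolynomial (Fin d) ℂ} (hp : p.IsHomogeneous 1)
    (x : Fin d → ℂ) : MvPolynomial.eval x p = coeffVec p ⬝ᵥ x := by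
  have hinj : Function.Injective (fun j : Fin d => (Finsupp.single j 1 : Fin d →₀ ℕ)) :=
    Finsupp.single_left_injective one_ne_zero
  have hsub : p.support ⊆ Finset.univ.map ⟨_, hinj⟩ := by
    intro m hm
    have h1 : m.degree = 1 := by
      rw [Finsupp.degree_eq_weight_one]
      exact hp (MvPolynomial.mem_support_iff.1 hm)
    obtain ⟨j, hj⟩ := (Finsupp.sum_eq_one_iff m).1 h1
    simp [hj]
  rw [MvPolynomial.eval_eq, Finset.sum_subset hsub
    (fun m _ hm => by rw [MvPolynomial.notMem_support_iff.1 hm, zero_mul]), Finset.sum_map]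
  simp only [coeffVec, dotProduct, Function.Embedding.coeFn_mk]
  refine Finset.sum_congr rfl fun j _ => ?_
  congr 1
  rw [Finset.prod_eq_single j]
  · simp
  · intro i _ hij
    simp [hij.symm]
  · simp

theorem coeffVec_ne_zero {p : MvPolynomial (Fin d) ℂ} (hp : p.IsHomogeneous 1) (hp0 : p ≠ 0) :
    coeffVec p ≠ 0 := fun h => hp0 (MvPolynomial.funext fun x => by
  rw [eval_eq_dotProduct hp, h, zero_dotProduct, map_zero])

/-- The forms of an arrangement together with the coordinate functions. -/
def formsWithCoordinates (L : Fin n → MvPolynomial (Fin d) ℂ) (hL : ∀ i, (L i).IsHomogeneous 1)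
    (hL0 : ∀ i, L i ≠ 0) : Family d (Fin n ⊕ Fin d) where
  form := Sum.elim (fun i => coeffVec (L i)) fun i => Pi.single i 1
  ne_zero := by
    rintro (i | i)
    · exact coeffVec_ne_zero (hL i) (hL0 i)
    · exact fun h => one_ne_zero (by simpa using congrFun h i : (1 : ℂ) = 0)
  spanning := by
    refine ⟨Sum.inr, ?_⟩
    have : rows (Sum.elim (fun i => coeffVec (L i)) fun i : Fin d => Pi.single i (1 : ℂ)) Sum.inr
        = 1 := by
      ext i j
      simp [rows, Matrix.one_apply, Pi.single_apply, eq_comm]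
    rw [this, det_one]
    exact one_ne_zero

section
variable {L : Fin n → MvPolynomial (Fin d) ℂ} {hL : ∀ i, (L i).IsHomogeneous 1}
  {hL0 : ∀ i, L i ≠ 0} {s : Fin n → ℕ}

theorem hyper_inl (i : Fin n) :
    (formsWithCoordinates L hL hL0).hyper (Sum.inl i) = hyperplane (L i) := by
  ext x
  rw [Family.mem_hyper, hyperplane, LinearMap.mem_ker, linearFunctional_apply]
  rfl

theorem eval_prod_eq (x : Fin d → ℂ) : MvPolynomial.eval x (∏ i, L i ^ s i) =
    ∏ j, ((formsWithCoordinates L hL hL0).form j ⬝ᵥ x) ^ (Sum.elim s (fun _ => 0)) j := by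
  simp only [map_prod, map_pow, Fintype.prod_sum_type, Sum.elim_inl, Sum.elim_inr, pow_zero,
    Finset.prod_const_one, mul_one, eval_eq_dotProduct (hL _)]
  rfl

theorem order_eq_weight (W : Submodule ℂ (Fin d → ℂ)) :
    (formsWithCoordinates L hL hL0).order (Sum.elim s (fun _ => 0)) W =
      weight (fun i => hyperplane (L i)) s W := by
  classical
  simp only [Family.order, weight, Finset.sum_filter, Fintype.sum_sum_type, Sum.elim_inl,
    Sum.elim_inr, ite_self, Finset.sum_const_zero, add_zero, hyper_inl]

theorem lattice_subset_flats : intersectionLattice (Set.range fun i => hyperplane (L i)) ⊆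
    (formsWithCoordinates L hL hL0).flats := by
  rintro W ⟨hW, S, hS, rfl⟩
  refine ⟨hW, S, hS.trans ?_, rfl⟩
  rintro _ ⟨i, rfl⟩
  exact ⟨Sum.inl i, hyper_inl i⟩

end

/-! ### Slopes in the intersection lattice -/

section
variable {H : Fin n → Submodule ℂ (Fin d → ℂ)} {s : Fin n → ℕ}

theorem weight_pos (hs : ∀ i, 0 < s i) {W : Submodule ℂ (Fin d → ℂ)}
    (hW : W ∈ intersectionLattice (Set.range H)) : 0 < weight H s W := by
  classical
  obtain ⟨hW, S, hS, rfl⟩ := hW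
  obtain ⟨U, hU⟩ : S.Nonempty := by
    rw [Set.nonempty_iff_ne_empty]
    rintro rfl
    exact hW sInf_empty
  obtain ⟨i, rfl⟩ := hS hU
  exact Finset.sum_pos (fun i _ => hs i) ⟨i, by simpa using sInf_le hU⟩

theorem mem_lattice_of_hyperplane {i : Fin n} (hi : H i ≠ ⊤) :
    H i ∈ intersectionLattice (Set.range H) :=
  ⟨hi, {H i}, by simp, by simp⟩

/-- Every hyperplane belongs to every building set. -/
theorem IsBuildingSet.hyperplane_mem {𝒢 : Set (Submodule ℂ (Fin d → ℂ))}
    (h𝒢 : IsBuildingSet (Set.range H) 𝒢) (hH : ∀ i, Module.finrank ℂ (H i) + 1 = d) (i : Fin n)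
    (hi : H i ≠ ⊤) : H i ∈ 𝒢 := by
  obtain ⟨h1, -⟩ := h𝒢.2 _ (mem_lattice_of_hyperplane hi)
  obtain ⟨U, hU⟩ : {U | Minimal (fun U => U ∈ 𝒢 ∧ H i ≤ U) U}.Nonempty := by
    rw [Set.nonempty_iff_ne_empty]
    intro h
    rw [h, sInf_empty] at h1
    exact hi h1.symm
  have hUtop : U ≠ ⊤ := (h𝒢.1 hU.1.1).1
  have hlt := Submodule.finrank_lt hUtop
  rw [Module.finrank_fin_fun] at hlt
  have hle := hU.1.2
  have heq : H i = U := Submodule.eq_of_le_of_finrank_le hle (by have := hH i; omega)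
  rw [heq]
  exact hU.1.1

/-- A lower bound for the slopes on a building set is a lower bound on the intersection lattice:
codimensions add up over the minimal elements above `C`, and every hyperplane through `C` contains
one of these. -/
theorem IsBuildingSet.mul_weight_le {𝒢 : Set (Submodule ℂ (Fin d → ℂ))}
    (h𝒢 : IsBuildingSet (Set.range H) 𝒢) (hmem : ∀ i, H i ∈ 𝒢) {μ : ℝ} (hμ : 0 ≤ μ)
    (hlow : ∀ U ∈ 𝒢, μ * weight H s U ≤ codim U) {C : Submodule ℂ (Fin d → ℂ)}
    (hC : C ∈ intersectionLattice (Set.range H)) : μ * weight H s C ≤ codim C := by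
  classical
  have hfin𝒢 : 𝒢.Finite := (Family.finite_intersectionLattice (Set.finite_range H)).subset h𝒢.1
  have hfin : {U | Minimal (fun U => U ∈ 𝒢 ∧ C ≤ U) U}.Finite := hfin𝒢.subset fun U hU => hU.1.1
  obtain ⟨-, hcodim⟩ := h𝒢.2 C hC
  rw [finsum_mem_eq_finite_toFinset_sum _ hfin] at hcodim
  have hweight : weight H s C ≤ ∑ U ∈ hfin.toFinset, weight H s U := by
    simp only [weight, Finset.sum_filter]
    rw [Finset.sum_comm]
    refine Finset.sum_le_sum fun j _ => ?_
    split_ifs with hj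
    · have hfinC : {U | U ∈ 𝒢 ∧ C ≤ U}.Finite := hfin𝒢.subset fun U hU => hU.1
      obtain ⟨U, hUj, hU⟩ := hfinC.exists_le_minimal (a := H j) ⟨hmem j, hj⟩
      have hUmem : U ∈ hfin.toFinset := hfin.mem_toFinset.2 hU
      refine le_trans ?_ (Finset.single_le_sum (fun _ _ => Nat.zero_le _) hUmem)
      rw [if_pos hUj]
    · exact Nat.zero_le _
  calc μ * weight H s C ≤ μ * ((∑ U ∈ hfin.toFinset, weight H s U : ℕ) : ℝ) := by
        gcongr
    _ = ∑ U ∈ hfin.toFinset, μ * (weight H s U : ℝ) := by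
        rw [Nat.cast_sum, Finset.mul_sum]
    _ ≤ ∑ U ∈ hfin.toFinset, (codim U : ℝ) := Finset.sum_le_sum fun U hU =>
        hlow U (hfin.mem_toFinset.1 hU).1.1
    _ = codim C := by rw [← Nat.cast_sum, hcodim]

/-- Every subspace of positive weight lies in an element of the intersection lattice of the same
weight; the slope is smaller unless the two spaces are equal. -/
theorem exists_lattice_slope_le {W : Submodule ℂ (Fin d → ℂ)} (hH : ∀ i, H i ≠ ⊤)
    (hW : 0 < weight H s W) : ∃ C ∈ intersectionLattice (Set.range H),
      slope H s C ≤ slope H s W ∧ (slope H s C = slope H s W → W = C) := by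
  classical
  let C := sInf {U | U ∈ Set.range H ∧ W ≤ U}
  have hWC : W ≤ C := le_sInf fun U hU => hU.2
  have hiff : ∀ i, C ≤ H i ↔ W ≤ H i := fun i =>
    ⟨hWC.trans, fun h => sInf_le ⟨⟨i, rfl⟩, h⟩⟩
  have hweight : weight H s C = weight H s W := by
    simp only [weight, hiff]
  have hCmem : C ∈ intersectionLattice (Set.range H) := by
    refine ⟨fun htop => ?_, _, fun U hU => hU.1, rfl⟩
    obtain ⟨i, hi, -⟩ := Finset.exists_ne_zero_of_sum_ne_zero hW.ne'
    exact hH i (top_le_iff.1 (htop ▸ (hiff i).2 (Finset.mem_filter.1 hi).2))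
  have hcodim : codim C ≤ codim W := by
    have h1 := Family.finrank_add_codim W
    have h2 := Family.finrank_add_codim C
    have h3 := Submodule.finrank_mono hWC
    omega
  have hW' : (0 : ℝ) < weight H s W := by exact_mod_cast hW
  refine ⟨C, hCmem, ?_, fun heq => ?_⟩
  · rw [slope, slope, hweight]
    gcongr
  · rw [slope, slope, hweight, div_left_inj' hW'.ne', Nat.cast_inj] at heq
    refine Submodule.eq_of_le_of_finrank_le hWC ?_
    have h1 := Family.finrank_add_codim W
    have h2 := Family.finrank_add_codim C
    omega

/-- A nonempty finite chain of proper subspaces is the range of a monotone sequence of length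
`d`. -/
theorem exists_monotone_range_eq {𝒞 : Set (Submodule ℂ (Fin d → ℂ))} (hfin : 𝒞.Finite)
    (hne : 𝒞.Nonempty) (hchain : IsChain (· ≤ ·) 𝒞) (htop : ∀ U ∈ 𝒞, U ≠ ⊤) :
    ∃ W : Fin d → Submodule ℂ (Fin d → ℂ), Monotone W ∧ Set.range W = 𝒞 := by
  obtain ⟨U₀, hU₀⟩ := hfin.exists_minimal hne
  have hU₀le : ∀ U ∈ 𝒞, U₀ ≤ U := fun U hU => by
    rcases hchain.total hU₀.1 hU with h | h
    · exact h
    · exact hU₀.2 hU h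
  -- the `i`-th term is the largest member of dimension at most `i`, or the smallest member
  let T : Fin d → Set (Submodule ℂ (Fin d → ℂ)) := fun i =>
    insert U₀ {U | U ∈ 𝒞 ∧ Module.finrank ℂ U ≤ i}
  have hT : ∀ i, T i ⊆ 𝒞 := fun i => Set.insert_subset hU₀.1 fun U hU => hU.1
  refine ⟨fun i => sSup (T i), fun i k hik => sSup_le_sSup (Set.insert_subset_insert
    fun U hU => ⟨hU.1, hU.2.trans hik⟩), Set.Subset.antisymm ?_ fun U hU => ?_⟩
  · rintro _ ⟨i, rfl⟩
    obtain ⟨M, hM⟩ := (hfin.subset (hT i)).exists_maximal ⟨U₀, Set.mem_insert _ _⟩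
    have : sSup (T i) = M := by
      refine le_antisymm (sSup_le fun U hU => ?_) (le_sSup hM.1)
      rcases hchain.total (hT i hU) (hT i hM.1) with h | h
      · exact h
      · exact hM.2 hU h
    show sSup (T i) ∈ 𝒞
    rw [this]
    exact hT i hM.1
  · have hlt := Submodule.finrank_lt (htop U hU)
    rw [Module.finrank_fin_fun] at hlt
    refine ⟨⟨_, hlt⟩, le_antisymm (sSup_le ?_) (le_sSup (Set.mem_insert_of_mem _ ⟨hU, le_rfl⟩))⟩
    rintro U' (rfl | ⟨hU', hle⟩)
    · exact hU₀le U hU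
    · rcases hchain.total hU' hU with h | h
      · exact h
      · exact (Submodule.eq_of_le_of_finrank_le h hle).ge

end
end Arrangement
end

theorem mainTheorem2 {d n : ℕ} (hn : 0 < n)
    (L : Fin n → MvPolynomial (Fin d) ℂ) (hL : ∀ i, (L i).IsHomogeneous 1) (hL0 : ∀ i, L i ≠ 0)
    (s : Fin n → ℕ) (hs : ∀ i, 0 < s i)
    (𝒢 : Set (Submodule ℂ (Fin d → ℂ)))
    (h𝒢 : Arrangement.IsBuildingSet (Set.range fun i => Arrangement.hyperplane (L i)) 𝒢) :
    ∃ (lam : ℝ) (m : ℕ), Arrangement.IsLCT (∏ i, L i ^ s i) lam m ∧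
      IsLeast (Arrangement.slope (fun i => Arrangement.hyperplane (L i)) s '' 𝒢) lam ∧
      IsGreatest {k : ℕ | ∃ W : Fin d → Submodule ℂ (Fin d → ℂ),
        (∀ i, W i ∈ Arrangement.intersectionLattice
          (Set.range fun i => Arrangement.hyperplane (L i))) ∧
        Monotone W ∧
        k = Set.ncard {U | U ∈ Set.range W ∧
          lam = Arrangement.slope (fun i => Arrangement.hyperplane (L i)) s U}} m := by
  open Arrangement in
  classical
  have hd : NeZero d := ⟨by
    rintro rfl
    exact coeffVec_ne_zero (hL ⟨0, hn⟩) (hL0 _) (Subsingleton.elim _ _)⟩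
  set H : Fin n → Submodule ℂ (Fin d → ℂ) := fun i => hyperplane (L i) with hHdef
  let F := formsWithCoordinates L hL hL0
  let s' : Fin n ⊕ Fin d → ℕ := Sum.elim s fun _ => 0
  let f := ∏ i, L i ^ s i
  have hf : ∀ x, MvPolynomial.eval x f = ∏ j, (F.form j ⬝ᵥ x) ^ s' j := eval_prod_eq
  have hFH : ∀ i, F.hyper (Sum.inl i) = H i := hyper_inl
  have hord : ∀ W, F.order s' W = weight H s W := order_eq_weight
  have hHtop : ∀ i, H i ≠ ⊤ := fun i => hFH i ▸ F.hyper_ne_top _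
  have hHdim : ∀ i, Module.finrank ℂ (H i) + 1 = d := fun i => by
    have h1 := Module.Dual.finrank_ker_add_one_of_ne_zero (f := linearFunctional (L i)) (by
      intro h0
      apply hHtop i
      show LinearMap.ker (linearFunctional (L i)) = ⊤
      rw [h0, LinearMap.ker_zero])
    rwa [Module.finrank_fin_fun] at h1
  have hflats : ∀ W ∈ intersectionLattice (Set.range H), W ∈ F.flats :=
    fun W hW => lattice_subset_flats hW
  have hmem : ∀ i, H i ∈ 𝒢 := fun i => h𝒢.hyperplane_mem hHdim i (hHtop i)
  have hfin𝒢 : 𝒢.Finite := (Family.finite_intersectionLattice (Set.finite_range H)).subset h𝒢.1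
  -- the smallest slope on the building set is the smallest slope on the intersection lattice
  obtain ⟨W₀, hW₀, hmin⟩ := Set.exists_min_image 𝒢 (slope H s) hfin𝒢 ⟨_, hmem ⟨0, hn⟩⟩
  have hwpos : ∀ W ∈ intersectionLattice (Set.range H), (0 : ℝ) < weight H s W := fun W hW => by
    exact_mod_cast weight_pos hs hW
  have hslope0 : 0 ≤ slope H s W₀ := by
    rw [Arrangement.slope]
    positivity
  have hlat : ∀ W ∈ intersectionLattice (Set.range H), slope H s W₀ ≤ slope H s W := by
    intro W hW
    have h1 := h𝒢.mul_weight_le (s := s) hmem hslope0 (fun U hU => by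
      have := hmin U hU
      rwa [Arrangement.slope.eq_def H s U, le_div_iff₀ (hwpos U (h𝒢.1 hU))] at this) hW
    rwa [Arrangement.slope.eq_def H s W, le_div_iff₀ (hwpos W hW)]
  have hflat : ∀ W, 0 < F.order s' W → slope H s W₀ ≤ slope H s W ∧
      (slope H s W₀ = slope H s W → W ∈ intersectionLattice (Set.range H)) := by
    intro W hW
    rw [hord] at hW
    obtain ⟨C, hC, h1, h2⟩ := exists_lattice_slope_le hHtop hW
    refine ⟨(hlat C hC).trans h1, fun heq => ?_⟩
    rw [h2 (le_antisymm h1 (heq ▸ hlat C hC))]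
    exact hC
  have hslope : ∀ W, (codim W : ℝ) / (F.order s' W : ℝ) = slope H s W := fun W => by
    rw [hord, Arrangement.slope]
  -- the pair computed by the model
  let R := F.logResolution s' f hf
  have hf0 : MvPolynomial.eval 0 f = 0 := by
    rw [hf]
    refine Finset.prod_eq_zero (Finset.mem_univ (Sum.inl ⟨0, hn⟩)) ?_
    rw [dotProduct_zero]
    exact zero_pow (hs _).ne'
  obtain ⟨lam, m, hR⟩ := R.exists_computes hf0
  have hlam : lam = slope H s W₀ := by
    refine hR.1.unique ⟨?_, ?_⟩
    · have hpos : 0 < F.order s' W₀ := by rw [hord]; exact weight_pos hs (h𝒢.1 hW₀)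
      refine ⟨(⟨W₀, hflats _ (h𝒢.1 hW₀), Or.inl hpos⟩ : F.Index s'), hpos, ?_⟩
      exact ((F.ratio_logResolution s' f hf
        (⟨W₀, hflats _ (h𝒢.1 hW₀), Or.inl hpos⟩ : F.Index s')).trans (hslope _)).symm
    · rintro _ ⟨W, hW, rfl⟩
      exact (hflat W.1 hW).1.trans_eq ((F.ratio_logResolution s' f hf W).trans (hslope _)).symm
  have hmult : ∀ P : F.Model, R.multAt lam P = Set.ncard {W | W ∈ intersectionLattice (Set.range H)
      ∧ lam = slope H s W ∧ P.1 ∈ F.divisor W} := by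
    intro P
    rw [Family.multAt_logResolution]
    congr 1
    ext W
    simp only [Set.mem_ofPred_eq, hslope]
    constructor
    · rintro ⟨-, h2, h3, h4⟩
      exact ⟨(hflat W h2).2 (hlam ▸ h3), h3, h4⟩
    · rintro ⟨h1, h2, h3⟩
      exact ⟨hflats _ h1, by rw [hord]; exact weight_pos hs h1, h2, h3⟩
  have hfinP : ∀ P : F.Model, {W | W ∈ intersectionLattice (Set.range H)
      ∧ lam = slope H s W ∧ P.1 ∈ F.divisor W}.Finite := fun P =>
    (Family.finite_intersectionLattice (Set.finite_range H)).subset fun W hW => hW.1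
  refine ⟨lam, m, ⟨⟨R⟩, fun R' => hR.of_other hf0 R'⟩, ⟨⟨W₀, hW₀, hlam.symm⟩, ?_⟩, ?_, ?_⟩
  · rintro _ ⟨W, hW, rfl⟩
    rw [hlam]
    exact hmin W hW
  · -- the divisors through a point of maximal multiplicity give a chain
    obtain ⟨P, hP⟩ := hR.2.1
    have hm : m = _ := hP.trans (hmult P)
    have hchain : IsChain (· ≤ ·) {W | W ∈ intersectionLattice (Set.range H)
        ∧ lam = slope H s W ∧ P.1 ∈ F.divisor W} := by
      refine (F.isChain_divisors P).mono ?_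
      rintro W ⟨hW, -, hPW⟩
      exact ⟨hflats _ hW, hPW⟩
    obtain ⟨W, hWmono, hWrange⟩ := exists_monotone_range_eq (hfinP P)
      (Set.nonempty_of_ncard_ne_zero (hm ▸ hR.mult_ne_zero)) hchain fun U hU => hU.1.1
    refine ⟨W, fun i => ?_, hWmono, ?_⟩
    · have : W i ∈ Set.range W := ⟨i, rfl⟩
      rw [hWrange] at this
      exact this.1
    · rw [hm, hWrange]
      congr 1
      ext U
      exact ⟨fun h => ⟨h, h.2.1⟩, fun h => h.1⟩
  · -- the divisors of a chain have a common point
    rintro _ ⟨W, hW, hmono, rfl⟩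
    have hfin : {U | U ∈ Set.range W ∧ lam = slope H s U}.Finite :=
      (Set.finite_range W).subset fun U hU => hU.1
    obtain ⟨P, hP⟩ := F.exists_mem_divisors hfin.toFinset
      (fun U hU => by
        obtain ⟨⟨i, rfl⟩, -⟩ := hfin.mem_toFinset.1 hU
        exact hflats _ (hW i))
      (by
        rw [hfin.coe_toFinset]
        rintro _ ⟨⟨i, rfl⟩, -⟩ _ ⟨⟨k, rfl⟩, -⟩ -
        rcases le_total i k with h | h
        · exact Or.inl (hmono h)
        · exact Or.inr (hmono h))
    refine le_trans ?_ (hR.multAt_le P)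
    rw [hmult P]
    refine Set.ncard_le_ncard ?_ (hfinP P)
    rintro U hU
    have hPU := hP U (hfin.mem_toFinset.2 hU)
    obtain ⟨⟨i, rfl⟩, hU2⟩ := hU
    exact ⟨hW i, hU2, hPU⟩
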